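/- Let $E=\{1,\dots,n\}$ and let $J$ be a càdlàg continuous-time Markov chain on $E$ with intensity matrix $Q=(q_{kj})$. Let $N$ be a Markov-modulated Poisson process with intensities $\lambda_k\ge 0$: a counting process, $N_0=0$, whose increments over disjoint intervals $(s,u]$ are, conditionally on $J$, independent and Poisson distributed with means $\int_s^u\lambda_{J_v}\,dv$. Let $C^{(k)}_m$ and $C^{(k,j)}_m$ ($k,j\in E$, $m\ge1$) be independent random variables with laws $F^{(k)}_C$ and $F^{(k,j)}_C$ on $[0,\infty)$, jointly independent of $(J,N)$. Let $p_1,\dots,p_n\in\mathbb R$. Write $T^N_m$ for the successive arrival epochs of $N$ and $T_m$ for the successive jump epochs of $J$, and for $x\in\mathbb R$ let $$X_t=x+\int_0^t p_{J_u}\,du-\sum_{m=1}^{N_t}C_m^{(J_{T^N_m})}-\sum_{m:\,T_m\le t}C_m^{(J_{T_m-},J_{T_m})}.$$ Let $T^C_1<T^C_2<\cdots$ be the epochs that are arrival epochs of $N$ or jump epochs of $J$, and put $$\nu^{(k,j)}(dy)=\mathbf 1_{\{k=j\}}\,\lambda_k F^{(k)}_C(dy)+\mathbf 1_{\{k\ne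 j\}}\,q_{kj}F^{(k,j)}_C(dy).$$ Let $\mathbb E_{x,i}$ denote expectation given $X_0=x$, $J_0=i$. **Theorem.** For every bounded measurable function $f:[0,\infty)\times\mathbb R\times\mathbb R\times E^2\to\mathbb R$, every $x\in\mathbb R$, $i\in E$ and $t\ge0$, $$\mathbb E_{x,i}\Big[\sum_{T^C_m\le t} f\big(T^C_m,X_{T^C_m-},X_{T^C_m},J_{T^C_m-},J_{T^C_m}\big)\Big]=\sum_{k,j\in E}\int_{[0,\infty)}\mathbb E_{x,i}\Big[\int_0^t f(s,X_s,X_s-y,k,j)\,\mathbf 1_{\{J_s=k\}}\,ds\Big]\nu^{(k,j)}(dy).$$ Here the sum inside the expectation on the left is integrable, and, for all $k,j$, the function $(y,\omega,s)\mapsto f(s,X_s,X_s-y,k,j)\mathbf 1_{\{J_s=k\}}$ is integrable with respect to $\nu^{(k,j)}\otimes\mathbb P_{x,i}\otimes ds$ on $[0,\infty)\times\Omega\times(0,t]$. -/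

import Mathlib

open MeasureTheory ProbabilityTheory Filter Topology
open scoped NNReal ENNReal

noncomputable section

namespace MMRisk

/-- Parameters of a Markov modulated risk process with environment space `E = Fin n`. -/
structure RiskParameters (n : ℕ) where
  /-- The intensity matrix of the environmental Markov chain. -/
  Q : Matrix (Fin n) (Fin n) ℝ
  Q_nonneg : ∀ i j, i ≠ j → 0 ≤ Q i j
  Q_row_sum : ∀ i, ∑ j, Q i j = 0
  /-- The claim arrival intensities. -/
  rate : Fin n → ℝ≥0
  /-- The premium intensities. -/
  premium : Fin n → ℝ
  /-- The law of the claims arriving while the environment is in state `i`. -/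
  claimLaw : Fin n → Measure ℝ
  claimLaw_prob : ∀ i, IsProbabilityMeasure (claimLaw i)
  claimLaw_nonneg : ∀ i, claimLaw i (Set.Iio 0) = 0
  /-- The law of the claims triggered by a transition of the environment from `i` to `j`. -/
  switchLaw : Fin n → Fin n → Measure ℝ
  switchLaw_prob : ∀ i j, IsProbabilityMeasure (switchLaw i j)
  switchLaw_nonneg : ∀ i j, switchLaw i j (Set.Iio 0) = 0

/-- The measures `ν^{(k,j)}`: an epoch at which the environment stays in `k` is a claim arrival,
an epoch at which it moves from `k` to `j ≠ k` is a transition. -/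
def RiskParameters.nu {n : ℕ} (R : RiskParameters n) (k j : Fin n) : Measure ℝ :=
  if k = j then R.rate k • R.claimLaw k else ENNReal.ofReal (R.Q k j) • R.switchLaw k j

/-- Right continuous with left limits (the left limit at time `0` is vacuous). -/
def IsCadlagPath {α : Type*} [TopologicalSpace α] (g : ℝ≥0 → α) : Prop :=
  ∀ t, ContinuousWithinAt g (Set.Ici t) t ∧ ∃ a, Tendsto g (𝓝[<] t) (𝓝 a)

/-- The set of times in `(0, ∞)` at which the path `g` jumps. -/
def jumpSet {α : Type*} [TopologicalSpace α] (g : ℝ≥0 → α) : Set ℝ≥0 :=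
  {s | 0 < s ∧ Function.leftLim g s ≠ g s}

/-- A càdlàg path in a discrete space has finitely many jumps up to any time, so that the
cardinality in `jumpCount` and the finite sum in `jumpSum` below are genuine. -/
theorem finite_jumpSet {α : Type*} [TopologicalSpace α] [DiscreteTopology α] {g : ℝ≥0 → α}
    (hg : IsCadlagPath g) (t : ℝ≥0) : (jumpSet g ∩ Set.Iic t).Finite := by
  by_contra hinf
  obtain ⟨x, -, hx⟩ := Set.Infinite.exists_accPt_of_subset_isCompact
    (s := jumpSet g ∩ Set.Iic t) hinf (isCompact_Icc (a := (0 : ℝ≥0)) (b := t))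
    (fun s hs => ⟨zero_le, hs.2⟩)
  rw [accPt_iff_frequently_nhdsNE] at hx
  have key : ∀ y a, (∀ᶠ z in 𝓝 y, g z = a) → y ∉ jumpSet g := by
    intro y a h hy
    have hne : (𝓝[<] y).NeBot := nhdsLT_neBot_of_exists_lt ⟨0, hy.1⟩
    apply hy.2
    rw [h.self_of_nhds]
    apply leftLim_eq_of_tendsto
    exact tendsto_const_nhds.congr' ((h.filter_mono nhdsWithin_le_nhds).mono fun z hz => hz.symm)
  apply hx
  rw [← Set.Iio_union_Ioi, nhdsWithin_union]
  obtain ⟨hr, a, hl⟩ := hg x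
  have hr' : Tendsto g (𝓝[>] x) (𝓝 (g x)) := hr.mono Set.Ioi_subset_Ici_self
  rw [nhds_discrete, tendsto_pure] at hl hr'
  refine Filter.eventually_sup.2 ⟨?_, ?_⟩
  · filter_upwards [eventually_eventually_nhdsWithin.2 hl, self_mem_nhdsWithin] with y h hy hS
    rw [isOpen_Iio.nhdsWithin_eq hy] at h
    exact key y _ h hS.1
  · filter_upwards [eventually_eventually_nhdsWithin.2 hr', self_mem_nhdsWithin] with y h hy hS
    rw [isOpen_Ioi.nhdsWithin_eq hy] at h
    exact key y _ h hS.1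

/-- The number of jumps of the path `g` in `(0, t]`. -/
def jumpCount {α : Type*} [TopologicalSpace α] (g : ℝ≥0 → α) (t : ℝ≥0) : ℕ :=
  (jumpSet g ∩ Set.Iic t).ncard

/-- The `k`-th arrival epoch of a counting path. -/
def arrivalTime (a : ℝ≥0 → ℕ) (k : ℕ) : ℝ≥0 := sInf {u | k ≤ a u}

section

variable {n : ℕ} {Ω : Type*}

/-- The family of all claims: `C i k` is the `k`-th claim for arrivals in state `i`,
and `D i j k` is the `k`-th claim for transitions from `i` to `j`. -/
def allClaims (C : Fin n → ℕ → Ω → ℝ) (D : Fin n → Fin n → ℕ → Ω → ℝ) :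
    (Fin n × ℕ) ⊕ (Fin n × Fin n × ℕ) → Ω → ℝ :=
  Sum.elim (fun a => C a.1 a.2) (fun a => D a.1 a.2.1 a.2.2)

/-- The accumulated arrival intensity `∫_s^t λ_{J_u} du`. -/
def cumRate (R : RiskParameters n) (J : ℝ≥0 → Ω → Fin n) (s t : ℝ≥0) (ω : Ω) : ℝ :=
  ∫ u in (s : ℝ)..(t : ℝ), (R.rate (J u.toNNReal ω) : ℝ)

/-- `J` is a càdlàg continuous time Markov chain with intensity matrix `Q` started at `i`. -/
structure IsMarkovChain [MeasurableSpace Ω] (Q : Matrix (Fin n) (Fin n) ℝ) (i : Fin n)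
    (μ : Measure Ω) (J : ℝ≥0 → Ω → Fin n) : Prop where
  measurable : ∀ t, Measurable (J t)
  cadlag : ∀ ω, IsCadlagPath (fun t => J t ω)
  fdd : ∀ (m : ℕ) (τ : Fin (m + 1) → ℝ≥0), Monotone τ → τ 0 = 0 → ∀ e : Fin (m + 1) → Fin n,
    μ.real {ω | ∀ l, J (τ l) ω = e l} =
      (if e 0 = i then 1 else 0) *
        ∏ l : Fin m, NormedSpace.exp ((τ l.succ - τ l.castSucc) • Q) (e l.castSucc) (e l.succ)

/-- `N` is a Markov modulated Poisson process: a counting process whose increments,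
conditionally on the whole environment `J`, are independent and Poisson distributed with
means `∫ λ_{J_u} du` over the respective time intervals. -/
structure IsModulatedPoisson [MeasurableSpace Ω] (R : RiskParameters n)
    (μ : Measure Ω) (J : ℝ≥0 → Ω → Fin n) (N : ℝ≥0 → Ω → ℕ) : Prop where
  measurable : ∀ t, Measurable (N t)
  zero : ∀ ω, N 0 ω = 0
  mono : ∀ ω, Monotone (fun t => N t ω)
  cadlag : ∀ ω, IsCadlagPath (fun t => N t ω)
  cond_increments : ∀ (m : ℕ) (τ : Fin (m + 1) → ℝ≥0), Monotone τ → ∀ (a : Fin m → ℕ) (S : Set Ω),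
    MeasurableSet[⨆ t, MeasurableSpace.comap (J t) inferInstance] S →
    μ.real (S ∩ {ω | ∀ l : Fin m, N (τ l.succ) ω = N (τ l.castSucc) ω + a l}) =
      ∫ ω in S, ∏ l : Fin m,
        (Real.exp (-cumRate R J (τ l.castSucc) (τ l.succ) ω) *
          cumRate R J (τ l.castSucc) (τ l.succ) ω ^ a l / (a l).factorial) ∂μ

/-- The ingredients of the Markov modulated risk process under the law with `J_0 = i`:
environment, claim arrivals, and independent claim sizes with the prescribed laws, which are
independent of the environment and of the claim arrivals. -/
structure IsRiskModel [MeasurableSpace Ω] (R : RiskParameters n) (i : Fin n) (μ : Measure Ω)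
    (J : ℝ≥0 → Ω → Fin n) (N : ℝ≥0 → Ω → ℕ)
    (C : Fin n → ℕ → Ω → ℝ) (D : Fin n → Fin n → ℕ → Ω → ℝ) : Prop where
  chain : IsMarkovChain R.Q i μ J
  arrivals : IsModulatedPoisson R μ J N
  measurable_C : ∀ i k, Measurable (C i k)
  measurable_D : ∀ i j k, Measurable (D i j k)
  law_C : ∀ i k, μ.map (C i k) = R.claimLaw i
  law_D : ∀ i j k, μ.map (D i j k) = R.switchLaw i j
  indep_claims : iIndepFun (allClaims C D) μ
  indep_env : IndepFun (fun ω c => allClaims C D c ω) (fun ω t => (J t ω, N t ω)) μ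

/-- The Markov modulated risk process with initial capital `x`. -/
def riskProcess (R : RiskParameters n) (x : ℝ) (J : ℝ≥0 → Ω → Fin n) (N : ℝ≥0 → Ω → ℕ)
    (C : Fin n → ℕ → Ω → ℝ) (D : Fin n → Fin n → ℕ → Ω → ℝ) (t : ℝ≥0) (ω : Ω) : ℝ :=
  x + (∫ u in (0 : ℝ)..(t : ℝ), R.premium (J u.toNNReal ω))
    - (∑ k ∈ Finset.Icc 1 (N t ω), C (J (arrivalTime (fun u => N u ω) k) ω) k ω)
    - ∑ k ∈ Finset.Icc 1 (jumpCount (fun u => J u ω) t),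
        D (Function.leftLim (fun u => J u ω) (arrivalTime (jumpCount (fun u => J u ω)) k))
          (J (arrivalTime (jumpCount (fun u => J u ω)) k) ω) k ω

/-- The set of epochs `T^C_k`: the claim arrivals and the transitions of the environment. -/
def epochs (J : ℝ≥0 → Ω → Fin n) (N : ℝ≥0 → Ω → ℕ) (ω : Ω) : Set ℝ≥0 :=
  jumpSet (fun u => N u ω) ∪ jumpSet (fun u => J u ω)

/-- The sum of `f(s, X_{s-}, X_s, J_{s-}, J_s)` over the epochs `s ≤ t`. -/
def jumpSum (f : ℝ≥0 → ℝ → ℝ → Fin n → Fin n → ℝ) (X : ℝ≥0 → Ω → ℝ)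
    (J : ℝ≥0 → Ω → Fin n) (N : ℝ≥0 → Ω → ℕ) (t : ℝ≥0) (ω : Ω) : ℝ :=
  ∑ᶠ s ∈ epochs J N ω ∩ Set.Iic t,
    f s (Function.leftLim (fun u => X u ω) s) (X s ω) (Function.leftLim (fun u => J u ω) s) (J s ω)

/-- The integrand `f(s, X_s, X_s - y, k, j) 1{J_s = k}`. -/
def compIntegrand (f : ℝ≥0 → ℝ → ℝ → Fin n → Fin n → ℝ) (X : ℝ≥0 → Ω → ℝ)
    (J : ℝ≥0 → Ω → Fin n) (k j : Fin n) (y : ℝ) (ω : Ω) (s : ℝ≥0) : ℝ :=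
  if J s ω = k then f s (X s ω) (X s ω - y) k j else 0

end

end MMRisk

end

/-! The environment and the arrival count together form one càdlàg path `joint` in a countable
discrete space, and the theorem is a Campbell formula for its marked jumps. Given the past, a jump
of type `(k, j)` (an arrival in state `k` if `k = j`, a transition otherwise) occurs during a time
`d` spent from state `k` on with probability `jumpRate R k j * d + o(d)`. A double arrival, or an
arrival together with a change of state, has probability `O(d²)`. Summed over finer and finer
partitions, the first estimate yields the compensator of the jumps
(`IsRiskModel.setLIntegral_jsum_jumpInd`), and the second excludes irregular jumps almost surely
(`IsRiskModel.lintegral_jsum_irregularInd`).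

The conditioning is on `history`, which contains all claims, past and future, from time `0` on. This
is harmless because the claims are independent of environment and arrivals (`IsRiskModel.markov`,
`IsRiskModel.poisson`). It has the advantage that the claim which would be paid at the next epoch,
`nextClaim`, is known before that epoch. At a jump of type `(k, j)` the risk process falls from its
left limit by the left limit of `nextClaim` (`riskProcess_of_isJump`), so the summand is predictable
once the type is fixed. The compensator identity is the assertion for the sets `B ×ˢ Set.Ioi s`,
which form a π-system generating the predictable σ-algebra; `IsRiskModel.lintegral_sum_jumps`
extends it to all nonnegative predictable integrands.

Under `ds` the left limits may be replaced by values. At a fixed time the claim due next has not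
entered the risk process, hence it is independent of the current risk value and state and can be
integrated out against its law (`IsRiskModel.lintegral_nextClaim`). This proves the formula for
nonnegative functions (`IsRiskModel.lintegral_epochSum`). A bounded `f` is the difference of its
positive and negative part; all terms are finite because each `R.nu k j` is finite and time is
bounded. -/

noncomputable section

namespace MMRisk

/-! ### Càdlàg paths in discrete spaces: jumps, jump counts, arrival times -/

section Paths

variable {α : Type*} [TopologicalSpace α] {g : ℝ≥0 → α}

theorem isCadlagPath_of_eventually (h : ∀ v, (∀ᶠ u in 𝓝[≥] v, g u = g v) ∧ ∃ a, ∀ᶠ u in 𝓝[<] v, g u = a) : IsCadlagPath g := by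
  intro v
  obtain ⟨hr, a, hl⟩ := h v
  exact ⟨tendsto_const_nhds.congr' (hr.mono fun u hu => hu.symm),
    a, tendsto_const_nhds.congr' (hl.mono fun u hu => hu.symm)⟩

variable {M : Type*} [AddCommMonoid M]

/-- The sum of `φ (g (r-)) (g r)` over the jumps `r ∈ (s, u]`. -/
def jsum (φ : α → α → M) (g : ℝ≥0 → α) (s u : ℝ≥0) : M :=
  ∑ᶠ r ∈ jumpSet g ∩ Set.Ioc s u, φ (Function.leftLim g r) (g r)

theorem jsum_self (φ : α → α → M) (s : ℝ≥0) : jsum φ g s s = 0 := by simp [jsum]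

open Classical in
-- Counting is the weight that is `1` off the diagonal, so additivity, locality and grid
-- approximation of `jsum` carry over to jump counts.
theorem jumpCount_eq_jsum (t : ℝ≥0) :
    jumpCount g t = jsum (fun a b => if a = b then 0 else 1) g 0 t := by
  unfold jumpCount jsum
  have : jumpSet g ∩ Set.Ioc 0 t = jumpSet g ∩ Set.Iic t := by
    ext r
    simp only [Set.mem_inter_iff, Set.mem_Ioc, Set.mem_Iic]
    exact ⟨fun h => ⟨h.1, h.2.2⟩, fun h => ⟨h.1, h.1.1, h.2⟩⟩
  rw [this, ← finsum_one]
  exact finsum_mem_congr rfl fun r hr => (if_neg hr.1.2).symm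

theorem jumpCount_zero : jumpCount g 0 = 0 := by
  unfold jumpCount
  have : jumpSet g ∩ Set.Iic 0 = ∅ := by
    ext r
    simp only [Set.mem_inter_iff, Set.mem_Iic, Set.mem_empty_iff_false, iff_false]
    exact fun h => absurd h.1.1 (not_lt.2 h.2)
  rw [this, Set.ncard_empty]

variable [DiscreteTopology α]

theorem nhdsLT_neBot {v : ℝ≥0} (hv : 0 < v) : (𝓝[<] v).NeBot :=
  nhdsLT_neBot_of_exists_lt ⟨0, hv⟩

/-- Near each time, a càdlàg path in a discrete space takes one value on the left and one value
on the right. -/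
theorem IsCadlagPath.exists_ball (hg : IsCadlagPath g) (v : ℝ≥0) :
    ∃ δ > 0, ∀ u ∈ Metric.ball v δ, (v ≤ u → g u = g v) ∧ (u < v → g u = Function.leftLim g v) := by
  obtain ⟨hr, hl⟩ := hg v
  have hl' := tendsto_leftLim_of_tendsto hl
  have hr' : Tendsto g (𝓝[≥] v) (𝓝 (g v)) := hr
  rw [nhds_discrete, tendsto_pure] at hl' hr'
  rw [eventually_nhdsWithin_iff] at hl' hr'
  obtain ⟨δ, hδ, h⟩ := Metric.eventually_nhds_iff_ball.1 (hr'.and hl')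
  exact ⟨δ, hδ, fun u hu => ⟨fun h1 => (h u hu).1 h1, fun h1 => (h u hu).2 h1⟩⟩

theorem leftLim_eq_of_eventually {v : ℝ≥0} (hv : 0 < v) {a : α} (h : ∀ᶠ u in 𝓝[<] v, g u = a) :
    Function.leftLim g v = a := by
  have := nhdsLT_neBot hv
  apply leftLim_eq_of_tendsto
  exact tendsto_const_nhds.congr' (h.mono fun u hu => hu.symm)

theorem IsCadlagPath.eventually_left (hg : IsCadlagPath g) (v : ℝ≥0) :
    ∀ᶠ u in 𝓝[<] v, g u = Function.leftLim g v := by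
  have hl' := tendsto_leftLim_of_tendsto (hg v).2
  rwa [nhds_discrete, tendsto_pure] at hl'

theorem IsCadlagPath.eventually_right (hg : IsCadlagPath g) (v : ℝ≥0) :
    ∀ᶠ u in 𝓝[≥] v, g u = g v := by
  have hl' : Tendsto g (𝓝[≥] v) (𝓝 (g v)) := (hg v).1
  rwa [nhds_discrete, tendsto_pure] at hl'

theorem leftLim_eq_of_eventually_nhds {v : ℝ≥0} (h : ∀ᶠ u in 𝓝 v, g u = g v) :
    Function.leftLim g v = g v := by
  rcases eq_or_lt_of_le (zero_le (a := v)) with h0 | h0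
  -- At the bottom element the left limit is the value itself, by convention.
  · subst h0
    exact leftLim_eq_of_isBot fun b => zero_le
  · exact leftLim_eq_of_eventually h0 (h.filter_mono nhdsWithin_le_nhds)

/-- In a neighbourhood where the path takes one value on each side of `v`, the only possible
jump is at `v`. -/
theorem jumpSet_subset_of_ball {v : ℝ≥0} {δ : ℝ}
    (h : ∀ u ∈ Metric.ball v δ, (v ≤ u → g u = g v) ∧ (u < v → g u = Function.leftLim g v)) :
    jumpSet g ∩ Metric.ball v δ ⊆ {v} := by
  rintro u ⟨⟨hu0, hu⟩, hub⟩
  by_contra hne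
  apply hu
  apply leftLim_eq_of_eventually_nhds
  have hball : ∀ᶠ z in 𝓝 u, z ∈ Metric.ball v δ := Metric.isOpen_ball.mem_nhds hub
  rcases lt_or_gt_of_ne hne with hlt | hlt
  · filter_upwards [hball, Iio_mem_nhds hlt] with z hz hzv
    rw [(h z hz).2 hzv, (h u hub).2 hlt]
  · filter_upwards [hball, Ioi_mem_nhds hlt] with z hz hzv
    rw [(h z hz).1 (le_of_lt hzv), (h u hub).1 hlt.le]

theorem finite_jumpSet_Ioc (hg : IsCadlagPath g) (s u : ℝ≥0) :
    (jumpSet g ∩ Set.Ioc s u).Finite :=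
  (finite_jumpSet hg u).subset fun _ h => ⟨h.1, h.2.2⟩

theorem jsum_add (hg : IsCadlagPath g) (φ : α → α → M) {s u w : ℝ≥0} (h1 : s ≤ u) (h2 : u ≤ w) :
    jsum φ g s u + jsum φ g u w = jsum φ g s w := by
  unfold jsum
  rw [← finsum_mem_union _ (finite_jumpSet_Ioc hg s u) (finite_jumpSet_Ioc hg u w),
    ← Set.inter_union_distrib_left, Set.Ioc_union_Ioc_eq_Ioc h1 h2]
  exact (Set.disjoint_left.2 fun z hz hz' => absurd hz.2.2 (not_le.2 hz'.2.1))

/-- The only possible jump in the ball is at `v`. If `v` lies in `(s, u]`, then `g s` and `g u` are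
the one-sided values at `v`; otherwise both points are on the same side of `v` and the path does not
move between them. Where there is no jump, `hφ` makes the right side vanish. -/
theorem jsum_of_ball {v : ℝ≥0} {δ : ℝ}
    (h : ∀ u ∈ Metric.ball v δ, (v ≤ u → g u = g v) ∧ (u < v → g u = Function.leftLim g v))
    {φ : α → α → M} (hφ : ∀ a, φ a a = 0) {s u : ℝ≥0} (hsu : s ≤ u)
    (hs : s ∈ Metric.ball v δ) (hu : u ∈ Metric.ball v δ) :
    jsum φ g s u = φ (g s) (g u) := by
  have hsub : ∀ r ∈ Set.Ioc s u, r ∈ Metric.ball v δ := by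
    intro r hr
    rw [Metric.mem_ball, NNReal.dist_eq, abs_lt] at *
    have h1 : (s : ℝ) < r := by exact_mod_cast hr.1
    have h2 : (r : ℝ) ≤ u := by exact_mod_cast hr.2
    constructor <;> linarith
  have hJ : jumpSet g ∩ Set.Ioc s u ⊆ {v} := fun r hr =>
    jumpSet_subset_of_ball h ⟨hr.1, hsub r hr.2⟩
  unfold jsum
  by_cases hv : v ∈ Set.Ioc s u
  · have e1 : g s = Function.leftLim g v := (h s hs).2 hv.1
    have e2 : g u = g v := (h u hu).1 hv.2
    by_cases hj : v ∈ jumpSet g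
    · have : jumpSet g ∩ Set.Ioc s u = {v} :=
        Set.Subset.antisymm hJ (by rintro r rfl; exact ⟨hj, hv⟩)
      rw [this, finsum_mem_singleton, e1, e2]
    · have : jumpSet g ∩ Set.Ioc s u = ∅ := by
        ext r
        simp only [Set.mem_inter_iff, Set.mem_empty_iff_false, iff_false]
        rintro hr
        have := hJ hr
        rw [Set.mem_singleton_iff] at this
        subst this
        exact hj hr.1
      rw [this, finsum_mem_empty, e1, e2]
      have : Function.leftLim g v = g v := by
        by_contra hne
        exact hj ⟨lt_of_le_of_lt zero_le hv.1, hne⟩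
      rw [this, hφ]
  · have : jumpSet g ∩ Set.Ioc s u = ∅ := by
      ext r
      simp only [Set.mem_inter_iff, Set.mem_empty_iff_false, iff_false]
      rintro hr
      have := hJ hr
      rw [Set.mem_singleton_iff] at this
      subst this
      exact hv hr.2
    rw [this, finsum_mem_empty]
    have : g s = g u := by
      rcases lt_or_ge u v with h1 | h1
      · rw [(h s hs).2 (hsu.trans_lt h1), (h u hu).2 h1]
      · have h2 : v ≤ s := by
          by_contra h3
          exact hv ⟨not_le.1 h3, h1⟩
        rw [(h s hs).1 h2, (h u hu).1 h1]
    rw [this, hφ]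

/-- The `l`-th point of the equidistant partition of `[s, u]` into `n` intervals. -/
def grid (s u : ℝ≥0) (n l : ℕ) : ℝ≥0 := s + (u - s) * (l / n)

theorem grid_mono (s u : ℝ≥0) (n : ℕ) : Monotone (grid s u n) := by
  intro a b hab
  unfold grid
  gcongr

theorem grid_zero (s u : ℝ≥0) (n : ℕ) : grid s u n 0 = s := by simp [grid]

theorem grid_last {s u : ℝ≥0} (h : s ≤ u) {n : ℕ} (hn : n ≠ 0) : grid s u n n = u := by
  have : (n : ℝ≥0) ≠ 0 := by exact_mod_cast hn
  rw [grid, div_self this, mul_one, add_tsub_cancel_of_le h]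

theorem le_grid (s u : ℝ≥0) (n l : ℕ) : s ≤ grid s u n l := le_self_add

theorem grid_le {s u : ℝ≥0} (h : s ≤ u) {n l : ℕ} (hl : l ≤ n) : grid s u n l ≤ u := by
  rcases Nat.eq_zero_or_pos n with h0 | h0
  · subst h0; simp [grid, h]
  · calc grid s u n l ≤ grid s u n n := grid_mono _ _ _ hl
      _ = u := grid_last h h0.ne'

theorem grid_succ (s u : ℝ≥0) (n l : ℕ) : grid s u n (l + 1) = grid s u n l + (u - s) / n := by
  simp only [grid]
  push_cast
  rw [add_div, mul_add, add_assoc, mul_one_div]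

theorem jsum_eq_sum_grid (hg : IsCadlagPath g) (φ : α → α → M) {s u : ℝ≥0} (h : s ≤ u) {n : ℕ}
    (hn : n ≠ 0) :
    ∑ l ∈ Finset.range n, jsum φ g (grid s u n l) (grid s u n (l + 1)) = jsum φ g s u := by
  have : ∀ m, ∑ l ∈ Finset.range m, jsum φ g (grid s u n l) (grid s u n (l + 1)) =
      jsum φ g s (grid s u n m) := by
    intro m
    induction m with
    | zero => simp [grid_zero, jsum_self]
    | succ m ih =>
      rw [Finset.sum_range_succ, ih, jsum_add hg φ (le_grid _ _ _ _)
        (grid_mono _ _ _ (Nat.le_succ m))]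
  rw [this n, grid_last h hn]

/-- The sums over fine equidistant partitions are equal to the sum over the jumps. -/
theorem eventually_sum_grid_eq_jsum (hg : IsCadlagPath g) {φ : α → α → M} (hφ : ∀ a, φ a a = 0)
    {s u : ℝ≥0} (h : s ≤ u) :
    ∀ᶠ n : ℕ in atTop,
      ∑ l ∈ Finset.range n, φ (g (grid s u n l)) (g (grid s u n (l + 1))) = jsum φ g s u := by
  choose δ hδ hball using fun v => hg.exists_ball v
  -- Once the mesh is below the Lebesgue number of this cover, each partition interval lies in one
  -- ball, where `jsum_of_ball` is exact.
  obtain ⟨ε, hε, hε'⟩ := lebesgue_number_lemma_of_metric (s := Set.Icc s u)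
    (c := fun v => Metric.ball v (δ v)) isCompact_Icc (fun v => Metric.isOpen_ball)
    (fun v _ => Set.mem_iUnion.2 ⟨v, Metric.mem_ball_self (hδ v)⟩)
  have hlim : Tendsto (fun n : ℕ => ((u - s : ℝ≥0) : ℝ) / n) atTop (𝓝 0) :=
    tendsto_const_div_atTop_nhds_zero_nat _
  filter_upwards [hlim.eventually (gt_mem_nhds hε), eventually_ne_atTop 0] with n hn hn0
  rw [← jsum_eq_sum_grid hg φ h hn0]
  refine Finset.sum_congr rfl fun l hl => ?_
  have hl' : l + 1 ≤ n := Finset.mem_range.1 hl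
  obtain ⟨v, hv⟩ := hε' (grid s u n l) ⟨le_grid _ _ _ _, grid_le h (Nat.le_of_succ_le hl')⟩
  refine (jsum_of_ball (hball v) hφ (grid_mono _ _ _ (Nat.le_succ l))
    (hv (Metric.mem_ball_self hε)) (hv ?_)).symm
  rw [grid_succ, Metric.mem_ball, NNReal.dist_eq]
  push_cast
  rw [add_sub_cancel_left, abs_of_nonneg (by positivity)]
  exact hn

theorem tendsto_sum_grid_jsum [TopologicalSpace M] (hg : IsCadlagPath g) {φ : α → α → M}
    (hφ : ∀ a, φ a a = 0) {s u : ℝ≥0} (h : s ≤ u) :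
    Tendsto (fun n : ℕ =>
      ∑ l ∈ Finset.range n, φ (g (grid s u n l)) (g (grid s u n (l + 1)))) atTop
      (𝓝 (jsum φ g s u)) :=
  tendsto_const_nhds.congr' ((eventually_sum_grid_eq_jsum hg hφ h).mono fun _ hn => hn.symm)

theorem jumpCount_mono (hg : IsCadlagPath g) : Monotone (jumpCount g) := fun _ b hab =>
  Set.ncard_le_ncard (Set.inter_subset_inter_right _ (Set.Iic_subset_Iic.2 hab))
    (finite_jumpSet hg b)

open Classical in
theorem jumpCount_of_ball (hg : IsCadlagPath g) {v : ℝ≥0} {δ : ℝ}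
    (h : ∀ u ∈ Metric.ball v δ, (v ≤ u → g u = g v) ∧ (u < v → g u = Function.leftLim g v))
    {s u : ℝ≥0} (hsu : s ≤ u)
    (hs : s ∈ Metric.ball v δ) (hu : u ∈ Metric.ball v δ) :
    jumpCount g u = jumpCount g s + if g s = g u then 0 else 1 := by
  rw [jumpCount_eq_jsum, jumpCount_eq_jsum, ← jsum_add hg _ (zero_le) hsu,
    jsum_of_ball h _ hsu hs hu]
  simp

theorem jumpCount_eventually_right (hg : IsCadlagPath g) (v : ℝ≥0) :
    ∀ᶠ u in 𝓝[≥] v, jumpCount g u = jumpCount g v := by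
  obtain ⟨δ, hδ, h⟩ := hg.exists_ball v
  filter_upwards [self_mem_nhdsWithin, nhdsWithin_le_nhds (Metric.ball_mem_nhds v hδ)] with u hu hu'
  rw [jumpCount_of_ball hg h hu (Metric.mem_ball_self hδ) hu', (h u hu').1 hu]
  simp

open Classical in
theorem jumpCount_eventually_left (hg : IsCadlagPath g) (v : ℝ≥0) :
    ∀ᶠ u in 𝓝[<] v, jumpCount g u =
      jumpCount g v - if Function.leftLim g v = g v then 0 else 1 := by
  obtain ⟨δ, hδ, h⟩ := hg.exists_ball v
  filter_upwards [self_mem_nhdsWithin, nhdsWithin_le_nhds (Metric.ball_mem_nhds v hδ)] with u hu hu'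
  rw [jumpCount_of_ball hg h (le_of_lt hu) hu' (Metric.mem_ball_self hδ), (h u hu').2 hu]
  simp

theorem jumpCount_isCadlagPath (hg : IsCadlagPath g) : IsCadlagPath (jumpCount g) :=
  isCadlagPath_of_eventually fun v =>
    ⟨jumpCount_eventually_right hg v, _, jumpCount_eventually_left hg v⟩

theorem jumpCount_eq_leftLim (hg : IsCadlagPath g) {v : ℝ≥0}
    (hj : Function.leftLim g v = g v) : Function.leftLim (jumpCount g) v = jumpCount g v := by
  rcases eq_or_lt_of_le (zero_le (a := v)) with h0 | h0
  · subst h0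
    exact leftLim_eq_of_isBot fun b => zero_le
  · apply leftLim_eq_of_eventually h0
    filter_upwards [jumpCount_eventually_left hg v] with u hu
    simpa [hj] using hu

theorem jumpCount_eq_leftLim_add_one (hg : IsCadlagPath g) {v : ℝ≥0}
    (hj : v ∈ jumpSet g) : jumpCount g v = Function.leftLim (jumpCount g) v + 1 := by
  have h1 : Function.leftLim (jumpCount g) v = jumpCount g v - 1 := by
    apply leftLim_eq_of_eventually hj.1
    filter_upwards [jumpCount_eventually_left hg v] with u hu
    simpa [hj.2] using hu
  -- Positivity is needed because the subtraction in `h1` is truncated.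
  have h2 : 0 < jumpCount g v := by
    unfold jumpCount
    exact (Set.ncard_pos (finite_jumpSet hg v)).2 ⟨v, hj, le_refl v⟩
  omega

theorem leftLim_le_of_monotone {a : ℝ≥0 → ℕ} (ha : IsCadlagPath a) (hm : Monotone a) (v : ℝ≥0) :
    Function.leftLim a v ≤ a v := by
  rcases eq_or_lt_of_le (zero_le (a := v)) with h0 | h0
  · subst h0
    rw [leftLim_eq_of_isBot fun b => zero_le]
  · have := nhdsLT_neBot h0
    obtain ⟨u, hu, hu'⟩ := ((ha.eventually_left v).and self_mem_nhdsWithin).exists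
    rw [← hu]
    exact hm (le_of_lt hu')

theorem le_leftLim_of_monotone {a : ℝ≥0 → ℕ} (ha : IsCadlagPath a) (hm : Monotone a) {u v : ℝ≥0}
    (huv : u < v) : a u ≤ Function.leftLim a v := by
  have := nhdsLT_neBot (lt_of_le_of_lt zero_le huv)
  obtain ⟨w, hw, hw'⟩ := ((ha.eventually_left v).and
    (Ioo_mem_nhdsLT huv)).exists
  rw [← hw]
  exact hm hw'.1.le

/-- At a jump the value exceeds the left limit, and with it all earlier values, so the level `a r`
is first reached at `r`, whatever the size of the jump. -/
theorem arrivalTime_of_mem_jumpSet {a : ℝ≥0 → ℕ} (ha : IsCadlagPath a) (hm : Monotone a)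
    {r : ℝ≥0} (hr : r ∈ jumpSet a) : arrivalTime a (a r) = r := by
  have hlt : Function.leftLim a r < a r :=
    lt_of_le_of_ne (leftLim_le_of_monotone ha hm r) hr.2
  apply le_antisymm
  · exact csInf_le (OrderBot.bddBelow _) (le_refl (a r))
  · refine le_csInf ⟨r, le_refl (a r)⟩ fun u hu => ?_
    by_contra hur
    have := le_leftLim_of_monotone ha hm (not_le.1 hur)
    have hu' : a r ≤ a u := hu
    omega

/-- The infimum is attained because the path keeps the value `a u` for a while after `u`. The
hypothesis `hk` says that the level is reached at all; otherwise `sInf ∅ = 0` would spoil the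
equivalence. -/
theorem arrivalTime_le_iff {a : ℝ≥0 → ℕ} (ha : IsCadlagPath a) (hm : Monotone a) {k : ℕ}
    {s : ℝ≥0} (hk : k ≤ a s) (u : ℝ≥0) : arrivalTime a k ≤ u ↔ k ≤ a u := by
  constructor
  · intro h
    obtain ⟨w, hw, hw'⟩ := ((eventually_nhdsWithin_of_eventually_nhds
      (Filter.Eventually.of_forall fun w => trivial)).and
      ((ha.eventually_right u).filter_mono (nhdsWithin_mono u Set.Ioi_subset_Ici_self)) |>.and
      self_mem_nhdsWithin : ∀ᶠ w in 𝓝[>] u, (True ∧ a w = a u) ∧ w ∈ Set.Ioi u).exists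
    have : arrivalTime a k < w := lt_of_le_of_lt h hw'
    obtain ⟨z, hz, hzw⟩ := exists_lt_of_csInf_lt ⟨s, hk⟩ this
    rw [← hw.2]
    exact le_trans hz (hm hzw.le)
  · intro h
    exact csInf_le (OrderBot.bddBelow _) h

theorem arrivalTime_pos {a : ℝ≥0 → ℕ} (ha : IsCadlagPath a) (hm : Monotone a) (h0 : a 0 = 0)
    {k : ℕ} {s : ℝ≥0} (hk : k ≤ a s) (hk0 : 0 < k) : 0 < arrivalTime a k := by
  by_contra h
  have := (arrivalTime_le_iff ha hm hk 0).1 (not_lt.1 h)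
  omega

end Paths

/-! ### Joint measurability and predictability of processes -/

section Measurability

variable {Ω E : Type*} [TopologicalSpace E] [TopologicalSpace.PseudoMetrizableSpace E]
  [MeasurableSpace E] [BorelSpace E]

theorem measurable_comp_countable {α β ι : Type*} [MeasurableSpace α] [MeasurableSpace β]
    [Countable ι] [MeasurableSpace ι] [MeasurableSingletonClass ι] {F : ι → α → β} {i : α → ι}
    (hF : ∀ k, Measurable (F k)) (hi : Measurable i) : Measurable fun z => F (i z) z := by
  have : Measurable fun p : ι × α => F p.1 p.2 := measurable_from_prod_countable_right hF
  exact this.comp (hi.prodMk measurable_id)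

/-- A process with right continuous paths is jointly measurable. -/
theorem measurable_uncurry_of_rightCts [MeasurableSpace Ω] {Y : ℝ≥0 → Ω → E}
    (hY : ∀ r, Measurable (Y r))
    (hr : ∀ ω s, ContinuousWithinAt (fun u => Y u ω) (Set.Ici s) s) :
    Measurable fun z : Ω × ℝ≥0 => Y z.2 z.1 := by
  -- Approximation from the right by multiples of `1 / (n + 1)`: right continuity applies, and only
  -- countably many times are involved.
  set d : ℕ → ℝ≥0 → ℝ≥0 := fun n s => ((⌊s * (n + 1)⌋₊ : ℝ≥0) + 1) / (n + 1) with hd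
  have hlt : ∀ n s, s ≤ d n s := by
    intro n s
    rw [hd, le_div_iff₀ (by positivity)]
    exact (Nat.lt_floor_add_one _).le
  have hle : ∀ n s, d n s ≤ s + 1 / (n + 1) := by
    intro n s
    simp only [hd]
    rw [add_div]
    gcongr
    rw [div_le_iff₀ (by positivity)]
    exact Nat.floor_le (zero_le)
  have hlim : ∀ s, Tendsto (fun n => d n s) atTop (𝓝[≥] s) := by
    intro s
    refine tendsto_nhdsWithin_iff.2 ⟨?_, Eventually.of_forall fun n => hlt n s⟩
    refine tendsto_of_tendsto_of_tendsto_of_le_of_le tendsto_const_nhds ?_ (fun n => hlt n s)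
      (fun n => hle n s)
    simpa using (tendsto_const_nhds (x := s)).add
      (tendsto_one_div_add_atTop_nhds_zero_nat (𝕜 := ℝ≥0))
  refine measurable_of_tendsto_metrizable (f := fun n (z : Ω × ℝ≥0) => Y (d n z.2) z.1) ?_ ?_
  · intro n
    refine measurable_comp_countable
      (F := fun (k : ℕ) (z : Ω × ℝ≥0) => Y (((k : ℝ≥0) + 1) / (n + 1)) z.1)
      (i := fun z => ⌊z.2 * (n + 1)⌋₊) (fun k => (hY _).comp measurable_fst) ?_
    exact Nat.measurable_floor.comp (measurable_snd.mul_const _)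
  · rw [tendsto_pi_nhds]
    intro z
    exact (hr z.1 z.2).tendsto.comp (hlim z.2)

/-- The predictable σ-algebra of the filtration `F`, restricted to positive times. -/
@[reducible]
def predictable (F : ℝ≥0 → MeasurableSpace Ω) : MeasurableSpace (Ω × ℝ≥0) :=
  MeasurableSpace.generateFrom {A | ∃ s B, MeasurableSet[F s] B ∧ A = B ×ˢ Set.Ioi s}

theorem predictable_le {F : ℝ≥0 → MeasurableSpace Ω} {m : MeasurableSpace Ω}
    (hF : ∀ s, F s ≤ m) : predictable F ≤ m.prod inferInstance := by
  refine MeasurableSpace.generateFrom_le ?_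
  rintro A ⟨s, B, hB, rfl⟩
  exact (hF s B hB).prod measurableSet_Ioi

theorem measurable_snd_predictable (F : ℝ≥0 → MeasurableSpace Ω) :
    Measurable[predictable F] (Prod.snd : Ω × ℝ≥0 → ℝ≥0) := by
  let _ := predictable F
  refine measurable_of_Ioi fun s => ?_
  refine MeasurableSpace.measurableSet_generateFrom ⟨s, Set.univ, MeasurableSet.univ, ?_⟩
  ext z; simp

/-- The process of left limits of an adapted process is predictable. -/
theorem measurable_leftLim_predictable {F : ℝ≥0 → MeasurableSpace Ω} [T2Space E]
    {Y : ℝ≥0 → Ω → E} (hY : ∀ r, Measurable[F r] (Y r))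
    (hl : ∀ ω s, 0 < s → ∃ a, Tendsto (fun u => Y u ω) (𝓝[<] s) (𝓝 a)) (e : E) :
    Measurable[predictable F] fun z : Ω × ℝ≥0 =>
      if 0 < z.2 then Function.leftLim (fun u => Y u z.1) z.2 else e := by
  -- The ceiling minus one, rather than the floor, keeps `d n s` strictly below `s` even if `s` is
  -- itself a multiple of `1 / (n + 1)`.
  set d : ℕ → ℝ≥0 → ℝ≥0 := fun n s => ((⌈s * (n + 1)⌉₊ - 1 : ℕ) : ℝ≥0) / (n + 1) with hd
  have hlt : ∀ n s, 0 < s → d n s < s := by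
    intro n s hs
    simp only [hd]
    rw [div_lt_iff₀ (by positivity)]
    have h1 : 0 < ⌈s * (n + 1)⌉₊ := Nat.ceil_pos.2 (by positivity)
    rw [← Nat.lt_ceil]
    omega
  have hle : ∀ n s, s - 1 / (n + 1) ≤ d n s := by
    intro n s
    rw [tsub_le_iff_right]
    simp only [hd]
    rw [← add_div, le_div_iff₀ (by positivity)]
    refine (Nat.le_ceil _).trans ?_
    have : ⌈s * ((n : ℝ≥0) + 1)⌉₊ ≤ (⌈s * ((n : ℝ≥0) + 1)⌉₊ - 1) + 1 := by omega
    exact_mod_cast this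
  have hlim : ∀ s, 0 < s → Tendsto (fun n => d n s) atTop (𝓝[<] s) := by
    intro s hs
    refine tendsto_nhdsWithin_iff.2 ⟨?_, Eventually.of_forall fun n => hlt n s hs⟩
    refine tendsto_of_tendsto_of_tendsto_of_le_of_le ?_ tendsto_const_nhds
      (fun n => hle n s) (fun n => (hlt n s hs).le)
    simpa using (tendsto_const_nhds (x := s)).sub
      (tendsto_one_div_add_atTop_nhds_zero_nat (𝕜 := ℝ≥0))
  have hIoi : ∀ a, MeasurableSet[predictable F] {z : Ω × ℝ≥0 | a < z.2} := fun a =>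
    measurable_snd_predictable F measurableSet_Ioi
  refine @measurable_of_tendsto_metrizable _ _ (predictable F) _ _ _ _
    (fun n (z : Ω × ℝ≥0) => if 0 < z.2 then Y (d n z.2) z.1 else e) _ ?_ ?_
  · intro n A hA
    -- For times in `(k / (n + 1), (k + 1) / (n + 1)]` the approximation is the value at the left
    -- endpoint, which is known by then. Each piece is a generator of the predictable σ-algebra cut
    -- off at a deterministic time.
    have : (fun z : Ω × ℝ≥0 => if 0 < z.2 then Y (d n z.2) z.1 else e) ⁻¹' A =
        ({z | 0 < z.2}ᶜ ∩ {_z | e ∈ A}) ∪ ⋃ k : ℕ,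
          ((Y ((k : ℝ≥0) / (n + 1)) ⁻¹' A) ×ˢ Set.Ioi ((k : ℝ≥0) / (n + 1))) ∩
            {z | ((k + 1 : ℕ) : ℝ≥0) / (n + 1) < z.2}ᶜ := by
      ext z
      simp only [Set.mem_preimage, Set.mem_union, Set.mem_inter_iff, Set.mem_compl_iff,
        Set.mem_ofPred_eq, Set.mem_iUnion, Set.mem_prod, Set.mem_Ioi]
      by_cases hz : 0 < z.2
      · simp only [hz, if_true, not_true, false_and, false_or]
        constructor
        · intro h
          have h1 : 0 < ⌈z.2 * ((n : ℝ≥0) + 1)⌉₊ := Nat.ceil_pos.2 (by positivity)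
          refine ⟨⌈z.2 * (n + 1)⌉₊ - 1, ⟨h, hlt n z.2 hz⟩, ?_⟩
          rw [not_lt, le_div_iff₀ (by positivity), Nat.sub_add_cancel h1]
          exact Nat.le_ceil _
        · rintro ⟨k, ⟨h, hk⟩, hk'⟩
          rw [div_lt_iff₀ (by positivity), ← Nat.lt_ceil] at hk
          rw [not_lt, le_div_iff₀ (by positivity), ← Nat.ceil_le] at hk'
          have : ⌈z.2 * ((n : ℝ≥0) + 1)⌉₊ - 1 = k := by omega
          simp only [hd, this]
          exact h
      · simp only [hz, if_false, not_false_iff, true_and]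
        refine ⟨Or.inl, ?_⟩
        rintro (h | ⟨k, ⟨-, hk⟩, -⟩)
        · exact h
        · exact absurd (lt_of_le_of_lt zero_le hk) hz
    rw [this]
    refine MeasurableSet.union ?_ (MeasurableSet.iUnion fun k => MeasurableSet.inter ?_ ?_)
    · exact (hIoi 0).compl.inter (MeasurableSet.const _)
    · exact MeasurableSpace.measurableSet_generateFrom ⟨_, _, hY _ hA, rfl⟩
    · exact (hIoi _).compl
  · rw [tendsto_pi_nhds]
    intro z
    by_cases hz : 0 < z.2
    · simp only [hz, if_true]
      exact (tendsto_leftLim_of_tendsto (hl z.1 z.2 hz)).comp (hlim z.2 hz)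
    · simp only [hz, if_false]
      exact tendsto_const_nhds

/-- The process of left limits is jointly measurable. -/
theorem measurable_uncurry_leftLim [MeasurableSpace Ω] [T2Space E] {Y : ℝ≥0 → Ω → E}
    (hY : ∀ r, Measurable (Y r))
    (hl : ∀ ω s, 0 < s → ∃ a, Tendsto (fun u => Y u ω) (𝓝[<] s) (𝓝 a)) (e : E) :
    Measurable fun z : Ω × ℝ≥0 =>
      if 0 < z.2 then Function.leftLim (fun u => Y u z.1) z.2 else e :=
  (measurable_leftLim_predictable (F := fun _ => inferInstance) hY hl e).mono
    (predictable_le fun _ => le_rfl) le_rfl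

variable {α : Type*} [TopologicalSpace α] [DiscreteTopology α] [Countable α]
  [MeasurableSpace α] [MeasurableSingletonClass α]

/-- A pointwise limit of grid sums, each of which uses finitely many values at times up to `u`; no
information after `u` is required. -/
theorem measurable_jsum [MeasurableSpace Ω] {M : Type*} [AddCommMonoid M] [TopologicalSpace M]
    [TopologicalSpace.PseudoMetrizableSpace M] [MeasurableSpace M] [BorelSpace M]
    [MeasurableAdd₂ M] {Y : ℝ≥0 → Ω → α} {s u : ℝ≥0} (hsu : s ≤ u)
    (hY : ∀ r ≤ u, Measurable (Y r)) (hc : ∀ ω, IsCadlagPath fun r => Y r ω)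
    {φ : α → α → M} (hφ : ∀ a, φ a a = 0) :
    Measurable fun ω => jsum φ (fun r => Y r ω) s u := by
  refine measurable_of_tendsto_metrizable (f := fun (n : ℕ) ω => ∑ l ∈ Finset.range n,
    φ (Y (grid s u n l) ω) (Y (grid s u n (l + 1)) ω)) (fun n => ?_) ?_
  · refine Finset.measurable_fun_sum _ fun l hl => ?_
    have hl' : l + 1 ≤ n := Finset.mem_range.1 hl
    have h1 := hY _ (grid_le hsu hl')
    have h0 := hY _ (grid_le hsu (Nat.le_of_succ_le hl'))
    exact (measurable_from_prod_countable_right (f := fun p : α × α => φ p.1 p.2)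
      (fun a => measurable_of_countable _)).comp (h0.prodMk h1)
  · rw [tendsto_pi_nhds]
    exact fun ω => tendsto_sum_grid_jsum (hc ω) hφ hsu

theorem measurable_jumpCount [MeasurableSpace Ω] {Y : ℝ≥0 → Ω → α} {u : ℝ≥0}
    (hY : ∀ r ≤ u, Measurable (Y r)) (hc : ∀ ω, IsCadlagPath fun r => Y r ω) :
    Measurable fun ω => jumpCount (fun r => Y r ω) u := by
  classical
  simp only [jumpCount_eq_jsum]
  exact measurable_jsum zero_le hY hc (by simp)

/-- The default value `s` caps the arrival time at `s`. For `u < s` the event that the capped time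
is at most `u` is `k ≤ A u`, so the information up to `s` suffices. -/
theorem measurable_arrivalTime [MeasurableSpace Ω] {A : ℝ≥0 → Ω → ℕ} {s : ℝ≥0}
    (hA : ∀ r ≤ s, Measurable (A r)) (hc : ∀ ω, IsCadlagPath fun r => A r ω)
    (hm : ∀ ω, Monotone fun r => A r ω) (k : ℕ) :
    Measurable fun ω => if k ≤ A s ω then arrivalTime (fun r => A r ω) k else s := by
  refine measurable_of_Iic fun u => ?_
  by_cases hu : s ≤ u
  · convert MeasurableSet.univ
    ext ω
    simp only [Set.mem_preimage, Set.mem_Iic, Set.mem_univ, iff_true]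
    split_ifs with h
    · exact ((arrivalTime_le_iff (hc ω) (hm ω) h s).2 h).trans hu
    · exact hu
  · convert hA u (not_le.1 hu).le (measurableSet_Ici (a := k)) using 1
    ext ω
    simp only [Set.mem_preimage, Set.mem_Iic, Set.mem_Ici]
    split_ifs with h
    · exact arrivalTime_le_iff (hc ω) (hm ω) h u
    · refine ⟨fun h' => absurd h' hu, fun h' => absurd (h'.trans (hm ω (not_le.1 hu).le)) h⟩

end Measurability

/-! ### Measurability of the risk process -/

section RiskProcess

variable {n : ℕ} {Ω : Type*} [MeasurableSpace Ω]

theorem isCadlagPath_stop {α : Type*} [TopologicalSpace α] [DiscreteTopology α] {g : ℝ≥0 → α}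
    (hg : IsCadlagPath g) (s : ℝ≥0) : IsCadlagPath fun r => g (min r s) := by
  refine isCadlagPath_of_eventually fun v => ⟨?_, ?_⟩
  · rcases lt_or_ge v s with h | h
    · filter_upwards [hg.eventually_right v, nhdsWithin_le_nhds (Iio_mem_nhds h)] with u hu hus
      rw [min_eq_left (le_of_lt hus), hu, min_eq_left h.le]
    · filter_upwards [self_mem_nhdsWithin] with u hu
      rw [min_eq_right (h.trans hu), min_eq_right h]
  · rcases lt_or_ge s v with h | h
    · refine ⟨g s, ?_⟩
      filter_upwards [nhdsWithin_le_nhds (Ioi_mem_nhds h)] with u hu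
      rw [min_eq_right (le_of_lt hu)]
    · refine ⟨Function.leftLim g v, ?_⟩
      filter_upwards [hg.eventually_left v, self_mem_nhdsWithin] with u hu huv
      rw [min_eq_left ((le_of_lt huv).trans h), hu]

theorem leftLim_stop {α : Type*} [TopologicalSpace α] [DiscreteTopology α] {g : ℝ≥0 → α}
    (hg : IsCadlagPath g) {s v : ℝ≥0} (hv : 0 < v) (hvs : v ≤ s) :
    Function.leftLim (fun r => g (min r s)) v = Function.leftLim g v := by
  apply leftLim_eq_of_eventually hv
  filter_upwards [hg.eventually_left v, self_mem_nhdsWithin] with u hu huv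
  rw [min_eq_left ((le_of_lt huv).trans hvs), hu]

variable {J : ℝ≥0 → Ω → Fin n}

theorem measurable_uncurry_stop {s : ℝ≥0} (hJ : ∀ r ≤ s, Measurable (J r))
    (hJc : ∀ ω, IsCadlagPath fun r => J r ω) :
    Measurable fun z : Ω × ℝ≥0 => J (min z.2 s) z.1 :=
  measurable_uncurry_of_rightCts (Y := fun r => J (min r s)) (fun _ => hJ _ (min_le_right _ _))
    fun ω v => (isCadlagPath_stop (hJc ω) s v).1

theorem measurable_intervalIntegral_comp {s t : ℝ≥0} (hst : s ≤ t)
    (hJ : ∀ r ≤ t, Measurable (J r)) (hJc : ∀ ω, IsCadlagPath fun r => J r ω) (c : Fin n → ℝ) :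
    Measurable fun ω => ∫ u in (s : ℝ)..(t : ℝ), c (J u.toNNReal ω) := by
  have hst' : (s : ℝ) ≤ t := by exact_mod_cast hst
  have : ∀ ω, ∫ u in (s : ℝ)..(t : ℝ), c (J u.toNNReal ω) =
      ∫ u in Set.Ioc (s : ℝ) t, c (J (min u.toNNReal t) ω) := by
    intro ω
    rw [intervalIntegral.integral_of_le hst']
    refine setIntegral_congr_fun measurableSet_Ioc fun u hu => ?_
    have : u.toNNReal ≤ t := Real.toNNReal_le_iff_le_coe.2 hu.2
    simp only [min_eq_left this]
  simp only [this]
  have hm : Measurable fun z : Ω × ℝ => c (J (min z.2.toNNReal t) z.1) :=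
    (measurable_of_countable c).comp ((measurable_uncurry_stop hJ hJc).comp
      (measurable_fst.prodMk (measurable_real_toNNReal.comp measurable_snd)))
  exact hm.stronglyMeasurable.integral_prod_right.measurable

variable {N : ℝ≥0 → Ω → ℕ} {C : Fin n → ℕ → Ω → ℝ} {D : Fin n → Fin n → ℕ → Ω → ℝ}

/-- A summand `F k` may look beyond time `s` when its index exceeds the count. It is replaced by a
measurable `G k` that agrees with it on the terms that are summed. -/
theorem measurable_sum_arrivals {A : ℝ≥0 → Ω → ℕ} {s : ℝ≥0} (hA : Measurable (A s))
    {F : ℕ → Ω → ℝ} {G : ℕ → Ω → ℝ} (hG : ∀ k, Measurable (G k))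
    (hFG : ∀ ω, ∀ k ∈ Finset.Icc 1 (A s ω), F k ω = G k ω) :
    Measurable fun ω => ∑ k ∈ Finset.Icc 1 (A s ω), F k ω := by
  have : (fun ω => ∑ k ∈ Finset.Icc 1 (A s ω), F k ω) =
      fun ω => ∑ k ∈ Finset.Icc 1 (A s ω), G k ω := by
    ext ω
    exact Finset.sum_congr rfl (hFG ω)
  rw [this]
  exact measurable_comp_countable (F := fun m ω => ∑ k ∈ Finset.Icc 1 m, G k ω)
    (fun m => Finset.measurable_fun_sum _ fun k _ => hG k) hA

/-- The risk process at time `s` is measurable for every σ-algebra which contains the information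
on the claims and on the environment and the arrivals up to time `s`. -/
theorem measurable_riskProcess_time (R : RiskParameters n) (x : ℝ) {s : ℝ≥0}
    (hJ : ∀ r ≤ s, Measurable (J r)) (hJc : ∀ ω, IsCadlagPath fun r => J r ω)
    (hN : ∀ r ≤ s, Measurable (N r)) (hNc : ∀ ω, IsCadlagPath fun r => N r ω)
    (hNm : ∀ ω, Monotone fun r => N r ω)
    (hC : ∀ i k, Measurable (C i k)) (hD : ∀ i j k, Measurable (D i j k)) :
    Measurable (riskProcess R x J N C D s) := by
  -- The base point provides a default state `J 0 ω₀` in place of a left limit at time `0`.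
  rcases isEmpty_or_nonempty Ω with hΩ | ⟨⟨ω₀⟩⟩
  · exact measurable_of_empty _
  have hJs := measurable_uncurry_stop hJ hJc
  have hJl := measurable_uncurry_leftLim (Y := fun r => J (min r s))
    (fun _ => hJ _ (min_le_right _ _))
    (fun ω v _ => (isCadlagPath_stop (hJc ω) s v).2) (J 0 ω₀)
  have hjc : ∀ r ≤ s, Measurable fun ω => jumpCount (fun u => J u ω) r := fun r hr =>
    measurable_jumpCount (fun u hu => hJ u (hu.trans hr)) hJc
  have hjcc : ∀ ω, IsCadlagPath fun r => jumpCount (fun u => J u ω) r := fun ω =>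
    jumpCount_isCadlagPath (hJc ω)
  have hjcm : ∀ ω, Monotone fun r => jumpCount (fun u => J u ω) r := fun ω =>
    jumpCount_mono (hJc ω)
  refine Measurable.sub (Measurable.sub (Measurable.add measurable_const ?_) ?_) ?_
  · exact measurable_intervalIntegral_comp zero_le hJ hJc R.premium
  · have hτ := measurable_arrivalTime hN hNc hNm
    -- Capping the arrival time at `s` changes no term of the sum and confines the evaluation of `J`
    -- to `[0, s]`.
    refine measurable_sum_arrivals (hN s le_rfl)
      (G := fun k ω => C (J (min (if k ≤ N s ω then arrivalTime (fun r => N r ω) k else s) s) ω)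
        k ω) (fun k => ?_) fun ω k hk => ?_
    · exact measurable_comp_countable (fun i => hC i k)
        (hJs.comp (measurable_id.prodMk (hτ k)))
    · have h1 : k ≤ N s ω := (Finset.mem_Icc.1 hk).2
      simp only [h1, if_true]
      rw [min_eq_left ((arrivalTime_le_iff (hNc ω) (hNm ω) h1 s).2 h1)]
  · have hτ := measurable_arrivalTime hjc hjcc hjcm
    refine measurable_sum_arrivals (A := fun s ω => jumpCount (fun u => J u ω) s) (hjc s le_rfl)
      (G := fun k ω => (fun p : Fin n × Fin n => D p.1 p.2 k)
        ((fun z : Ω × ℝ≥0 => ((if 0 < z.2 then Function.leftLim (fun u => J (min u s) z.1) z.2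
          else J 0 ω₀), J (min z.2 s) z.1)) (ω,
          if k ≤ jumpCount (fun u => J u ω) s then arrivalTime (jumpCount (fun u => J u ω)) k
            else s)) ω) (fun k => ?_) fun ω k hk => ?_
    · exact measurable_comp_countable (fun p => hD p.1 p.2 k)
        ((hJl.prodMk hJs).comp (measurable_id.prodMk (hτ k)))
    · obtain ⟨h0, h1⟩ := Finset.mem_Icc.1 hk
      have h2 := arrivalTime_pos (hjcc ω) (hjcm ω) jumpCount_zero h1 h0
      have h3 := (arrivalTime_le_iff (hjcc ω) (hjcm ω) h1 s).2 h1
      simp only [h1, if_true, h2, leftLim_stop (hJc ω) h2 h3, min_eq_left h3]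

theorem intervalIntegrable_path {g : ℝ≥0 → Fin n} (hg : IsCadlagPath g) (c : Fin n → ℝ) (a b : ℝ) :
    IntervalIntegrable (fun u : ℝ => c (g u.toNNReal)) volume a b := by
  -- A single path is a process over a one-point probability space.
  have hgm : Measurable g :=
    (measurable_uncurry_of_rightCts (Ω := Unit) (Y := fun r _ => g r)
      (fun r => measurable_const) fun _ v => (hg v).1).comp
      (measurable_const (a := ()) |>.prodMk measurable_id)
  have hb : ∀ i, |c i| ≤ ∑ j, |c j| := fun i =>
    Finset.single_le_sum (f := fun j => |c j|) (fun j _ => abs_nonneg _) (Finset.mem_univ i)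
  refine (intervalIntegrable_const (c := ∑ j, |c j|)).mono_fun' ?_ ?_
  · exact ((measurable_of_countable c).comp
      (hgm.comp measurable_real_toNNReal)).aestronglyMeasurable
  · exact Eventually.of_forall fun u => hb _

theorem continuous_integral_path {c : Fin n → ℝ} {g : ℝ≥0 → Fin n} (hg : IsCadlagPath g) :
    Continuous fun t : ℝ≥0 => ∫ u in (0 : ℝ)..(t : ℝ), c (g u.toNNReal) :=
  (intervalIntegral.continuous_primitive (intervalIntegrable_path hg c) 0).comp
    NNReal.continuous_coe

end RiskProcess

/-! ### Path behaviour of the risk process at and between epochs -/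

section RiskPaths

theorem IsCadlagPath.prodMk {α β : Type*} [TopologicalSpace α] [DiscreteTopology α]
    [TopologicalSpace β] [DiscreteTopology β] {g : ℝ≥0 → α} {h : ℝ≥0 → β}
    (hg : IsCadlagPath g) (hh : IsCadlagPath h) : IsCadlagPath fun t => (g t, h t) := by
  refine isCadlagPath_of_eventually fun v => ⟨?_, (Function.leftLim g v, Function.leftLim h v), ?_⟩
  · filter_upwards [hg.eventually_right v, hh.eventually_right v] with u h1 h2
    rw [h1, h2]
  · filter_upwards [hg.eventually_left v, hh.eventually_left v] with u h1 h2
    rw [h1, h2]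

theorem leftLim_prodMk {α β : Type*} [TopologicalSpace α] [DiscreteTopology α]
    [TopologicalSpace β] [DiscreteTopology β] {g : ℝ≥0 → α} {h : ℝ≥0 → β}
    (hg : IsCadlagPath g) (hh : IsCadlagPath h) (v : ℝ≥0) :
    Function.leftLim (fun t => (g t, h t)) v = (Function.leftLim g v, Function.leftLim h v) := by
  rcases eq_or_lt_of_le (zero_le (a := v)) with h0 | h0
  · subst h0
    rw [leftLim_eq_of_isBot fun b => zero_le, leftLim_eq_of_isBot fun b => zero_le,
      leftLim_eq_of_isBot fun b => zero_le]
  · apply leftLim_eq_of_eventually h0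
    filter_upwards [hg.eventually_left v, hh.eventually_left v] with u h1 h2
    rw [h1, h2]

theorem jumpSet_prodMk {α β : Type*} [TopologicalSpace α] [DiscreteTopology α]
    [TopologicalSpace β] [DiscreteTopology β] {g : ℝ≥0 → α} {h : ℝ≥0 → β}
    (hg : IsCadlagPath g) (hh : IsCadlagPath h) :
    jumpSet (fun t => (g t, h t)) = jumpSet h ∪ jumpSet g := by
  ext r
  simp only [jumpSet, leftLim_prodMk hg hh, Set.mem_ofPred_eq, Set.mem_union, ne_eq,
    Prod.mk.injEq]
  tauto

variable {n : ℕ} {Ω : Type*} {J : ℝ≥0 → Ω → Fin n} {N : ℝ≥0 → Ω → ℕ}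

/-- The value of the risk process at time `t` if the first `a` arrival claims and the first `b`
transition claims have been paid. -/
def riskValue (R : RiskParameters n) (x : ℝ) (J : ℝ≥0 → Ω → Fin n) (N : ℝ≥0 → Ω → ℕ)
    (C : Fin n → ℕ → Ω → ℝ) (D : Fin n → Fin n → ℕ → Ω → ℝ) (ω : Ω) (a b : ℕ) (t : ℝ≥0) : ℝ :=
  x + (∫ u in (0 : ℝ)..(t : ℝ), R.premium (J u.toNNReal ω))
    - (∑ k ∈ Finset.Icc 1 a, C (J (arrivalTime (fun u => N u ω) k) ω) k ω)
    - ∑ k ∈ Finset.Icc 1 b,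
        D (Function.leftLim (fun u => J u ω) (arrivalTime (jumpCount (fun u => J u ω)) k))
          (J (arrivalTime (jumpCount (fun u => J u ω)) k) ω) k ω

variable {R : RiskParameters n} {x : ℝ} {C : Fin n → ℕ → Ω → ℝ}
  {D : Fin n → Fin n → ℕ → Ω → ℝ} {ω : Ω}

/-- With the numbers of paid claims frozen, only the premium integral depends on time. One-sided
limits of the risk process thus result from freezing the counts at their one-sided values. -/
theorem continuous_riskValue (hJc : IsCadlagPath fun t => J t ω) (a b : ℕ) :
    Continuous (riskValue R x J N C D ω a b) :=
  ((continuous_const.add (continuous_integral_path hJc)).sub continuous_const).sub continuous_const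

theorem riskProcess_rightCts (hJc : IsCadlagPath fun t => J t ω) (hNc : IsCadlagPath fun t => N t ω)
    (s : ℝ≥0) : ContinuousWithinAt (fun u => riskProcess R x J N C D u ω) (Set.Ici s) s := by
  refine ((continuous_riskValue (R := R) (x := x) (N := N) (C := C) (D := D) hJc (N s ω)
    (jumpCount (fun u => J u ω) s)).continuousWithinAt (s := Set.Ici s) (x := s)).congr_of_eventuallyEq
    ?_ rfl
  filter_upwards [hNc.eventually_right s, jumpCount_eventually_right hJc s] with u h1 h2
  simp only [riskProcess, riskValue, h1, h2]

theorem tendsto_riskProcess_left (hJc : IsCadlagPath fun t => J t ω)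
    (hNc : IsCadlagPath fun t => N t ω) (s : ℝ≥0) :
    Tendsto (fun u => riskProcess R x J N C D u ω) (𝓝[<] s)
      (𝓝 (riskValue R x J N C D ω (Function.leftLim (fun u => N u ω) s)
        (Function.leftLim (jumpCount fun u => J u ω) s) s)) := by
  refine (((continuous_riskValue hJc _ _).tendsto s).mono_left nhdsWithin_le_nhds).congr' ?_
  filter_upwards [hNc.eventually_left s, (jumpCount_isCadlagPath hJc).eventually_left s] with u h1 h2
  simp only [riskProcess, riskValue, h1, h2]

theorem leftLim_riskProcess (hJc : IsCadlagPath fun t => J t ω) (hNc : IsCadlagPath fun t => N t ω)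
    (s : ℝ≥0) : Function.leftLim (fun u => riskProcess R x J N C D u ω) s =
      riskValue R x J N C D ω (Function.leftLim (fun u => N u ω) s)
        (Function.leftLim (jumpCount fun u => J u ω) s) s := by
  rcases eq_or_lt_of_le (zero_le (a := s)) with h0 | h0
  · subst h0
    rw [leftLim_eq_of_isBot fun b => zero_le, leftLim_eq_of_isBot fun b => zero_le,
      leftLim_eq_of_isBot fun b => zero_le]
    rfl
  · have := nhdsLT_neBot h0
    exact leftLim_eq_of_tendsto (tendsto_riskProcess_left hJc hNc s)

theorem riskProcess_eq_leftLim (hJc : IsCadlagPath fun t => J t ω)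
    (hNc : IsCadlagPath fun t => N t ω) {s : ℝ≥0}
    (hJ : Function.leftLim (fun u => J u ω) s = J s ω)
    (hN : Function.leftLim (fun u => N u ω) s = N s ω) :
    Function.leftLim (fun u => riskProcess R x J N C D u ω) s = riskProcess R x J N C D s ω := by
  rw [leftLim_riskProcess hJc hNc, hN, jumpCount_eq_leftLim hJc hJ]
  rfl

/-- The risk process at a claim arrival. -/
theorem riskProcess_of_arrival (hJc : IsCadlagPath fun t => J t ω)
    (hNc : IsCadlagPath fun t => N t ω) (hNm : Monotone fun t => N t ω) {s : ℝ≥0} (hs : 0 < s)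
    (hJ : Function.leftLim (fun u => J u ω) s = J s ω)
    (hN : N s ω = Function.leftLim (fun u => N u ω) s + 1) :
    riskProcess R x J N C D s ω = Function.leftLim (fun u => riskProcess R x J N C D u ω) s -
      C (J s ω) (Function.leftLim (fun u => N u ω) s + 1) ω := by
  have h1 : arrivalTime (fun u => N u ω) (N s ω) = s :=
    arrivalTime_of_mem_jumpSet hNc hNm ⟨hs, by show _ ≠ N s ω; rw [hN]; exact (Nat.lt_succ_self _).ne⟩
  rw [leftLim_riskProcess hJc hNc, jumpCount_eq_leftLim hJc hJ]
  have h2 : riskProcess R x J N C D s ω =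
    riskValue R x J N C D ω (N s ω) (jumpCount (fun u => J u ω) s) s := rfl
  -- The claim paid at `s` is the top term of the sum, and by `h1` its arrival time is `s`, so it is
  -- paid in state `J s ω`.
  rw [h2, hN, riskValue, riskValue, Finset.sum_Icc_succ_top (by omega), ← hN, h1]
  ring

/-- The risk process at a transition of the environment. -/
theorem riskProcess_of_transition (hJc : IsCadlagPath fun t => J t ω)
    (hNc : IsCadlagPath fun t => N t ω) {s : ℝ≥0}
    (hJ : s ∈ jumpSet fun u => J u ω)
    (hN : Function.leftLim (fun u => N u ω) s = N s ω) :
    riskProcess R x J N C D s ω = Function.leftLim (fun u => riskProcess R x J N C D u ω) s -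
      D (Function.leftLim (fun u => J u ω) s) (J s ω)
        (Function.leftLim (jumpCount fun u => J u ω) s + 1) ω := by
  have hc := jumpCount_eq_leftLim_add_one hJc hJ
  have h1 : arrivalTime (jumpCount fun u => J u ω) (jumpCount (fun u => J u ω) s) = s :=
    arrivalTime_of_mem_jumpSet (jumpCount_isCadlagPath hJc) (jumpCount_mono hJc)
      ⟨hJ.1, by rw [hc]; exact (Nat.lt_succ_self _).ne⟩
  rw [leftLim_riskProcess hJc hNc, hN]
  have h2 : riskProcess R x J N C D s ω =
    riskValue R x J N C D ω (N s ω) (jumpCount (fun u => J u ω) s) s := rfl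
  rw [h2, hc, riskValue, riskValue, Finset.sum_Icc_succ_top (by omega), ← hc, h1]
  ring

end RiskPaths

/-! ### Uniqueness of measures on generated σ-algebras -/

section Generation

variable {Ω : Type*} {mΩ : MeasurableSpace Ω}

/-- The sets `S ∩ T` form a π-system that generates `m₁ ⊔ m₂`. This is how statements about claims,
environment and arrivals are checked one source at a time. -/
theorem measure_eq_of_forall_inter {μ ν : Measure Ω} [IsFiniteMeasure μ] {m₁ m₂ : MeasurableSpace Ω}
    (h₁ : m₁ ≤ mΩ) (h₂ : m₂ ≤ mΩ)
    (h : ∀ S T, MeasurableSet[m₁] S → MeasurableSet[m₂] T → μ (S ∩ T) = ν (S ∩ T))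
    {A : Set Ω} (hA : MeasurableSet[m₁ ⊔ m₂] A) : μ A = ν A := by
  refine ext_on_measurableSpace_of_generate_finite mΩ
    {A | ∃ S T, MeasurableSet[m₁] S ∧ MeasurableSet[m₂] T ∧ A = S ∩ T} ?_ (sup_le h₁ h₂) ?_ ?_ ?_ hA
  · rintro _ ⟨S, T, hS, hT, rfl⟩
    exact h S T hS hT
  · apply le_antisymm
    · refine sup_le (fun S hS => ?_) fun T hT => ?_
      · exact MeasurableSpace.measurableSet_generateFrom
          ⟨S, Set.univ, hS, MeasurableSet.univ, (Set.inter_univ S).symm⟩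
      · exact MeasurableSpace.measurableSet_generateFrom
          ⟨Set.univ, T, MeasurableSet.univ, hT, (Set.univ_inter T).symm⟩
    · refine MeasurableSpace.generateFrom_le ?_
      rintro _ ⟨S, T, hS, hT, rfl⟩
      exact MeasurableSet.inter ((le_sup_left : m₁ ≤ m₁ ⊔ m₂) _ hS)
        ((le_sup_right : m₂ ≤ m₁ ⊔ m₂) _ hT)
  · rintro _ ⟨S, T, hS, hT, rfl⟩ _ ⟨S', T', hS', hT', rfl⟩ -
    exact ⟨S ∩ S', T ∩ T', hS.inter hS', hT.inter hT', Set.inter_inter_inter_comm S T S' T'⟩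
  · simpa using h _ _ MeasurableSet.univ MeasurableSet.univ

theorem measure_eq_of_forall_inter₃ {μ ν : Measure Ω} [IsFiniteMeasure μ]
    {m₁ m₂ m₃ : MeasurableSpace Ω} (h₁ : m₁ ≤ mΩ) (h₂ : m₂ ≤ mΩ) (h₃ : m₃ ≤ mΩ)
    (h : ∀ E S T, MeasurableSet[m₁] E → MeasurableSet[m₂] S → MeasurableSet[m₃] T →
      μ (E ∩ (S ∩ T)) = ν (E ∩ (S ∩ T)))
    {A : Set Ω} (hA : MeasurableSet[m₁ ⊔ (m₂ ⊔ m₃)] A) : μ A = ν A := by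
  refine measure_eq_of_forall_inter h₁ (sup_le h₂ h₃) (fun E B hE hB => ?_) hA
  have := measure_eq_of_forall_inter (μ := μ.restrict E) (ν := ν.restrict E) h₂ h₃
    (fun S T hS hT => ?_) hB
  · rwa [Measure.restrict_apply' (h₁ _ hE), Measure.restrict_apply' (h₁ _ hE), Set.inter_comm]
      at this
  · rw [Measure.restrict_apply' (h₁ _ hE), Measure.restrict_apply' (h₁ _ hE), Set.inter_comm,
      h E S T hE hS hT]

/-- The integrals only see the restrictions of the measures to `m`, and these coincide. -/
theorem lintegral_eq_of_forall_measure_eq {μ ν : Measure Ω} {m : MeasurableSpace Ω} (hm : m ≤ mΩ)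
    (h : ∀ A, MeasurableSet[m] A → μ A = ν A) {f : Ω → ℝ≥0∞} (hf : Measurable[m] f) :
    ∫⁻ ω, f ω ∂μ = ∫⁻ ω, f ω ∂ν := by
  rw [← lintegral_trim hm hf, ← lintegral_trim hm hf]
  congr 1
  refine @Measure.ext _ m _ _ fun A hA => ?_
  rw [trim_measurableSet_eq hm hA, trim_measurableSet_eq hm hA, h A hA]

variable {α : Type*} [MeasurableSpace α]

/-- The information on the process `Y` up to time `v`. -/
@[reducible]
def pathInfo (Y : ℝ≥0 → Ω → α) (v : ℝ≥0) : MeasurableSpace Ω :=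
  ⨆ r : Set.Iic v, MeasurableSpace.comap (Y r) inferInstance

theorem pathInfo_le {Y : ℝ≥0 → Ω → α} {v : ℝ≥0} {m : MeasurableSpace Ω}
    (hY : ∀ r ≤ v, Measurable[m] (Y r)) : pathInfo Y v ≤ m :=
  iSup_le fun r => (hY r r.2).comap_le

theorem measurable_pathInfo {Y : ℝ≥0 → Ω → α} {r v : ℝ≥0} (hrv : r ≤ v) :
    Measurable[pathInfo Y v] (Y r) :=
  (comap_measurable (Y r)).mono (le_iSup (fun r : Set.Iic v =>
    MeasurableSpace.comap (Y r) inferInstance) ⟨r, hrv⟩) le_rfl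

theorem pathInfo_mono {Y : ℝ≥0 → Ω → α} : Monotone (pathInfo Y) := fun _ _ h =>
  pathInfo_le fun _ hr => measurable_pathInfo (hr.trans h)

variable [Countable α] [MeasurableSingletonClass α]

/-- A finite measure on the paths of `Y` up to time `v` is determined by its finite dimensional
distributions on grids from `0` to `v`. -/
theorem measure_eq_of_forall_grid {μ ν : Measure Ω} [IsFiniteMeasure μ] {Y : ℝ≥0 → Ω → α}
    {v : ℝ≥0} (hY : ∀ r ≤ v, Measurable (Y r))
    (h : ∀ (m : ℕ) (τ : Fin (m + 1) → ℝ≥0), Monotone τ → τ 0 = 0 → τ (Fin.last m) = v →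
      ∀ ω₀, μ {ω | ∀ l, Y (τ l) ω = Y (τ l) ω₀} = ν {ω | ∀ l, Y (τ l) ω = Y (τ l) ω₀})
    {A : Set Ω} (hA : MeasurableSet[pathInfo Y v] A) : μ A = ν A := by
  -- Cylinders prescribe the values at finitely many times through a reference point. Two cylinders
  -- that meet intersect in a cylinder, with any common point as reference. The times `0` and `v`
  -- are included to match the grids in `h`.
  set C : Set (Set Ω) := {A | ∃ I : Finset ℝ≥0, 0 ∈ I ∧ v ∈ I ∧ (∀ r ∈ I, r ≤ v) ∧
    ∃ ω₀, A = {ω | ∀ r ∈ I, Y r ω = Y r ω₀}} with hC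
  have hkey : ∀ A ∈ C, μ A = ν A := by
    rintro _ ⟨I, h0, hv, hI, ω₀, rfl⟩
    obtain ⟨m, hm⟩ : ∃ m, I.card = m + 1 :=
      ⟨I.card - 1, (Nat.sub_add_cancel (Finset.card_pos.2 ⟨0, h0⟩)).symm⟩
    have hrange : ∀ r, r ∈ I ↔ ∃ l, I.orderEmbOfFin hm l = r := fun r => by
      rw [← Finset.mem_coe, ← Finset.range_orderEmbOfFin I hm]; rfl
    have hset : {ω | ∀ r ∈ I, Y r ω = Y r ω₀} =
        {ω | ∀ l, Y (I.orderEmbOfFin hm l) ω = Y (I.orderEmbOfFin hm l) ω₀} := by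
      ext ω
      simp only [Set.mem_ofPred_eq]
      exact ⟨fun H l => H _ ((hrange _).2 ⟨l, rfl⟩), fun H r hr => by
        obtain ⟨l, rfl⟩ := (hrange r).1 hr
        exact H l⟩
    rw [hset]
    refine h m _ (I.orderEmbOfFin hm).monotone ?_ ?_ ω₀
    · obtain ⟨l, hl⟩ := (hrange 0).1 h0
      exact le_antisymm (((I.orderEmbOfFin hm).monotone (Fin.zero_le l)).trans hl.le) zero_le
    · obtain ⟨l, hl⟩ := (hrange v).1 hv
      exact le_antisymm (hI _ ((hrange _).2 ⟨_, rfl⟩))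
        (hl.ge.trans ((I.orderEmbOfFin hm).monotone (Fin.le_last l)))
  have hpair : ∀ {r : ℝ≥0}, r ≤ v → ∀ A, (∃ ω₀, A = {ω | ∀ s ∈ ({0, r, v} : Finset ℝ≥0),
      Y s ω = Y s ω₀}) → A ∈ C := by
    rintro r hr A ⟨ω₀, rfl⟩
    exact ⟨_, by simp, by simp, by simp [hr], ω₀, rfl⟩
  have hpre : ∀ {r : ℝ≥0}, r ≤ v → ∀ p : α × α × α,
      ((fun ω => (Y 0 ω, Y r ω, Y v ω)) ⁻¹' {p}) = ∅ ∨
      ((fun ω => (Y 0 ω, Y r ω, Y v ω)) ⁻¹' {p}) ∈ C := by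
    intro r hr p
    rcases Set.eq_empty_or_nonempty ((fun ω => (Y 0 ω, Y r ω, Y v ω)) ⁻¹' {p}) with h0 | ⟨ω₀, h0⟩
    · exact Or.inl h0
    · refine Or.inr (hpair hr _ ⟨ω₀, ?_⟩)
      simp only [Set.mem_preimage, Set.mem_singleton_iff] at h0
      ext ω
      simp only [Set.mem_preimage, Set.mem_singleton_iff, ← h0, Prod.mk.injEq]
      simp
  have hle : pathInfo Y v ≤ mΩ := pathInfo_le hY
  refine ext_on_measurableSpace_of_generate_finite mΩ C hkey hle ?_ ?_ ?_ hA
  · apply le_antisymm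
    · refine pathInfo_le fun r hr => ?_
      have : Measurable[MeasurableSpace.generateFrom C] fun ω => (Y 0 ω, Y r ω, Y v ω) := by
        refine @measurable_to_countable' _ _ (_) _ (MeasurableSpace.generateFrom C) _ fun p => ?_
        rcases hpre hr p with h0 | h0
        · rw [h0]
          exact @MeasurableSet.empty _ (MeasurableSpace.generateFrom C)
        · exact MeasurableSpace.measurableSet_generateFrom h0
      exact (measurable_fst.comp measurable_snd).comp this
    · refine MeasurableSpace.generateFrom_le ?_
      rintro _ ⟨I, -, -, hI, ω₀, rfl⟩
      have : {ω | ∀ r ∈ I, Y r ω = Y r ω₀} = ⋂ r ∈ I, Y r ⁻¹' {Y r ω₀} := by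
        ext ω; simp
      rw [this]
      exact Finset.measurableSet_biInter _ fun r hr =>
        measurable_pathInfo (hI r hr) (measurableSet_singleton _)
  · rintro _ ⟨I, h0, hv, hI, ω₀, rfl⟩ _ ⟨I', h0', hv', hI', ω₀', rfl⟩ ⟨ω₁, h1, h1'⟩
    classical
    refine ⟨I ∪ I', Finset.mem_union_left _ h0, Finset.mem_union_left _ hv, ?_, ω₁, ?_⟩
    · intro r hr
      rcases Finset.mem_union.1 hr with hr | hr
      exacts [hI r hr, hI' r hr]
    · ext ω
      simp only [Set.mem_inter_iff, Set.mem_ofPred_eq, Finset.mem_union] at h1 h1' ⊢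
      constructor
      · rintro ⟨H, H'⟩ r (hr | hr)
        exacts [(H r hr).trans (h1 r hr).symm, (H' r hr).trans (h1' r hr).symm]
      · exact fun H => ⟨fun r hr => (H r (Or.inl hr)).trans (h1 r hr),
          fun r hr => (H r (Or.inr hr)).trans (h1' r hr)⟩
  · have hmeas : Measurable fun ω => (Y 0 ω, Y v ω, Y v ω) :=
      (hY 0 zero_le).prodMk ((hY v le_rfl).prodMk (hY v le_rfl))
    have key : ∀ κ : Measure Ω, κ Set.univ =
        ∑' p : α × α × α, κ ((fun ω => (Y 0 ω, Y v ω, Y v ω)) ⁻¹' {p}) := by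
      intro κ
      rw [← measure_iUnion]
      · congr 1
        ext ω
        simp
      · intro p q hpq
        exact Disjoint.preimage _ (Set.disjoint_singleton.2 hpq)
      · exact fun p => hmeas (measurableSet_singleton p)
    rw [key μ, key ν]
    refine tsum_congr fun p => ?_
    rcases hpre (le_refl v) p with h0 | h0
    · rw [h0, measure_empty, measure_empty]
    · exact hkey _ h0

end Generation

/-! ### The Markov and Poisson properties given the whole history -/

variable {n : ℕ} {Ω : Type*} {R : RiskParameters n} {i : Fin n} {J : ℝ≥0 → Ω → Fin n} {N : ℝ≥0 → Ω → ℕ}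
  {C : Fin n → ℕ → Ω → ℝ} {D : Fin n → Fin n → ℕ → Ω → ℝ}

/-- The transition probabilities of the environment. -/
def transProb (Q : Matrix (Fin n) (Fin n) ℝ) (h : ℝ≥0) (k j : Fin n) : ℝ :=
  NormedSpace.exp (h • Q) k j

/-- The Poisson probabilities of the number of arrivals in `(s, t]` given the environment. -/
def condPoisson (R : RiskParameters n) (J : ℝ≥0 → Ω → Fin n) (s t : ℝ≥0) (a : ℕ) (ω : Ω) : ℝ :=
  Real.exp (-cumRate R J s t ω) * cumRate R J s t ω ^ a / (a).factorial

theorem cumRate_nonneg {s t : ℝ≥0} (hst : s ≤ t) (ω : Ω) : 0 ≤ cumRate R J s t ω :=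
  intervalIntegral.integral_nonneg (by exact_mod_cast hst) fun _ _ => NNReal.coe_nonneg _

theorem condPoisson_nonneg {s t : ℝ≥0} (hst : s ≤ t) (a : ℕ) (ω : Ω) :
    0 ≤ condPoisson R J s t a ω := by
  have := cumRate_nonneg (R := R) (J := J) hst ω
  unfold condPoisson
  positivity

theorem condPoisson_le_one {s t : ℝ≥0} (hst : s ≤ t) (a : ℕ) (ω : Ω) :
    condPoisson R J s t a ω ≤ 1 := by
  have h0 := cumRate_nonneg (R := R) (J := J) hst ω
  have := Real.pow_div_factorial_le_exp _ h0 a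
  unfold condPoisson
  rw [mul_div_assoc, Real.exp_neg, inv_mul_le_iff₀ (Real.exp_pos _), mul_one]
  exact this

/-- The information on the environment. -/
@[reducible]
def envInfo (J : ℝ≥0 → Ω → Fin n) : MeasurableSpace Ω :=
  ⨆ t, MeasurableSpace.comap (J t) inferInstance

theorem measurable_envInfo (r : ℝ≥0) : Measurable[envInfo J] (J r) :=
  (comap_measurable (J r)).mono (le_iSup (fun r =>
    MeasurableSpace.comap (J r) inferInstance) r) le_rfl

/-- The information on the claims. -/
@[reducible]
def claimInfo (C : Fin n → ℕ → Ω → ℝ) (D : Fin n → Fin n → ℕ → Ω → ℝ) : MeasurableSpace Ω :=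
  MeasurableSpace.comap (fun ω c => allClaims C D c ω) inferInstance

/-- The information on the claims and on the environment and the arrivals up to time `v`. -/
@[reducible]
def history (J : ℝ≥0 → Ω → Fin n) (N : ℝ≥0 → Ω → ℕ) (C : Fin n → ℕ → Ω → ℝ)
    (D : Fin n → Fin n → ℕ → Ω → ℝ) (v : ℝ≥0) : MeasurableSpace Ω :=
  claimInfo C D ⊔ (pathInfo J v ⊔ pathInfo N v)

theorem history_mono : Monotone (history J N C D) := fun _ _ h =>
  sup_le_sup le_rfl (sup_le_sup (pathInfo_mono h) (pathInfo_mono h))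

theorem measurable_claims_claimInfo (c : (Fin n × ℕ) ⊕ (Fin n × Fin n × ℕ)) :
    Measurable[claimInfo C D] (allClaims C D c) :=
  (measurable_pi_apply c).comp (comap_measurable (fun ω c => allClaims C D c ω))

theorem measurable_env (r : ℝ≥0) :
    Measurable[MeasurableSpace.comap (fun ω t => (J t ω, N t ω)) inferInstance] (J r) :=
  (measurable_fst.comp (measurable_pi_apply (X := fun _ => Fin n × ℕ) r)).comp
    (comap_measurable (fun ω t => (J t ω, N t ω)))

theorem measurable_arrivals (r : ℝ≥0) :
    Measurable[MeasurableSpace.comap (fun ω t => (J t ω, N t ω)) inferInstance] (N r) :=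
  (measurable_snd.comp (measurable_pi_apply (X := fun _ => Fin n × ℕ) r)).comp
    (comap_measurable (fun ω t => (J t ω, N t ω)))

variable [mΩ : MeasurableSpace Ω] {μ : Measure Ω}

theorem measurable_condPoisson {s t : ℝ≥0} (hst : s ≤ t)
    (hJ : ∀ r ≤ t, Measurable (J r)) (hJc : ∀ ω, IsCadlagPath fun r => J r ω) (a : ℕ) :
    Measurable (condPoisson R J s t a) := by
  have : Measurable (cumRate R J s t) :=
    measurable_intervalIntegral_comp hst hJ hJc fun k => (R.rate k : ℝ)
  unfold condPoisson
  fun_prop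

theorem measurable_prod_condPoisson {m : ℕ} {τ : Fin (m + 1) → ℝ≥0} (hτ : Monotone τ)
    (hJ : ∀ r ≤ τ (Fin.last m), Measurable (J r)) (hJc : ∀ ω, IsCadlagPath fun r => J r ω)
    (a : Fin m → ℕ) {S : Set Ω} (hS : MeasurableSet S) :
    Measurable fun ω => (∏ l : Fin m, ENNReal.ofReal
      (condPoisson R J (τ l.castSucc) (τ l.succ) (a l) ω)) * S.indicator (1 : Ω → ℝ≥0∞) ω :=
  (Finset.measurable_fun_prod _ fun l _ => (measurable_condPoisson (hτ l.castSucc_lt_succ.le)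
    (fun r hr => hJ r (hr.trans (hτ (Fin.le_last _)))) hJc (a l)).ennreal_ofReal).mul
    (measurable_one.indicator hS)

theorem measurableSet_eq_add {f g : Ω → ℕ} (hf : Measurable f) (hg : Measurable g) (a : ℕ) :
    MeasurableSet {ω | f ω = g ω + a} :=
  measurableSet_eq_fun hf (hg.add_const a)

theorem monotone_snoc {m : ℕ} {τ : Fin (m + 1) → ℝ≥0} (hτ : Monotone τ) {w : ℝ≥0}
    (hw : τ (Fin.last m) ≤ w) : Monotone (Fin.snoc τ w : Fin (m + 2) → ℝ≥0) := by
  rw [Fin.monotone_iff_le_succ]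
  intro l
  induction l using Fin.lastCases with
  | last => simpa using hw
  | cast l =>
    rw [Fin.succ_castSucc, Fin.snoc_castSucc, Fin.snoc_castSucc]
    exact hτ l.castSucc_lt_succ.le

theorem forall_snoc {m : ℕ} {P : Fin (m + 1) → Prop} :
    (∀ l, P l) ↔ (∀ l : Fin m, P l.castSucc) ∧ P (Fin.last m) :=
  ⟨fun h => ⟨fun _ => h _, h _⟩, fun h l => by
    induction l using Fin.lastCases with
    | last => exact h.2
    | cast l => exact h.1 l⟩

theorem snoc_zero {β : Type*} {m : ℕ} (τ : Fin (m + 1) → β) (w : β) :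
    (Fin.snoc τ w : Fin (m + 2) → β) 0 = τ 0 := by
  rw [← Fin.castSucc_zero, Fin.snoc_castSucc]

theorem IsMarkovChain.measureReal_grid (hJ : IsMarkovChain R.Q i μ J) {m : ℕ}
    {τ : Fin (m + 1) → ℝ≥0} (hτ : Monotone τ) (h0 : τ 0 = 0) (e : Fin (m + 1) → Fin n) :
    μ.real {ω | ∀ l, J (τ l) ω = e l} = (if e 0 = i then 1 else 0) *
      ∏ l : Fin m, transProb R.Q (τ l.succ - τ l.castSucc) (e l.castSucc) (e l.succ) :=
  hJ.fdd m τ hτ h0 e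

/-- On a cylinder that ends at time `v` in state `k`, the condition at `w` adds one factor to the
product of transition probabilities; on all other cylinders both sides vanish. Cylinders determine
measures on `pathInfo J v`. -/
theorem IsMarkovChain.measure_inter [IsProbabilityMeasure μ]
    (hJ : IsMarkovChain R.Q i μ J) {v w : ℝ≥0} (hvw : v ≤ w) (k j : Fin n) {S : Set Ω}
    (hS : MeasurableSet[pathInfo J v] S) :
    μ (S ∩ ({ω | J v ω = k} ∩ {ω | J w ω = j})) =
      ENNReal.ofReal (transProb R.Q (w - v) k j) * μ (S ∩ {ω | J v ω = k}) := by
  have hm : ∀ r l, MeasurableSet {ω | J r ω = l} := fun r l =>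
    hJ.measurable r (measurableSet_singleton l)
  have := measure_eq_of_forall_grid (Y := J) (v := v)
    (μ := μ.restrict ({ω | J v ω = k} ∩ {ω | J w ω = j}))
    (ν := ENNReal.ofReal (transProb R.Q (w - v) k j) • μ.restrict {ω | J v ω = k})
    (fun r _ => hJ.measurable r) (fun m τ hτ h0 hv ω₀ => ?_) hS
  · rwa [Measure.smul_apply, Measure.restrict_apply' ((hm v k).inter (hm w j)),
      Measure.restrict_apply' (hm v k), smul_eq_mul] at this
  · rw [Measure.smul_apply, Measure.restrict_apply' ((hm v k).inter (hm w j)),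
      Measure.restrict_apply' (hm v k), smul_eq_mul]
    by_cases he : J v ω₀ = k
    · have e1 : {ω | ∀ l, J (τ l) ω = J (τ l) ω₀} ∩ {ω | J v ω = k} =
          {ω | ∀ l, J (τ l) ω = J (τ l) ω₀} := by
        refine Set.inter_eq_left.2 fun ω hω => ?_
        have := hω (Fin.last m)
        rw [hv] at this
        exact this.trans he
      have e2 : {ω | ∀ l, J (τ l) ω = J (τ l) ω₀} ∩ ({ω | J v ω = k} ∩ {ω | J w ω = j}) =
          {ω | ∀ l : Fin (m + 2), J ((Fin.snoc τ w : Fin (m + 2) → ℝ≥0) l) ω =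
            (Fin.snoc (fun l => J (τ l) ω₀) j : Fin (m + 2) → Fin n) l} := by
        rw [← Set.inter_assoc, e1]
        ext ω
        simp only [Set.mem_inter_iff, Set.mem_ofPred_eq]
        rw [forall_snoc (m := m + 1)]
        simp only [Fin.snoc_castSucc, Fin.snoc_last]
      rw [e1, e2, ← ofReal_measureReal, ← ofReal_measureReal,
        hJ.measureReal_grid hτ h0 (fun l => J (τ l) ω₀), hJ.measureReal_grid
          (monotone_snoc hτ (hv.le.trans hvw)) ((snoc_zero _ _).trans h0),
        Fin.prod_univ_castSucc, ← mul_assoc, ENNReal.ofReal_mul, mul_comm]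
      · simp only [Fin.succ_castSucc, Fin.snoc_castSucc, Fin.succ_last, Fin.snoc_last, snoc_zero,
          hv, he]
      · simp only [Fin.succ_castSucc, Fin.snoc_castSucc, snoc_zero]
        rw [← hJ.measureReal_grid hτ h0 (fun l => J (τ l) ω₀)]
        exact measureReal_nonneg
    · have e1 : {ω | ∀ l, J (τ l) ω = J (τ l) ω₀} ∩ {ω | J v ω = k} = ∅ := by
        ext ω
        simp only [Set.mem_inter_iff, Set.mem_ofPred_eq, Set.mem_empty_iff_false, iff_false]
        rintro ⟨h1, h2⟩
        have := h1 (Fin.last m)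
        rw [hv] at this
        exact he (this.symm.trans h2)
      rw [← Set.inter_assoc, e1, Set.empty_inter, measure_empty, mul_zero]

theorem envInfo_le (hJ : ∀ r, Measurable (J r)) : envInfo J ≤ mΩ :=
  iSup_le fun r => (hJ r).comap_le

/-- The event that the numbers of arrivals in the intervals of the grid `τ` are given by `a`. -/
def incrementEvent (N : ℝ≥0 → Ω → ℕ) {m : ℕ} (τ : Fin (m + 1) → ℝ≥0) (a : Fin m → ℕ) : Set Ω :=
  {ω | ∀ l : Fin m, N (τ l.succ) ω = N (τ l.castSucc) ω + a l}

theorem IsModulatedPoisson.measurableSet_incrementEvent (hN : IsModulatedPoisson R μ J N) {m : ℕ}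
    (τ : Fin (m + 1) → ℝ≥0) (a : Fin m → ℕ) : MeasurableSet (incrementEvent N τ a) := by
  have : incrementEvent N τ a = ⋂ l, {ω | N (τ l.succ) ω = N (τ l.castSucc) ω + a l} := by
    ext ω; simp [incrementEvent]
  rw [this]
  exact MeasurableSet.iInter fun l =>
    measurableSet_eq_fun (hN.measurable _) ((hN.measurable _).add_const _)

/-- Integration of functions of the environment over events on the arrival counts. -/
theorem IsModulatedPoisson.setLIntegral_incrementEvent [IsProbabilityMeasure μ]
    (hJ : IsMarkovChain R.Q i μ J) (hN : IsModulatedPoisson R μ J N) {m : ℕ}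
    {τ : Fin (m + 1) → ℝ≥0} (hτ : Monotone τ) (a : Fin m → ℕ) {ψ : Ω → ℝ≥0∞}
    (hψ : Measurable[envInfo J] ψ) :
    ∫⁻ ω in incrementEvent N τ a, ψ ω ∂μ =
      ∫⁻ ω, (∏ l : Fin m, ENNReal.ofReal (condPoisson R J (τ l.castSucc) (τ l.succ) (a l) ω)) * ψ ω
        ∂μ := by
  have hle := envInfo_le hJ.measurable
  have hle' : ∀ l : Fin m, τ l.castSucc ≤ τ l.succ := fun l => hτ l.castSucc_lt_succ.le
  have hm : ∀ l : Fin m, Measurable (condPoisson R J (τ l.castSucc) (τ l.succ) (a l)) := fun l =>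
    measurable_condPoisson (hle' l) (fun r _ => hJ.measurable r) hJ.cadlag _
  have hm' : Measurable fun ω => ∏ l : Fin m,
      ENNReal.ofReal (condPoisson R J (τ l.castSucc) (τ l.succ) (a l) ω) :=
    Finset.measurable_fun_prod _ fun l _ => (hm l).ennreal_ofReal
  -- The hypothesis `cond_increments` says that on environment events, restriction to the increment
  -- event and weighting by the Poisson product are the same measure; the passage to functions is
  -- formal.
  rw [lintegral_eq_of_forall_measure_eq hle (ν := μ.withDensity fun ω =>
    ∏ l : Fin m, ENNReal.ofReal (condPoisson R J (τ l.castSucc) (τ l.succ) (a l) ω)) _ hψ,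
    lintegral_withDensity_eq_lintegral_mul _ hm' (hψ.mono hle le_rfl)]
  · rfl
  intro S hS
  rw [Measure.restrict_apply (hle _ hS), withDensity_apply _ (hle _ hS), ← ofReal_measureReal,
    incrementEvent, hN.cond_increments m τ hτ a S hS, ofReal_integral_eq_lintegral_ofReal]
  · refine lintegral_congr fun ω => ?_
    rw [← ENNReal.ofReal_prod_of_nonneg fun l _ => condPoisson_nonneg (hle' l) _ _]
    rfl
  · refine Integrable.mono' (integrable_const (1 : ℝ))
      (Finset.measurable_fun_prod _ fun l _ => hm l).aestronglyMeasurable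
      (Eventually.of_forall fun ω => ?_)
    refine (Real.norm_of_nonneg (Finset.prod_nonneg fun l _ =>
      condPoisson_nonneg (hle' l) (a l) ω)).trans_le ?_
    exact Finset.prod_le_one (fun l _ => condPoisson_nonneg (hle' l) _ _)
      fun l _ => condPoisson_le_one (hle' l) _ _
  · exact Eventually.of_forall fun ω =>
      Finset.prod_nonneg fun l _ => condPoisson_nonneg (hle' l) _ _

/-- The distribution of the environment and the arrivals up to time `v` is determined by the
events on the arrival counts over grids. -/
theorem IsModulatedPoisson.measure_eq_of_forall_incrementEvent {κ ν : Measure Ω}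
    [IsFiniteMeasure κ] (hN : IsModulatedPoisson R μ J N) {v : ℝ≥0}
    (h : ∀ (m : ℕ) (τ : Fin (m + 1) → ℝ≥0), Monotone τ → τ (Fin.last m) = v →
      ∀ a, κ (incrementEvent N τ a) = ν (incrementEvent N τ a))
    {A : Set Ω} (hA : MeasurableSet[pathInfo N v] A) : κ A = ν A := by
  refine measure_eq_of_forall_grid (fun r _ => hN.measurable r) (fun m τ hτ h0 hv ω₀ => ?_) hA
  -- As `N` starts at `0` and `τ 0 = 0`, prescribing values on the grid is the same as prescribing
  -- increments.
  have : {ω | ∀ l, N (τ l) ω = N (τ l) ω₀} =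
      incrementEvent N τ fun l => N (τ l.succ) ω₀ - N (τ l.castSucc) ω₀ := by
    ext ω
    have hle : ∀ l : Fin m, N (τ l.castSucc) ω₀ ≤ N (τ l.succ) ω₀ := fun l =>
      hN.mono ω₀ (hτ l.castSucc_lt_succ.le)
    simp only [incrementEvent, Set.mem_ofPred_eq]
    constructor
    · intro H l
      rw [H, H]
      have := hle l
      omega
    · intro H l
      induction l using Fin.induction with
      | zero => rw [h0, hN.zero, hN.zero]
      | succ l ih =>
        rw [H l, ih]
        have := hle l
        omega
  rw [this]
  exact h m τ hτ hv _

theorem IsRiskModel.measurable_claims (h : IsRiskModel R i μ J N C D)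
    (c : (Fin n × ℕ) ⊕ (Fin n × Fin n × ℕ)) : Measurable (allClaims C D c) := by
  rcases c with c | c
  exacts [h.measurable_C _ _, h.measurable_D _ _ _]

theorem IsRiskModel.claimInfo_le (h : IsRiskModel R i μ J N C D) : claimInfo C D ≤ mΩ :=
  (measurable_pi_iff.2 h.measurable_claims).comap_le

theorem IsRiskModel.history_le (h : IsRiskModel R i μ J N C D) (v : ℝ≥0) :
    history J N C D v ≤ mΩ :=
  sup_le h.claimInfo_le (sup_le (pathInfo_le fun r _ => h.chain.measurable r)
    (pathInfo_le fun r _ => h.arrivals.measurable r))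

theorem IsRiskModel.indep (h : IsRiskModel R i μ J N C D) :
    Indep (claimInfo C D) (MeasurableSpace.comap (fun ω t => (J t ω, N t ω)) inferInstance) μ :=
  h.indep_env

theorem IsRiskModel.env_le (h : IsRiskModel R i μ J N C D) :
    MeasurableSpace.comap (fun ω t => (J t ω, N t ω)) inferInstance ≤ mΩ :=
  (measurable_pi_iff.2 fun t =>
    (h.chain.measurable t).prodMk (h.arrivals.measurable t)).comap_le

theorem IsRiskModel.setLIntegral_inter (h : IsRiskModel R i μ J N C D) {E G : Set Ω}
    (hE : MeasurableSet[claimInfo C D] E)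
    (hG : MeasurableSet[MeasurableSpace.comap (fun ω t => (J t ω, N t ω)) inferInstance] G)
    {ψ : Ω → ℝ≥0∞}
    (hψ : Measurable[MeasurableSpace.comap (fun ω t => (J t ω, N t ω)) inferInstance] ψ) :
    ∫⁻ ω in E ∩ G, ψ ω ∂μ = μ E * ∫⁻ ω in G, ψ ω ∂μ := by
  have hE' := h.claimInfo_le _ hE
  have hG' := h.env_le _ hG
  have := lintegral_mul_eq_lintegral_mul_lintegral_of_independent_measurableSpace h.claimInfo_le
    h.env_le h.indep (f := E.indicator 1) (g := G.indicator ψ)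
    (@Measurable.indicator _ _ (_) _ _ _ _ (@measurable_one _ _ _ (_) _) hE)
    (@Measurable.indicator _ _ (_) _ _ _ _ hψ hG)
  rw [lintegral_indicator_one hE', lintegral_indicator hG'] at this
  rw [← this, ← lintegral_indicator (hE'.inter hG')]
  refine lintegral_congr fun ω => ?_
  by_cases h1 : ω ∈ E <;> by_cases h2 : ω ∈ G <;> simp [h1, h2]

theorem IsRiskModel.measure_inter (h : IsRiskModel R i μ J N C D) {E G : Set Ω}
    (hE : MeasurableSet[claimInfo C D] E)
    (hG : MeasurableSet[MeasurableSpace.comap (fun ω t => (J t ω, N t ω)) inferInstance] G) :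
    μ (E ∩ G) = μ E * μ G :=
  (Indep_iff _ _ _).1 h.indep E G hE hG

/-- The Markov property of the environment with respect to the whole history. -/
theorem IsRiskModel.markov [IsProbabilityMeasure μ] (h : IsRiskModel R i μ J N C D) {v w : ℝ≥0}
    (hvw : v ≤ w) (k j : Fin n) {A : Set Ω} (hA : MeasurableSet[history J N C D v] A) :
    μ (A ∩ ({ω | J v ω = k} ∩ {ω | J w ω = j})) =
      ENNReal.ofReal (transProb R.Q (w - v) k j) * μ (A ∩ {ω | J v ω = k}) := by
  set p := ENNReal.ofReal (transProb R.Q (w - v) k j) with hp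
  have hpt : p ≠ ∞ := ENNReal.ofReal_ne_top
  have hJm := h.chain.measurable
  have hNm := h.arrivals.measurable
  have hmj : ∀ r l, MeasurableSet[envInfo J] {ω | J r ω = l} := fun r l =>
    measurable_envInfo r (measurableSet_singleton l)
  have hJe : envInfo J ≤ MeasurableSpace.comap (fun ω t => (J t ω, N t ω)) inferInstance :=
    iSup_le fun r => (measurable_env r).comap_le
  set K := {ω | J v ω = k} ∩ {ω | J w ω = j} with hK
  set V := {ω | J v ω = k} with hV
  have hKe : MeasurableSet[envInfo J] K := (hmj v k).inter (hmj w j)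
  have hVe : MeasurableSet[envInfo J] V := hmj v k
  have hle := envInfo_le hJm
  have hJp : pathInfo J v ≤ envInfo J := pathInfo_le fun r _ => measurable_envInfo r
  have hNp : pathInfo N v ≤ MeasurableSpace.comap (fun ω t => (J t ω, N t ω)) inferInstance :=
    pathInfo_le fun r _ => measurable_arrivals r
  -- The claims are left out here; they factor out by independence at the end.
  have key : ∀ S, MeasurableSet[pathInfo J v] S → ∀ T, MeasurableSet[pathInfo N v] T →
      μ (S ∩ T ∩ K) = p * μ (S ∩ T ∩ V) := by
    intro S hS T hT
    have hSK : MeasurableSet[envInfo J] (S ∩ K) := (hJp _ hS).inter hKe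
    have hSV : MeasurableSet[envInfo J] (S ∩ V) := (hJp _ hS).inter hVe
    have := h.arrivals.measure_eq_of_forall_incrementEvent (v := v) (κ := μ.restrict (S ∩ K))
      (ν := p • μ.restrict (S ∩ V)) (fun m τ hτ hτv a => ?_) hT
    · rw [Measure.smul_apply, Measure.restrict_apply' (hle _ hSK),
        Measure.restrict_apply' (hle _ hSV), smul_eq_mul] at this
      rw [Set.inter_right_comm, Set.inter_comm, this, Set.inter_comm T, Set.inter_right_comm]
    · have hI := h.arrivals.measurableSet_incrementEvent τ a
      have e : ∀ G, MeasurableSet[envInfo J] G → μ.restrict (S ∩ G) (incrementEvent N τ a) =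
          ∫⁻ ω, (∏ l : Fin m, ENNReal.ofReal
            (condPoisson R J (τ l.castSucc) (τ l.succ) (a l) ω)) * S.indicator 1 ω
            ∂(μ.restrict G) := by
        intro G hG
        have hSG : MeasurableSet[envInfo J] (S ∩ G) := (hJp _ hS).inter hG
        have h1 := h.arrivals.setLIntegral_incrementEvent h.chain hτ a
          (ψ := (S ∩ G).indicator 1)
          (@Measurable.indicator _ _ (_) _ _ _ _ (@measurable_one _ _ _ (_) _) hSG)
        rw [lintegral_indicator_one (hle _ hSG), Measure.restrict_apply' hI] at h1
        rw [Measure.restrict_apply' (hle _ hSG), Set.inter_comm, h1,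
          ← lintegral_indicator (hle _ hG)]
        refine lintegral_congr fun ω => ?_
        by_cases h1 : ω ∈ S <;> by_cases h2 : ω ∈ G <;> simp [h1, h2]
      rw [Measure.smul_apply, smul_eq_mul, e K hKe, e V hVe, ← smul_eq_mul,
        ← lintegral_smul_measure]
      -- The Poisson weights involve the environment up to `v` only, so the Markov property of `J`
      -- with respect to its own past is enough.
      refine lintegral_eq_of_forall_measure_eq (hJp.trans hle) (fun B hB => ?_) ?_
      · rw [Measure.smul_apply, Measure.restrict_apply' (hle _ hKe),
          Measure.restrict_apply' (hle _ hVe), smul_eq_mul]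
        exact h.chain.measure_inter hvw k j hB
      · exact measurable_prod_condPoisson (mΩ := pathInfo J v) hτ
          (fun r hr => measurable_pathInfo (hr.trans hτv.le)) h.chain.cadlag a hS
  have := measure_eq_of_forall_inter₃ (μ := μ.restrict K) (ν := p • μ.restrict V) h.claimInfo_le
    (hJp.trans hle) (hNp.trans h.env_le) (fun E S T hE hS hT => ?_) hA
  · rwa [Measure.smul_apply, Measure.restrict_apply' (hle _ hKe),
        Measure.restrict_apply' (hle _ hVe), smul_eq_mul] at this
  · have hST := (hJe _ (hJp _ hS)).inter (hNp _ hT)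
    rw [Measure.smul_apply, Measure.restrict_apply' (hle _ hKe),
        Measure.restrict_apply' (hle _ hVe), smul_eq_mul, Set.inter_assoc E, Set.inter_assoc E,
        h.measure_inter hE (hST.inter (hJe _ hKe)), h.measure_inter hE (hST.inter (hJe _ hVe)),
        key S hS T hT]
    ring

/-- The conditional distribution of the arrival counts given the whole history. -/
theorem IsRiskModel.poisson [IsProbabilityMeasure μ] (h : IsRiskModel R i μ J N C D) {v w : ℝ≥0}
    (hvw : v ≤ w) (a : ℕ) {A : Set Ω} (hA : MeasurableSet[history J N C D v] A) :
    μ (A ∩ {ω | N w ω = N v ω + a}) = ∫⁻ ω in A, ENNReal.ofReal (condPoisson R J v w a ω) ∂μ := by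
  have hJm := h.chain.measurable
  have hNm := h.arrivals.measurable
  have hJe : envInfo J ≤ MeasurableSpace.comap (fun ω t => (J t ω, N t ω)) inferInstance :=
    iSup_le fun r => (measurable_env r).comap_le
  have hle := envInfo_le hJm
  have hJp : pathInfo J v ≤ envInfo J := pathInfo_le fun r _ => measurable_envInfo r
  have hNp : pathInfo N v ≤ MeasurableSpace.comap (fun ω t => (J t ω, N t ω)) inferInstance :=
    pathInfo_le fun r _ => measurable_arrivals r
  set K := {ω | N w ω = N v ω + a} with hK
  have hKe : MeasurableSet[MeasurableSpace.comap (fun ω t => (J t ω, N t ω)) inferInstance] K :=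
    measurableSet_eq_add
      (mΩ := MeasurableSpace.comap (fun ω t => (J t ω, N t ω)) inferInstance) (measurable_arrivals w) (measurable_arrivals v) a
  have hKm := h.env_le _ hKe
  have hpm : Measurable[envInfo J] fun ω => ENNReal.ofReal (condPoisson R J v w a ω) :=
    (measurable_condPoisson (mΩ := envInfo J) hvw (fun r _ => measurable_envInfo r)
      h.chain.cadlag a).ennreal_ofReal
  -- The conditional probability depends on the environment after `v`, so it enters as a density and
  -- not as a constant factor.
  set ν := μ.withDensity fun ω => ENNReal.ofReal (condPoisson R J v w a ω) with hν
  have hνa : ∀ B, MeasurableSet B → ν B = ∫⁻ ω in B, ENNReal.ofReal (condPoisson R J v w a ω) ∂μ :=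
    fun B hB => withDensity_apply _ hB
  have key : ∀ S, MeasurableSet[pathInfo J v] S → ∀ T, MeasurableSet[pathInfo N v] T →
      μ (S ∩ T ∩ K) = ν (S ∩ T) := by
    intro S hS T hT
    have hSm := hle _ (hJp _ hS)
    have := h.arrivals.measure_eq_of_forall_incrementEvent (v := v) (κ := μ.restrict (S ∩ K))
      (ν := ν.restrict S) (fun m τ hτ hτv b => ?_) hT
    · rw [Measure.restrict_apply' (hSm.inter hKm), Measure.restrict_apply' hSm] at this
      rw [Set.inter_right_comm, Set.inter_comm, this, Set.inter_comm T]
    · have hI := h.arrivals.measurableSet_incrementEvent τ b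
      have hSi : Measurable[envInfo J] (S.indicator (1 : Ω → ℝ≥0∞)) :=
        @Measurable.indicator _ _ (_) _ _ _ _ (@measurable_one _ _ _ (_) _) (hJp _ hS)
      have h1 := h.arrivals.setLIntegral_incrementEvent h.chain
        (monotone_snoc hτ (hτv.le.trans hvw)) (Fin.snoc b a) hSi
      have h2 := h.arrivals.setLIntegral_incrementEvent h.chain hτ b
        (@Measurable.mul _ _ _ _ _ (_) _ _ hpm hSi)
      -- The event on `(v, w]` is one more increment at the end of the grid. It contributes the last
      -- factor of the product in `h1`, which `h2` treats as part of the integrand.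
      have h3 : incrementEvent N (Fin.snoc τ w : Fin (m + 2) → ℝ≥0)
          (Fin.snoc b a : Fin (m + 1) → ℕ) = incrementEvent N τ b ∩ K := by
        ext ω
        simp only [incrementEvent, Set.mem_inter_iff, Set.mem_ofPred_eq, hK]
        rw [forall_snoc (m := m)]
        simp only [Fin.snoc_castSucc, Fin.snoc_last, Fin.succ_castSucc, Fin.succ_last, hτv]
      rw [lintegral_indicator_one hSm, Measure.restrict_apply hSm, h3] at h1
      simp only [Fin.prod_univ_castSucc (n := m), Fin.snoc_castSucc, Fin.snoc_last, Fin.succ_castSucc, Fin.succ_last, hτv] at h1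
      rw [Measure.restrict_apply' (hSm.inter hKm), Measure.restrict_apply' hSm, hνa _ (hI.inter hSm),
        Set.inter_left_comm, h1, Set.inter_comm, ← Measure.restrict_restrict hSm,
        ← lintegral_indicator hSm]
      calc _ = _ := lintegral_congr fun ω => by rw [mul_assoc]; rfl
        _ = _ := h2.symm
        _ = _ := lintegral_congr fun ω => by by_cases h1 : ω ∈ S <;> simp [h1]
  have := measure_eq_of_forall_inter₃ (μ := μ.restrict K) (ν := ν) h.claimInfo_le
    (hJp.trans hle) (hNp.trans h.env_le) (fun E S T hE hS hT => ?_) hA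
  · rwa [Measure.restrict_apply' hKm, hνa _ (h.history_le v _ hA)] at this
  · have hST := (hJe _ (hJp _ hS)).inter (hNp _ hT)
    have hSTm := h.env_le _ hST
    rw [Measure.restrict_apply' hKm, hνa _ ((h.claimInfo_le _ hE).inter hSTm), Set.inter_assoc E,
      h.setLIntegral_inter hE hST (hpm.mono hJe le_rfl), h.measure_inter hE (hST.inter hKe),
      key S hS T hT, hνa _ hSTm]

/-! ### Bounds for sums over jumps -/

open Classical in
/-- The indicator function of a change of the state. -/
def changeInd {α : Type*} (a b : α) : ℝ≥0∞ := if a = b then 0 else 1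

theorem changeInd_self {α : Type*} (a : α) : changeInd a a = 0 := if_pos rfl

theorem changeInd_of_ne {α : Type*} {a b : α} (h : a ≠ b) : changeInd a b = 1 := if_neg h

theorem changeInd_ne_top {α : Type*} (a b : α) : changeInd a b ≠ ∞ := by
  unfold changeInd
  split_ifs <;> simp

theorem measurable_comp_pair {α Ω M : Type*} [Countable α] [MeasurableSpace α]
    [MeasurableSingletonClass α] [MeasurableSpace Ω] [MeasurableSpace M] {Y : ℝ≥0 → Ω → α}
    (hY : ∀ r, Measurable (Y r)) (φ : α → α → M) (v w : ℝ≥0) :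
    Measurable fun ω => φ (Y v ω) (Y w ω) :=
  (measurable_of_countable fun p : α × α => φ p.1 p.2).comp ((hY v).prodMk (hY w))

section Paths

variable {α : Type*} [TopologicalSpace α] [DiscreteTopology α] {g : ℝ≥0 → α}

/-- If the endpoint values differ, some step of a fine grid changes the value, and the sum over a
fine grid equals the sum over the jumps. The number of jumps therefore dominates the number of
changes over any grid, coarse ones included. -/
theorem changeInd_le_jsum (hg : IsCadlagPath g) {a b : ℝ≥0} (hab : a ≤ b) :
    changeInd (g a) (g b) ≤ jsum changeInd g a b := by
  classical
  by_cases h : g a = g b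
  · rw [h, changeInd_self]
    exact zero_le
  · rw [changeInd_of_ne h]
    obtain ⟨m, hm, hm0⟩ := ((eventually_sum_grid_eq_jsum hg
      (φ := changeInd) changeInd_self hab).and
      (eventually_ne_atTop 0)).exists
    rw [← hm]
    by_contra hlt
    apply h
    have hz : ∀ l < m, g (grid a b m l) = g (grid a b m (l + 1)) := by
      intro l hl
      by_contra hne
      apply hlt
      refine le_trans ?_ (Finset.single_le_sum (f := fun l =>
        changeInd (g (grid a b m l)) (g (grid a b m (l + 1))))
        (fun _ _ => zero_le) (Finset.mem_range.2 hl))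
      rw [changeInd_of_ne hne]
    have : ∀ l ≤ m, g (grid a b m l) = g a := by
      intro l
      induction l with
      | zero => intro _; rw [grid_zero]
      | succ l ih => exact fun hl => (hz l hl).symm.trans (ih (Nat.le_of_succ_le hl))
    have hlast := this m le_rfl
    rw [grid_last hab hm0] at hlast
    exact hlast.symm

theorem jsum_mono_right (hg : IsCadlagPath g) (φ : α → α → ℝ≥0∞) {a b c : ℝ≥0} (hab : a ≤ b)
    (hbc : b ≤ c) : jsum φ g a b ≤ jsum φ g a c := by
  rw [← jsum_add hg φ hab hbc]
  exact le_self_add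

theorem jsum_mono {φ ψ : α → α → ℝ≥0∞} (hg : IsCadlagPath g) (h : ∀ a b, φ a b ≤ ψ a b)
    (s t : ℝ≥0) : jsum φ g s t ≤ jsum ψ g s t := by
  unfold jsum
  rw [finsum_mem_eq_finite_toFinset_sum _ (finite_jumpSet_Ioc hg s t),
    finsum_mem_eq_finite_toFinset_sum _ (finite_jumpSet_Ioc hg s t)]
  exact Finset.sum_le_sum fun r _ => h _ _

theorem jsum_ne_top {φ : α → α → ℝ≥0∞} (hg : IsCadlagPath g) (h : ∀ a b, φ a b ≠ ∞)
    (s t : ℝ≥0) : jsum φ g s t ≠ ∞ := by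
  unfold jsum
  rw [finsum_mem_eq_finite_toFinset_sum _ (finite_jumpSet_Ioc hg s t)]
  exact ENNReal.sum_ne_top.2 fun r _ => h _ _

variable [Countable α] [MeasurableSpace α] [MeasurableSingletonClass α]
  {Ω : Type*} [MeasurableSpace Ω] {μ : Measure Ω}

/-- A bound on the expected sum over the jumps from a bound on short intervals. -/
theorem lintegral_jsum_le {Y : ℝ≥0 → Ω → α} (hY : ∀ r, Measurable (Y r))
    (hc : ∀ ω, IsCadlagPath fun r => Y r ω) {φ : α → α → ℝ≥0∞} (hφ : ∀ a, φ a a = 0)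
    {c : ℝ≥0 → ℝ≥0}
    (h : ∀ᶠ d in 𝓝 (0 : ℝ≥0), ∀ v, ∫⁻ ω, φ (Y v ω) (Y (v + d) ω) ∂μ ≤ c d)
    {s t : ℝ≥0} (hst : s ≤ t) {b : ℝ≥0}
    (hb : Tendsto (fun m : ℕ => m * c ((t - s) / m)) atTop (𝓝 b)) :
    ∫⁻ ω, jsum φ (fun r => Y r ω) s t ∂μ ≤ b := by
  -- Fatou's lemma for the grid sums: for large `m`, the `m`-th one has integral at most `m * c ((t
  -- - s) / m)`.
  have h1 : ∀ ω, jsum φ (fun r => Y r ω) s t = liminf (fun m : ℕ => ∑ l ∈ Finset.range m,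
      φ (Y (grid s t m l) ω) (Y (grid s t m (l + 1)) ω)) atTop := fun ω =>
    (tendsto_sum_grid_jsum (hc ω) hφ hst).liminf_eq.symm
  simp only [h1]
  refine (lintegral_liminf_le fun m => Finset.measurable_fun_sum _ fun l _ =>
    measurable_comp_pair hY φ _ _).trans ?_
  have h2 : Tendsto (fun m : ℕ => ((m * c ((t - s) / m) : ℝ≥0) : ℝ≥0∞)) atTop (𝓝 b) :=
    ENNReal.tendsto_coe.2 hb
  rw [← h2.liminf_eq]
  have hlim : Tendsto (fun m : ℕ => (t - s) / m) atTop (𝓝 0) :=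
    tendsto_const_div_atTop_nhds_zero_nat _
  refine liminf_le_liminf ?_
  filter_upwards [hlim.eventually h] with m hm
  rw [lintegral_finsetSum _ fun l _ => measurable_comp_pair hY φ _ _]
  have : ∀ l ∈ Finset.range m, ∫⁻ ω, φ (Y (grid s t m l) ω) (Y (grid s t m (l + 1)) ω) ∂μ ≤
      c ((t - s) / m) := by
    intro l _
    rw [grid_succ]
    exact hm _
  refine (Finset.sum_le_sum this).trans ?_
  rw [Finset.sum_const, Finset.card_range, nsmul_eq_mul]
  push_cast
  exact le_rfl

end Paths

/-! ### Increments of environment and arrivals over short intervals -/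

section Increments

variable {n : ℕ} {Ω : Type*} {R : RiskParameters n} {i : Fin n} {J : ℝ≥0 → Ω → Fin n} {N : ℝ≥0 → Ω → ℕ}
  {C : Fin n → ℕ → Ω → ℝ} {D : Fin n → Fin n → ℕ → Ω → ℝ}

/-- A bound for the arrival intensity. -/
def rateBound (R : RiskParameters n) : ℝ := ∑ k, (R.rate k : ℝ)

theorem rateBound_nonneg (R : RiskParameters n) : 0 ≤ rateBound R :=
  Finset.sum_nonneg fun _ _ => NNReal.coe_nonneg _

theorem rate_le_rateBound (R : RiskParameters n) (k : Fin n) : (R.rate k : ℝ) ≤ rateBound R :=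
  Finset.single_le_sum (f := fun k => (R.rate k : ℝ)) (fun _ _ => NNReal.coe_nonneg _)
    (Finset.mem_univ k)

theorem cumRate_le (v h : ℝ≥0) (ω : Ω) : cumRate R J v (v + h) ω ≤ rateBound R * h := by
  refine (le_abs_self _).trans ?_
  have := intervalIntegral.norm_integral_le_of_norm_le_const (a := (v : ℝ)) (b := ((v + h : ℝ≥0) : ℝ))
    (f := fun u => (R.rate (J u.toNNReal ω) : ℝ)) (C := rateBound R) fun u _ => by
      rw [Real.norm_of_nonneg (NNReal.coe_nonneg _)]
      exact rate_le_rateBound R _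
  refine this.trans_eq ?_
  rw [NNReal.coe_add, add_sub_cancel_left, abs_of_nonneg h.coe_nonneg]

/-- An off-diagonal entry of the statement that `exp (u • Q)` has derivative `Q` at `u = 0`. The
passage through `ENNReal.ofReal` takes a positive part, which can only bring the entry closer to the
nonnegative number `h * Q k j`. -/
theorem transProb_isLittleO (Q : Matrix (Fin n) (Fin n) ℝ) {k j : Fin n} (hkj : k ≠ j)
    (hQ : 0 ≤ Q k j) {ε : ℝ} (hε : 0 < ε) : ∀ᶠ h in 𝓝 (0 : ℝ≥0),
      |(ENNReal.ofReal (transProb Q h k j)).toReal - h * Q k j| ≤ ε * h := by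
  let _ : NormedRing (Matrix (Fin n) (Fin n) ℝ) := Matrix.linftyOpNormedRing
  let _ : NormedAlgebra ℝ (Matrix (Fin n) (Fin n) ℝ) := Matrix.linftyOpNormedAlgebra
  have h1 := hasDerivAt_exp_smul_const (𝕂 := ℝ) Q (0 : ℝ)
  rw [zero_smul, NormedSpace.exp_zero, one_mul] at h1
  have h2 : HasDerivAt (fun u : ℝ => NormedSpace.exp (u • Q) k j) (Q k j) 0 := by
    let L : Matrix (Fin n) (Fin n) ℝ →L[ℝ] ℝ := LinearMap.toContinuousLinearMap
      { toFun := fun M => M k j, map_add' := fun _ _ => rfl, map_smul' := fun _ _ => rfl }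
    exact L.hasFDerivAt.comp_hasDerivAt (0 : ℝ) h1
  have h3 := (hasDerivAt_iff_isLittleO.1 h2).def hε
  filter_upwards [(NNReal.continuous_coe.tendsto 0).eventually h3] with h h5
  simp only [zero_smul, NormedSpace.exp_zero, Matrix.one_apply_ne hkj, sub_zero, smul_eq_mul,
    Real.norm_eq_abs, abs_of_nonneg h.coe_nonneg] at h5
  have h6 : transProb Q h k j = NormedSpace.exp ((h : ℝ) • Q) k j := rfl
  rw [ENNReal.toReal_ofReal', h6]
  have h7 : 0 ≤ (h : ℝ) * Q k j := mul_nonneg h.coe_nonneg hQ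
  refine le_trans ?_ h5
  rcases le_total 0 (NormedSpace.exp ((h : ℝ) • Q) k j) with h8 | h8
  · rw [max_eq_left h8]
  · rw [max_eq_right h8, abs_of_nonpos (by linarith), abs_of_nonpos (by linarith)]
    linarith

variable [mΩ : MeasurableSpace Ω] {μ : Measure Ω}

theorem IsModulatedPoisson.measureReal_inter (hN : IsModulatedPoisson R μ J N) {v w : ℝ≥0} (hvw : v ≤ w) (a : ℕ) {A : Set Ω}
    (hA : MeasurableSet[envInfo J] A) :
    μ.real (A ∩ {ω | N w ω = N v ω + a}) = ∫ ω in A, condPoisson R J v w a ω ∂μ := by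
  have hτ : Monotone ![v, w] := by
    rw [Fin.monotone_iff_le_succ]
    intro l
    fin_cases l
    simpa using hvw
  have := hN.cond_increments 1 ![v, w] hτ (fun _ => a) A hA
  simpa [condPoisson] using this

variable [IsProbabilityMeasure μ]

theorem IsMarkovChain.measureReal_inter (hJ : IsMarkovChain R.Q i μ J) (v h : ℝ≥0)
    (k j : Fin n) : μ.real ({ω | J v ω = k} ∩ {ω | J (v + h) ω = j}) =
      (ENNReal.ofReal (transProb R.Q h k j)).toReal * μ.real {ω | J v ω = k} := by
  have := hJ.measure_inter (le_self_add : v ≤ v + h) k j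
    (@MeasurableSet.univ _ (pathInfo J v))
  rw [Set.univ_inter, Set.univ_inter, add_tsub_cancel_left] at this
  rw [measureReal_def, this, ENNReal.toReal_mul, measureReal_def]

/-- A union bound over the pairs of distinct states. `transProb_isLittleO` with `ε = 1` gives each
pair at most `(|Q k j| + 1) * h`. -/
theorem IsMarkovChain.measureReal_change_le (hJ : IsMarkovChain R.Q i μ J) :
    ∃ K : ℝ, 0 ≤ K ∧ ∀ᶠ h in 𝓝 (0 : ℝ≥0), ∀ v,
      μ.real {ω | J v ω ≠ J (v + h) ω} ≤ K * h := by
  refine ⟨∑ k, ∑ j, (|R.Q k j| + 1), by positivity, ?_⟩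
  have hQ : ∀ᶠ h in 𝓝 (0 : ℝ≥0), ∀ k j : Fin n, k ≠ j →
      |(ENNReal.ofReal (transProb R.Q h k j)).toReal - h * R.Q k j| ≤ 1 * h :=
    eventually_all.2 fun k => eventually_all.2 fun j => by
      by_cases hkj : k = j
      · exact Eventually.of_forall fun _ hne => absurd hkj hne
      · exact (transProb_isLittleO R.Q hkj (R.Q_nonneg k j hkj) one_pos).mono fun _ h _ => h
  filter_upwards [hQ] with h hh v
  have hsub : {ω | J v ω ≠ J (v + h) ω} ⊆ ⋃ k, ⋃ j,
      if k = j then ∅ else {ω | J v ω = k} ∩ {ω | J (v + h) ω = j} := by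
    intro ω hω
    refine Set.mem_iUnion.2 ⟨J v ω, Set.mem_iUnion.2 ⟨J (v + h) ω, ?_⟩⟩
    rw [if_neg hω]
    exact ⟨rfl, rfl⟩
  refine (measureReal_mono hsub).trans ((measureReal_iUnion_fintype_le _).trans ?_)
  rw [Finset.sum_mul]
  refine Finset.sum_le_sum fun k _ => (measureReal_iUnion_fintype_le _).trans ?_
  rw [Finset.sum_mul]
  refine Finset.sum_le_sum fun j _ => ?_
  have h0 : (0 : ℝ) ≤ h := h.coe_nonneg
  split_ifs with hkj
  · rw [measureReal_empty]
    positivity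
  · rw [hJ.measureReal_inter]
    have h1 := abs_le.1 (hh k j hkj)
    have h2 := le_abs_self (R.Q k j)
    have h3 : (ENNReal.ofReal (transProb R.Q h k j)).toReal ≤ (|R.Q k j| + 1) * h := by
      nlinarith [h1.2]
    calc _ ≤ (ENNReal.ofReal (transProb R.Q h k j)).toReal * 1 :=
          mul_le_mul_of_nonneg_left measureReal_le_one ENNReal.toReal_nonneg
      _ ≤ _ := by rw [mul_one]; exact h3

theorem integrable_condPoisson (hJ : IsMarkovChain R.Q i μ J) {v w : ℝ≥0} (hvw : v ≤ w) (a : ℕ) :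
    Integrable (condPoisson R J v w a) μ := by
  refine Integrable.mono' (integrable_const (1 : ℝ))
    (measurable_condPoisson hvw (fun r _ => hJ.measurable r) hJ.cadlag a).aestronglyMeasurable
    (Eventually.of_forall fun ω => ?_)
  rw [Real.norm_of_nonneg (condPoisson_nonneg hvw a ω)]
  exact condPoisson_le_one hvw a ω

theorem measureReal_eq_of_lintegral_condPoisson (hJ : IsMarkovChain R.Q i μ J) {v w : ℝ≥0}
    (hvw : v ≤ w) (a : ℕ) {A B : Set Ω}
    (h : μ B = ∫⁻ ω in A, ENNReal.ofReal (condPoisson R J v w a ω) ∂μ) :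
    μ.real B = ∫ ω in A, condPoisson R J v w a ω ∂μ := by
  rw [integral_eq_lintegral_of_nonneg_ae
    (Eventually.of_forall fun ω => condPoisson_nonneg hvw a ω)
    (integrable_condPoisson hJ hvw a).integrableOn.aestronglyMeasurable, ← h, measureReal_def]

/-- Given the environment, there is no arrival with probability `exp (-Λ) ≥ 1 - Λ`, where the
accumulated rate `Λ` is at most `rateBound R * h`. The event `A` may concern the environment at any
time, including during the interval itself. -/
theorem IsModulatedPoisson.measureReal_inter_change_le (hJ : IsMarkovChain R.Q i μ J)
    (hN : IsModulatedPoisson R μ J N) (v h : ℝ≥0) {A : Set Ω}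
    (hA : MeasurableSet[envInfo J] A) :
    μ.real (A ∩ {ω | N v ω ≠ N (v + h) ω}) ≤ rateBound R * h * μ.real A := by
  have hAm := envInfo_le hJ.measurable _ hA
  have hvw : v ≤ v + h := le_self_add
  have h1 := hN.measureReal_inter hvw 0 hA
  have hmeas : MeasurableSet {ω | N (v + h) ω = N v ω + 0} :=
    measurableSet_eq_add (hN.measurable _) (hN.measurable _) 0
  have h2 : A ∩ {ω | N v ω ≠ N (v + h) ω} = A \ {ω | N (v + h) ω = N v ω + 0} := by
    ext ω
    simp only [Set.mem_inter_iff, Set.mem_ofPred_eq, Set.mem_sdiff, add_zero, ne_eq]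
    rw [eq_comm]
  have h3 := measureReal_inter_add_sdiff (μ := μ) (s := A) hmeas
  have h4 : (1 - rateBound R * h) * μ.real A ≤ ∫ ω in A, condPoisson R J v (v + h) 0 ω ∂μ := by
    calc _ = ∫ ω in A, (1 - rateBound R * h) ∂μ := by
          rw [setIntegral_const, smul_eq_mul, mul_comm]
      _ ≤ _ := by
          refine setIntegral_mono (integrable_const _).integrableOn
            (integrable_condPoisson hJ hvw 0).integrableOn fun ω => ?_
          have h5 := Real.add_one_le_exp (-cumRate R J v (v + h) ω)
          have h6 := cumRate_le (R := R) (J := J) v h ω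
          simp only [condPoisson, pow_zero, Nat.factorial_zero, Nat.cast_one, div_one, mul_one]
          linarith
  rw [h2]
  linarith

/-- At most one arrival has conditional probability `exp (-Λ) * (1 + Λ) ≥ (1 - Λ) * (1 + Λ) = 1 -
Λ²`. -/
theorem IsModulatedPoisson.measureReal_double_le (hJ : IsMarkovChain R.Q i μ J)
    (hN : IsModulatedPoisson R μ J N) (v h : ℝ≥0) :
    μ.real {ω | N v ω + 2 ≤ N (v + h) ω} ≤ (rateBound R * h) ^ 2 := by
  have hvw : v ≤ v + h := le_self_add
  have hmeas : ∀ a, MeasurableSet {ω | N (v + h) ω = N v ω + a} := fun a =>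
    measurableSet_eq_add (hN.measurable _) (hN.measurable _) a
  have h0 := hN.measureReal_inter hvw 0 (@MeasurableSet.univ _ (envInfo J))
  have h1 := hN.measureReal_inter hvw 1 (@MeasurableSet.univ _ (envInfo J))
  rw [Set.univ_inter, setIntegral_univ] at h0 h1
  have h2 : {ω | N v ω + 2 ≤ N (v + h) ω} =
      ({ω | N (v + h) ω = N v ω + 0} ∪ {ω | N (v + h) ω = N v ω + 1})ᶜ := by
    ext ω
    have := hN.mono ω hvw
    simp only [Set.mem_ofPred_eq, Set.mem_compl_iff, Set.mem_union] at this ⊢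
    omega
  have hd : Disjoint {ω | N (v + h) ω = N v ω + 0} {ω | N (v + h) ω = N v ω + 1} := by
    rw [Set.disjoint_left]
    intro ω h3 h4
    simp only [Set.mem_ofPred_eq] at h3 h4
    omega
  rw [h2, probReal_compl_eq_one_sub ((hmeas 0).union (hmeas 1)), measureReal_union hd (hmeas 1),
    h0, h1, ← integral_add (integrable_condPoisson hJ hvw 0) (integrable_condPoisson hJ hvw 1)]
  have h5 : ∫ _ω, (1 - (rateBound R * h) ^ 2 : ℝ) ∂μ ≤
      ∫ ω, (condPoisson R J v (v + h) 0 ω + condPoisson R J v (v + h) 1 ω) ∂μ := by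
    refine integral_mono (integrable_const _)
      ((integrable_condPoisson hJ hvw 0).add (integrable_condPoisson hJ hvw 1)) fun ω => ?_
    have h6 := cumRate_le (R := R) (J := J) v h ω
    have h7 := cumRate_nonneg (R := R) (J := J) hvw ω
    have h8 := Real.add_one_le_exp (-cumRate R J v (v + h) ω)
    simp only [condPoisson, pow_zero, Nat.factorial_zero, Nat.cast_one, div_one, mul_one, pow_one,
      Nat.factorial_one]
    have h9 : cumRate R J v (v + h) ω ^ 2 ≤ (rateBound R * h) ^ 2 := pow_le_pow_left₀ h7 h6 2
    nlinarith
  rw [integral_const, probReal_univ, one_smul] at h5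
  linarith

end Increments

/-! ### Types of jumps and their compensators -/

section Compensator

variable {n : ℕ} {Ω : Type*} {R : RiskParameters n} {i : Fin n} {J : ℝ≥0 → Ω → Fin n}
  {N : ℝ≥0 → Ω → ℕ} {C : Fin n → ℕ → Ω → ℝ} {D : Fin n → Fin n → ℕ → Ω → ℝ}

/-- The environment together with the number of arrivals. -/
def joint (J : ℝ≥0 → Ω → Fin n) (N : ℝ≥0 → Ω → ℕ) (r : ℝ≥0) (ω : Ω) : Fin n × ℕ :=
  (J r ω, N r ω)

/-- The jump from `p` to `q` is an arrival in state `k` if `k = j`, and a transition from `k` to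
`j` otherwise. -/
def IsJump (k j : Fin n) (p q : Fin n × ℕ) : Prop :=
  p.1 = k ∧ q.1 = j ∧ q.2 = p.2 + if k = j then 1 else 0

theorem IsJump.ne {k j : Fin n} {p q : Fin n × ℕ} (h : IsJump k j p q) : p ≠ q := by
  rintro rfl
  obtain ⟨h1, h2, h3⟩ := h
  rw [if_pos (h1.symm.trans h2)] at h3
  omega

open Classical in
/-- The indicator function of a jump of the given type. -/
def jumpInd (k j : Fin n) (p q : Fin n × ℕ) : ℝ≥0∞ := if IsJump k j p q then 1 else 0

theorem jumpInd_self (k j : Fin n) (p : Fin n × ℕ) : jumpInd k j p p = 0 :=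
  if_neg fun h => h.ne rfl

theorem jumpInd_le (k j : Fin n) (p q : Fin n × ℕ) : jumpInd k j p q ≤ changeInd p q := by
  unfold jumpInd changeInd
  split_ifs with h1 h2
  · exact absurd h2 h1.ne
  all_goals simp

open Classical in
/-- The indicator function of a jump which is neither a single arrival nor a transition without
arrival. -/
def irregularInd (p q : Fin n × ℕ) : ℝ≥0∞ :=
  if p ≠ q ∧ ¬ IsJump p.1 q.1 p q then 1 else 0

theorem irregularInd_self (p : Fin n × ℕ) : irregularInd p p = 0 := if_neg fun h => h.1 rfl

/-- The intensities of the jumps from `k` to `j`. -/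
def jumpRate (R : RiskParameters n) (k j : Fin n) : ℝ≥0 :=
  if k = j then R.rate k else (R.Q k j).toNNReal

/-- The intensity of the jumps from `k` to `j` as a function of the current state. -/
def stateRate (R : RiskParameters n) (k j a : Fin n) : ℝ :=
  if a = k then (jumpRate R k j : ℝ) else 0

variable [mΩ : MeasurableSpace Ω] {μ : Measure Ω}

theorem IsRiskModel.joint_cadlag (h : IsRiskModel R i μ J N C D) (ω : Ω) :
    IsCadlagPath fun r => joint J N r ω :=
  (h.chain.cadlag ω).prodMk (h.arrivals.cadlag ω)

theorem IsRiskModel.measurable_joint (h : IsRiskModel R i μ J N C D) (r : ℝ≥0) :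
    Measurable (joint J N r) :=
  (h.chain.measurable r).prodMk (h.arrivals.measurable r)

theorem lintegral_pair_eq {α : Type*} [Countable α] [MeasurableSpace α]
    [MeasurableSingletonClass α] {X Y : Ω → α} (hX : Measurable X) (hY : Measurable Y)
    {P : α → α → Prop} {φ : α → α → ℝ≥0∞} (h1 : ∀ a b, P a b → φ a b = 1)
    (h0 : ∀ a b, ¬ P a b → φ a b = 0) (A : Set Ω) :
    ∫⁻ ω in A, φ (X ω) (Y ω) ∂μ = μ (A ∩ {ω | P (X ω) (Y ω)}) := by
  have hm : MeasurableSet {ω | P (X ω) (Y ω)} :=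
    (hX.prodMk hY) (Set.to_countable {p : α × α | P p.1 p.2}).measurableSet
  rw [Set.inter_comm, ← Measure.restrict_apply hm, ← lintegral_indicator_one hm]
  refine lintegral_congr fun ω => ?_
  by_cases h : P (X ω) (Y ω)
  · rw [h1 _ _ h, Set.indicator_of_mem (by exact h)]; rfl
  · rw [h0 _ _ h, Set.indicator_of_notMem (by exact h)]

theorem IsRiskModel.measurable_integral (h : IsRiskModel R i μ J N C D) (c : Fin n → ℝ)
    (v d : ℝ≥0) : Measurable fun ω => ∫ r in (v : ℝ)..((v + d : ℝ≥0) : ℝ), c (J r.toNNReal ω) :=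
  measurable_intervalIntegral_comp le_self_add (fun r _ => h.chain.measurable r) h.chain.cadlag c

theorem IsRiskModel.setIntegral_stateRate (h : IsRiskModel R i μ J N C D) (k j : Fin n) (v : ℝ≥0)
    (A : Set Ω) :
    ∫ ω in A, stateRate R k j (J v ω) ∂μ = jumpRate R k j * μ.real (A ∩ {ω | J v ω = k}) := by
  have hm : MeasurableSet {ω | J v ω = k} := h.chain.measurable v (measurableSet_singleton k)
  have : (fun ω => stateRate R k j (J v ω)) =
      {ω | J v ω = k}.indicator fun _ => (jumpRate R k j : ℝ) := by
    ext ω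
    simp [stateRate, Set.indicator_apply]
  rw [this, integral_indicator hm, setIntegral_const, smul_eq_mul,
    measureReal_restrict_apply hm, Set.inter_comm, mul_comm]

variable [IsProbabilityMeasure μ]

/-- Whether the state changes is decided by the environment, given which an arrival still has
probability `O(d)`; the two bounds of order `d` multiply. -/
theorem IsRiskModel.measureReal_common_le (h : IsRiskModel R i μ J N C D) :
    ∃ K : ℝ, 0 ≤ K ∧ ∀ᶠ d in 𝓝 (0 : ℝ≥0), ∀ v,
      μ.real ({ω | J v ω ≠ J (v + d) ω} ∩ {ω | N v ω ≠ N (v + d) ω}) ≤ K * d ^ 2 := by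
  obtain ⟨K, hK, hd⟩ := h.chain.measureReal_change_le
  refine ⟨rateBound R * K, mul_nonneg (rateBound_nonneg R) hK, ?_⟩
  filter_upwards [hd] with d hd v
  have hA : MeasurableSet[envInfo J] {ω | J v ω ≠ J (v + d) ω} := by
    have hp : Measurable[envInfo J] fun ω => (J v ω, J (v + d) ω) :=
      (measurable_envInfo v).prodMk (measurable_envInfo _)
    exact hp (Set.to_countable {p : Fin n × Fin n | p.1 ≠ p.2}).measurableSet
  refine (h.arrivals.measureReal_inter_change_le h.chain v d hA).trans ?_
  calc _ ≤ rateBound R * d * (K * d) :=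
        mul_le_mul_of_nonneg_left (hd v) (mul_nonneg (rateBound_nonneg R) d.coe_nonneg)
    _ = _ := by ring

/-- The probability of a change over an interval of length `d` is bounded linearly in `d`, so the
sum of these bounds over a partition does not depend on the mesh. The mean number of jumps found
here supplies the domination in all later limits. -/
theorem IsRiskModel.exists_lintegral_jsum_changeInd_le (h : IsRiskModel R i μ J N C D) :
    ∃ K : ℝ≥0, ∀ s t, s ≤ t →
      ∫⁻ ω, jsum changeInd (fun r => joint J N r ω) s t ∂μ ≤ (K * (t - s) : ℝ≥0) := by
  obtain ⟨K, hK, hd⟩ := h.chain.measureReal_change_le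
  refine ⟨(K + rateBound R).toNNReal, fun s t hst => ?_⟩
  refine lintegral_jsum_le h.measurable_joint h.joint_cadlag changeInd_self
    (c := fun d => (K + rateBound R).toNNReal * d) ?_ hst ?_
  · filter_upwards [hd] with d hd v
    rw [← setLIntegral_univ, lintegral_pair_eq (P := fun a b => a ≠ b) (h.measurable_joint v)
      (h.measurable_joint _) (fun a b => changeInd_of_ne)
      (fun a b hab => by rw [not_not.1 hab, changeInd_self]) Set.univ, Set.univ_inter,
      ← ofReal_measureReal]
    rw [← ENNReal.ofReal_coe_nnreal]
    refine ENNReal.ofReal_le_ofReal ?_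
    have hsub : {ω | joint J N v ω ≠ joint J N (v + d) ω} ⊆
        {ω | J v ω ≠ J (v + d) ω} ∪ (Set.univ ∩ {ω | N v ω ≠ N (v + d) ω}) := by
      intro ω hω
      by_contra hc
      simp only [Set.univ_inter, Set.mem_union, Set.mem_ofPred_eq, not_or, not_not] at hc
      exact hω (Prod.ext hc.1 hc.2)
    have h1 := h.arrivals.measureReal_inter_change_le h.chain v d
      (@MeasurableSet.univ _ (envInfo J))
    rw [probReal_univ, mul_one] at h1
    refine (measureReal_mono hsub).trans ((measureReal_union_le _ _).trans ?_)
    rw [NNReal.coe_mul, Real.coe_toNNReal _ (add_nonneg hK (rateBound_nonneg R)), add_mul]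
    exact add_le_add (hd v) h1
  · refine tendsto_const_nhds.congr' ?_
    filter_upwards [eventually_ne_atTop 0] with m hm
    have : (m : ℝ≥0) ≠ 0 := by exact_mod_cast hm
    field_simp

/-- Almost surely, all jumps are single arrivals or transitions without arrival. -/
theorem IsRiskModel.lintegral_jsum_irregularInd (h : IsRiskModel R i μ J N C D) {s t : ℝ≥0}
    (hst : s ≤ t) : ∫⁻ ω, jsum irregularInd (fun r => joint J N r ω) s t ∂μ = 0 := by
  obtain ⟨K, hK, hd⟩ := h.measureReal_common_le
  have hK' : 0 ≤ K + rateBound R ^ 2 := by positivity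
  rw [← nonpos_iff_eq_zero, ← ENNReal.coe_zero]
  refine lintegral_jsum_le h.measurable_joint h.joint_cadlag irregularInd_self
    (c := fun d => (K + rateBound R ^ 2).toNNReal * d ^ 2) ?_ hst ?_
  · filter_upwards [hd] with d hd v
    rw [← setLIntegral_univ, lintegral_pair_eq (φ := irregularInd)
      (P := fun p q => p ≠ q ∧ ¬ IsJump p.1 q.1 p q)
      (h.measurable_joint v) (h.measurable_joint _) (fun a b hab => if_pos hab)
      (fun a b hab => if_neg hab) Set.univ, Set.univ_inter, ← ofReal_measureReal]
    rw [← ENNReal.ofReal_coe_nnreal]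
    refine ENNReal.ofReal_le_ofReal ?_
    have hsub : {ω | joint J N v ω ≠ joint J N (v + d) ω ∧
          ¬ IsJump (joint J N v ω).1 (joint J N (v + d) ω).1 (joint J N v ω)
            (joint J N (v + d) ω)} ⊆
        ({ω | J v ω ≠ J (v + d) ω} ∩ {ω | N v ω ≠ N (v + d) ω}) ∪
          {ω | N v ω + 2 ≤ N (v + d) ω} := by
      rintro ω ⟨h1, h2⟩
      have hm : N v ω ≤ N (v + d) ω := h.arrivals.mono ω le_self_add
      -- If the state is the same at both ends, the count moves but not by one, hence by at least
      -- two; if the state differs, the count moves as well.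
      have h3 : ¬ (J v ω = J (v + d) ω ∧ N v ω = N (v + d) ω) := fun he =>
        h1 (Prod.ext he.1 he.2)
      have h4 : N (v + d) ω ≠ N v ω + if J v ω = J (v + d) ω then 1 else 0 := fun he =>
        h2 ⟨rfl, rfl, he⟩
      simp only [Set.mem_union, Set.mem_inter_iff, Set.mem_ofPred_eq, ne_eq]
      split_ifs at h4 <;> omega
    refine (measureReal_mono hsub).trans ((measureReal_union_le _ _).trans ?_)
    rw [NNReal.coe_mul, Real.coe_toNNReal _ hK', add_mul, NNReal.coe_pow, ← mul_pow]
    exact add_le_add (hd v) (h.arrivals.measureReal_double_le h.chain v d)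
  -- A bound of order `d²` per interval leaves a total of order `1 / m`.
  · have : Tendsto (fun m : ℕ => (K + rateBound R ^ 2).toNNReal * (t - s) ^ 2 / (m : ℝ≥0)) atTop
        (𝓝 0) := tendsto_const_div_atTop_nhds_zero_nat _
    refine this.congr' ?_
    filter_upwards [eventually_ne_atTop 0] with m hm
    have : (m : ℝ≥0) ≠ 0 := by exact_mod_cast hm
    field_simp

theorem IsRiskModel.integrable_comp (h : IsRiskModel R i μ J N C D) (c : Fin n → ℝ) (v : ℝ≥0) :
    Integrable (fun ω => c (J v ω)) μ := by
  refine Integrable.mono' (integrable_const (∑ j, |c j|))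
    ((measurable_of_countable c).comp (h.chain.measurable v)).aestronglyMeasurable
    (Eventually.of_forall fun ω => ?_)
  exact Finset.single_le_sum (f := fun j => |c j|) (fun j _ => abs_nonneg _) (Finset.mem_univ _)

theorem IsRiskModel.integrable_integral (h : IsRiskModel R i μ J N C D) (c : Fin n → ℝ)
    (v d : ℝ≥0) :
    Integrable (fun ω => ∫ r in (v : ℝ)..((v + d : ℝ≥0) : ℝ), c (J r.toNNReal ω)) μ := by
  refine Integrable.mono' (integrable_const ((∑ j, |c j|) * |((v + d : ℝ≥0) : ℝ) - v|))
    (h.measurable_integral c v d).aestronglyMeasurable (Eventually.of_forall fun ω => ?_)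
  exact intervalIntegral.norm_integral_le_of_norm_le_const fun r _ =>
    Finset.single_le_sum (f := fun j => |c j|) (fun j _ => abs_nonneg _) (Finset.mem_univ _)

/-- Over short intervals, the integral of a function of the environment is well approximated by
means of the initial value. -/
theorem IsRiskModel.abs_integral_sub_le (h : IsRiskModel R i μ J N C D) (c : Fin n → ℝ) :
    ∃ K : ℝ, 0 ≤ K ∧ ∀ v d : ℝ≥0, ∀ A : Set Ω,
      |∫ ω in A, (∫ r in (v : ℝ)..((v + d : ℝ≥0) : ℝ), c (J r.toNNReal ω)) ∂μ -
        d * ∫ ω in A, c (J v ω) ∂μ| ≤ K * d ^ 2 := by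
  obtain ⟨K, hK⟩ := h.exists_lintegral_jsum_changeInd_le
  set M := ∑ j, |c j| with hM
  have hM0 : 0 ≤ M := Finset.sum_nonneg fun j _ => abs_nonneg _
  have hMc : ∀ j, |c j| ≤ M := fun j =>
    Finset.single_le_sum (f := fun j => |c j|) (fun j _ => abs_nonneg _) (Finset.mem_univ _)
  refine ⟨2 * M * K, by positivity, fun v d A => ?_⟩
  -- The number of jumps in `(v, v + d]` is at least one as soon as the environment leaves its state
  -- at `v`, so the pathwise error is at most `2 * M * d * κ`. The second factor `d` comes from the
  -- mean of `κ`.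
  set κ : Ω → ℝ≥0∞ := fun ω => jsum changeInd (fun r => joint J N r ω) v (v + d) with hκ
  have hvd : v ≤ v + d := le_self_add
  have hκm : Measurable κ := measurable_jsum hvd (fun r _ => h.measurable_joint r) h.joint_cadlag
    changeInd_self
  have hκK := hK v (v + d) hvd
  rw [add_tsub_cancel_left] at hκK
  have hκt : ∀ ω, κ ω ≠ ∞ := fun ω => jsum_ne_top (h.joint_cadlag ω) changeInd_ne_top _ _
  have hκi : Integrable (fun ω => (κ ω).toReal) μ :=
    integrable_toReal_of_lintegral_ne_top hκm.aemeasurable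
      (hκK.trans_lt ENNReal.coe_lt_top).ne
  have hκb : ∫ ω, (κ ω).toReal ∂μ ≤ K * d := by
    rw [integral_toReal hκm.aemeasurable (Eventually.of_forall fun ω => (hκt ω).lt_top)]
    exact ENNReal.toReal_mono ENNReal.coe_ne_top hκK
  have hpath : ∀ ω, |(∫ r in (v : ℝ)..((v + d : ℝ≥0) : ℝ), c (J r.toNNReal ω)) - d * c (J v ω)| ≤
      2 * M * d * (κ ω).toReal := by
    intro ω
    have e : (∫ r in (v : ℝ)..((v + d : ℝ≥0) : ℝ), c (J r.toNNReal ω)) - d * c (J v ω) =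
        ∫ r in (v : ℝ)..((v + d : ℝ≥0) : ℝ), (c (J r.toNNReal ω) - c (J v ω)) := by
      rw [intervalIntegral.integral_sub (intervalIntegrable_path (h.chain.cadlag ω) c _ _)
        intervalIntegrable_const, intervalIntegral.integral_const, NNReal.coe_add,
        add_sub_cancel_left, smul_eq_mul]
    rw [e]
    have := intervalIntegral.norm_integral_le_of_norm_le_const (a := (v : ℝ))
      (b := ((v + d : ℝ≥0) : ℝ)) (f := fun r => c (J r.toNNReal ω) - c (J v ω))
      (C := 2 * M * (κ ω).toReal) fun r hr => by
        rw [Set.uIoc_of_le (by exact_mod_cast hvd)] at hr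
        have hr1 : v ≤ r.toNNReal := NNReal.le_toNNReal_of_coe_le hr.1.le
        have hr2 : r.toNNReal ≤ v + d := Real.toNNReal_le_iff_le_coe.2 hr.2
        by_cases hJ : J r.toNNReal ω = J v ω
        · rw [hJ, sub_self, norm_zero]
          positivity
        · have h1 : (1 : ℝ≥0∞) ≤ κ ω := by
            rw [← changeInd_of_ne (a := joint J N v ω) (b := joint J N r.toNNReal ω)
              fun he => hJ (congrArg Prod.fst he).symm]
            exact (changeInd_le_jsum (h.joint_cadlag ω) hr1).trans
              (jsum_mono_right (h.joint_cadlag ω) _ hr1 hr2)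
          have h2 : 1 ≤ (κ ω).toReal := by
            have := ENNReal.toReal_mono (hκt ω) h1
            rwa [ENNReal.toReal_one] at this
          calc ‖c (J r.toNNReal ω) - c (J v ω)‖ ≤ |c (J r.toNNReal ω)| + |c (J v ω)| :=
                abs_sub _ _
            _ ≤ 2 * M * 1 := by linarith [hMc (J r.toNNReal ω), hMc (J v ω)]
            _ ≤ _ := by gcongr
    refine this.trans_eq ?_
    rw [NNReal.coe_add, add_sub_cancel_left, abs_of_nonneg d.coe_nonneg]
    ring
  rw [← integral_const_mul, ← integral_sub (h.integrable_integral c v d).integrableOn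
    ((h.integrable_comp c v).const_mul _).integrableOn]
  refine abs_integral_le_integral_abs.trans ?_
  calc ∫ ω in A, |(∫ r in (v : ℝ)..((v + d : ℝ≥0) : ℝ), c (J r.toNNReal ω)) - d * c (J v ω)| ∂μ
      ≤ ∫ ω in A, 2 * M * d * (κ ω).toReal ∂μ :=
        integral_mono (((h.integrable_integral c v d).sub
          ((h.integrable_comp c v).const_mul _)).abs.integrableOn)
          (hκi.const_mul _).integrableOn hpath
    _ ≤ ∫ ω, 2 * M * d * (κ ω).toReal ∂μ :=
        setIntegral_le_integral (hκi.const_mul _) (Eventually.of_forall fun ω => by positivity)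
    _ = 2 * M * d * ∫ ω, (κ ω).toReal ∂μ := integral_const_mul _ _
    _ ≤ 2 * M * d * (K * d) := by gcongr
    _ = _ := by ring

theorem abs_measureReal_sub_le {S T B : Set Ω} (h1 : S ⊆ T ∪ B) (h2 : T ⊆ S ∪ B) :
    |μ.real S - μ.real T| ≤ μ.real B := by
  have h3 := (measureReal_mono (μ := μ) h1).trans (measureReal_union_le _ _)
  have h4 := (measureReal_mono (μ := μ) h2).trans (measureReal_union_le _ _)
  rw [abs_le]
  constructor <;> linarith

/-- The conditional jump probabilities over short intervals. -/
theorem IsRiskModel.abs_measureReal_jump_sub_le (h : IsRiskModel R i μ J N C D) (k j : Fin n)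
    {ε : ℝ} (hε : 0 < ε) : ∀ᶠ d in 𝓝 (0 : ℝ≥0), ∀ v, ∀ A, MeasurableSet[history J N C D v] A →
      |μ.real (A ∩ {ω | IsJump k j (joint J N v ω) (joint J N (v + d) ω)}) -
        ∫ ω in A, (∫ r in (v : ℝ)..((v + d : ℝ≥0) : ℝ), stateRate R k j (J r.toNNReal ω)) ∂μ| ≤
        ε * d := by
  obtain ⟨K₁, hK₁, hF₁⟩ := h.abs_integral_sub_le (stateRate R k j)
  obtain ⟨K₂, hK₂, hF₂⟩ := h.abs_integral_sub_le fun a => (R.rate a : ℝ)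
  obtain ⟨K₃, hK₃, hF₃⟩ := h.measureReal_common_le
  have hQ : k ≠ j → ∀ᶠ d in 𝓝 (0 : ℝ≥0),
      |(ENNReal.ofReal (transProb R.Q d k j)).toReal - d * R.Q k j| ≤ ε / 2 * d := fun hkj =>
    transProb_isLittleO R.Q hkj (R.Q_nonneg k j hkj) (half_pos hε)
  -- The four errors of order `d²`: freezing the state in the two integrals, a change of state
  -- coinciding with arrivals, and the Poisson probability of one arrival compared with its mean.
  set K := K₁ + K₂ + K₃ + rateBound R ^ 2 with hK
  have hK0 : 0 ≤ K := by positivity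
  have hsmall : ∀ᶠ d : ℝ≥0 in 𝓝 (0 : ℝ≥0), K * (d : ℝ) < ε / 2 := by
    have : Tendsto (fun d : ℝ≥0 => K * (d : ℝ)) (𝓝 0) (𝓝 (K * (0 : ℝ≥0))) :=
      (continuous_const.mul NNReal.continuous_coe).tendsto 0
    rw [NNReal.coe_zero, mul_zero] at this
    exact this.eventually (gt_mem_nhds (half_pos hε))
  filter_upwards [hsmall, hF₃, eventually_imp_distrib_left.2 hQ] with d hd hF₃ hQ v A hA
  have hvd : v ≤ v + d := le_self_add
  have hd0 : (0 : ℝ) ≤ d := d.coe_nonneg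
  have hKd : K * (d : ℝ) ^ 2 ≤ ε / 2 * d := by nlinarith
  have hV : MeasurableSet[history J N C D v] {ω | J v ω = k} :=
    (measurable_pathInfo le_rfl).mono (le_sup_left.trans le_sup_right) le_rfl
      (measurableSet_singleton k)
  have hVA := hA.inter hV
  have e1 := hF₁ v d A
  rw [h.setIntegral_stateRate] at e1
  set I := ∫ ω in A, (∫ r in (v : ℝ)..((v + d : ℝ≥0) : ℝ), stateRate R k j (J r.toNNReal ω)) ∂μ
    with hI
  set V := {ω | J v ω = k} with hVdef
  have e3 := hF₃ v
  set B := {ω | J v ω ≠ J (v + d) ω} ∩ {ω | N v ω ≠ N (v + d) ω} with hB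
  rw [abs_le] at e1
  by_cases hkj : k = j
  · subst hkj
    -- An increment by one which starts in `k` and is not a jump of type `(k, k)` comes with a
    -- change of state, hence lies in `B`.
    have e4 : |μ.real (A ∩ {ω | IsJump k k (joint J N v ω) (joint J N (v + d) ω)}) -
        μ.real ((A ∩ V) ∩ {ω | N (v + d) ω = N v ω + 1})| ≤ μ.real B := by
      refine abs_measureReal_sub_le ?_ ?_
      · rintro ω ⟨h1, h2, h3, h4⟩
        rw [if_pos rfl] at h4
        exact Or.inl ⟨⟨h1, h2⟩, h4⟩
      · rintro ω ⟨⟨h1, h2⟩, h3⟩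
        simp only [Set.mem_ofPred_eq, hVdef] at h2 h3
        by_cases h4 : J (v + d) ω = k
        · exact Or.inl ⟨h1, h2, h4, by rw [if_pos rfl]; exact h3⟩
        · refine Or.inr ⟨?_, ?_⟩
          · show J v ω ≠ J (v + d) ω
            rw [h2]; exact Ne.symm h4
          · show N v ω ≠ N (v + d) ω
            omega
    have e5 := measureReal_eq_of_lintegral_condPoisson h.chain hvd 1 (h.poisson hvd 1 hVA)
    have e6 := hF₂ v d (A ∩ V)
    have e7 : ∫ ω in A ∩ V, (R.rate (J v ω) : ℝ) ∂μ = jumpRate R k k * μ.real (A ∩ V) := by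
      rw [mul_comm, ← smul_eq_mul, ← setIntegral_const]
      refine setIntegral_congr_fun (h.history_le v _ hVA) fun ω hω => ?_
      have : J v ω = k := hω.2
      simp [this, jumpRate]
    have hcm : Integrable (cumRate R J v (v + d)) μ :=
      h.integrable_integral (fun a => (R.rate a : ℝ)) v d
    -- Pointwise, `0 ≤ Λ - exp (-Λ) * Λ ≤ Λ²` for the accumulated rate `Λ`.
    have e8 : |μ.real ((A ∩ V) ∩ {ω | N (v + d) ω = N v ω + 1}) -
        ∫ ω in A ∩ V, cumRate R J v (v + d) ω ∂μ| ≤ (rateBound R * d) ^ 2 := by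
      rw [e5, ← integral_sub (integrable_condPoisson h.chain hvd 1).integrableOn hcm.integrableOn]
      have := norm_setIntegral_le_of_norm_le_const (μ := μ) (s := A ∩ V)
        (f := fun ω => condPoisson R J v (v + d) 1 ω - cumRate R J v (v + d) ω)
        (C := (rateBound R * d) ^ 2) (measure_lt_top _ _) fun ω _ => by
          have h6 := cumRate_le (R := R) (J := J) v d ω
          have h7 := cumRate_nonneg (R := R) (J := J) hvd ω
          have h8 := Real.add_one_le_exp (-cumRate R J v (v + d) ω)
          have h10 : Real.exp (-cumRate R J v (v + d) ω) ≤ 1 :=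
            Real.exp_le_one_iff.2 (by linarith)
          have h9 : cumRate R J v (v + d) ω ^ 2 ≤ (rateBound R * d) ^ 2 := pow_le_pow_left₀ h7 h6 2
          simp only [condPoisson, pow_one, Nat.factorial_one, Nat.cast_one, div_one]
          rw [Real.norm_eq_abs, abs_le]
          constructor <;> nlinarith
      refine this.trans (mul_le_of_le_one_right (by positivity) measureReal_le_one)
    have e9 : ∫ ω in A ∩ V, (∫ r in (v : ℝ)..((v + d : ℝ≥0) : ℝ), (R.rate (J r.toNNReal ω) : ℝ)) ∂μ
      = ∫ ω in A ∩ V, cumRate R J v (v + d) ω ∂μ := rfl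
    rw [e7, e9] at e6
    rw [abs_le] at e4 e6 e8 ⊢
    have : K * (d : ℝ) ^ 2 = K₁ * d ^ 2 + K₂ * d ^ 2 + K₃ * d ^ 2 + (rateBound R * d) ^ 2 := by
      rw [hK]; ring
    have hεd : 0 ≤ ε * d := by positivity
    constructor <;> linarith [e1.1, e1.2, e4.1, e4.2, e6.1, e6.2, e8.1, e8.2]
  · have e4 : |μ.real (A ∩ {ω | IsJump k j (joint J N v ω) (joint J N (v + d) ω)}) -
        μ.real (A ∩ (V ∩ {ω | J (v + d) ω = j}))| ≤ μ.real B := by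
      refine abs_measureReal_sub_le ?_ ?_
      · rintro ω ⟨h1, h2, h3, h4⟩
        exact Or.inl ⟨h1, h2, h3⟩
      · rintro ω ⟨h1, h2, h3⟩
        simp only [Set.mem_ofPred_eq, hVdef] at h2 h3
        by_cases h4 : N (v + d) ω = N v ω
        · exact Or.inl ⟨h1, h2, h3, by rw [if_neg hkj]; exact h4⟩
        · refine Or.inr ⟨?_, ?_⟩
          · show J v ω ≠ J (v + d) ω
            rw [h2, h3]; exact hkj
          · exact Ne.symm h4
    have e5 : μ.real (A ∩ (V ∩ {ω | J (v + d) ω = j})) =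
        (ENNReal.ofReal (transProb R.Q d k j)).toReal * μ.real (A ∩ V) := by
      have := h.markov hvd k j hA
      rw [add_tsub_cancel_left] at this
      rw [measureReal_def, this, ENNReal.toReal_mul, measureReal_def]
    have e6 : (jumpRate R k j : ℝ) = R.Q k j := by
      rw [jumpRate, if_neg hkj, Real.coe_toNNReal _ (R.Q_nonneg k j hkj)]
    have e7 := hQ hkj
    have e8 : |(ENNReal.ofReal (transProb R.Q d k j)).toReal * μ.real (A ∩ V) -
        d * (R.Q k j * μ.real (A ∩ V))| ≤ ε / 2 * d := by
      rw [← mul_assoc, ← sub_mul, abs_mul, abs_of_nonneg (measureReal_nonneg)]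
      exact (mul_le_of_le_one_right (abs_nonneg _) measureReal_le_one).trans e7
    rw [e6] at e1
    rw [e5] at e4
    rw [abs_le] at e4 e8 ⊢
    have : K * (d : ℝ) ^ 2 = K₁ * d ^ 2 + K₂ * d ^ 2 + K₃ * d ^ 2 + (rateBound R * d) ^ 2 := by
      rw [hK]; ring
    have h2 : 0 ≤ K₂ * (d : ℝ) ^ 2 := by positivity
    have h3 : 0 ≤ (rateBound R * d) ^ 2 := by positivity
    constructor <;> linarith [e1.1, e1.2, e4.1, e4.2, e8.1, e8.2]

/-- The compensator of the number of jumps from `k` to `j`. -/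
theorem IsRiskModel.setLIntegral_jsum_jumpInd (h : IsRiskModel R i μ J N C D) (k j : Fin n)
    {s t : ℝ≥0} (hst : s ≤ t) {A : Set Ω} (hA : MeasurableSet[history J N C D s] A) :
    ∫⁻ ω in A, jsum (jumpInd k j) (fun r => joint J N r ω) s t ∂μ =
      ENNReal.ofReal
        (∫ ω in A, (∫ r in (s : ℝ)..(t : ℝ), stateRate R k j (J r.toNNReal ω)) ∂μ) := by
  set b := ∫ ω in A, (∫ r in (s : ℝ)..(t : ℝ), stateRate R k j (J r.toNNReal ω)) ∂μ with hb
  set L := ∫⁻ ω in A, jsum (jumpInd k j) (fun r => joint J N r ω) s t ∂μ with hL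
  set a : ℕ → ℝ≥0∞ := fun m => ∫⁻ ω in A, ∑ l ∈ Finset.range m,
    jumpInd k j (joint J N (grid s t m l) ω) (joint J N (grid s t m (l + 1)) ω) ∂μ with ha
  have hAm := h.history_le _ _ hA
  obtain ⟨K, hK⟩ := h.exists_lintegral_jsum_changeInd_le
  have hfin : ∫⁻ ω in A, jsum changeInd (fun r => joint J N r ω) s t ∂μ ≠ ∞ :=
    ((setLIntegral_le_lintegral _ _).trans_lt ((hK s t hst).trans_lt ENNReal.coe_lt_top)).ne
  have hLfin : L ≠ ∞ := by
    refine ((lintegral_mono fun ω => ?_).trans_lt hfin.lt_top).ne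
    exact jsum_mono (h.joint_cadlag ω) (jumpInd_le k j) s t
  -- The grid sums are dominated by the total number of jumps, which is integrable.
  have hlim : Tendsto a atTop (𝓝 L) := by
    refine tendsto_lintegral_of_dominated_convergence
      (fun ω => jsum changeInd (fun r => joint J N r ω) s t)
      (fun m => Finset.measurable_fun_sum _ fun l _ =>
        measurable_comp_pair h.measurable_joint _ _ _) (fun m => Eventually.of_forall fun ω => ?_)
      hfin (Eventually.of_forall fun ω => ?_)
    · rcases eq_or_ne m 0 with rfl | hm
      · simp
      · beta_reduce
        rw [← jsum_eq_sum_grid (h.joint_cadlag ω) changeInd hst hm]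
        exact Finset.sum_le_sum fun l _ => (jumpInd_le k j _ _).trans
          (changeInd_le_jsum (h.joint_cadlag ω) (grid_mono _ _ _ (Nat.le_succ l)))
    · exact tendsto_sum_grid_jsum (h.joint_cadlag ω) (jumpInd_self k j) hst
  have hlim' : Tendsto (fun m => (a m).toReal) atTop (𝓝 L.toReal) :=
    (ENNReal.tendsto_toReal hLfin).comp hlim
  have hareal : ∀ m, (a m).toReal = ∑ l ∈ Finset.range m, μ.real (A ∩
      {ω | IsJump k j (joint J N (grid s t m l) ω) (joint J N (grid s t m (l + 1)) ω)}) := by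
    intro m
    simp only [ha]
    rw [lintegral_finsetSum _ fun l _ => measurable_comp_pair h.measurable_joint _ _ _]
    simp only [lintegral_pair_eq (h.measurable_joint _) (h.measurable_joint _)
      (P := IsJump k j) (φ := jumpInd k j) (fun _ _ hab => if_pos hab) fun _ _ hab => if_neg hab]
    rw [ENNReal.toReal_sum fun l _ => measure_ne_top _ _]
    rfl
  have hbsum : ∀ m : ℕ, m ≠ 0 → b = ∑ l ∈ Finset.range m,
      ∫ ω in A, (∫ r in (grid s t m l : ℝ)..(grid s t m (l + 1) : ℝ),
        stateRate R k j (J r.toNNReal ω)) ∂μ := by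
    intro m hm
    rw [← integral_finsetSum]
    · refine integral_congr_ae (Eventually.of_forall fun ω => ?_)
      have := intervalIntegral.sum_integral_adjacent_intervals (μ := volume) (n := m)
        (a := fun l => (grid s t m l : ℝ)) (f := fun r => stateRate R k j (J r.toNNReal ω))
        fun l _ => intervalIntegrable_path (h.chain.cadlag ω) _ _ _
      rw [grid_zero, grid_last hst hm] at this
      exact this.symm
    · intro l _
      rw [grid_succ]
      exact (h.integrable_integral _ _ _).integrableOn
  -- Each of the `m` intervals contributes at most `ε * (t - s) / m`. The event `A` is admissible at
  -- every grid point because `history` increases with time.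
  have hclose : ∀ ε : ℝ, 0 < ε → |L.toReal - b| ≤ ε * (t - s : ℝ≥0) := by
    intro ε hε
    refine le_of_tendsto ((hlim'.sub_const b).abs) ?_
    have hmesh : Tendsto (fun m : ℕ => (t - s) / (m : ℝ≥0)) atTop (𝓝 0) :=
      tendsto_const_div_atTop_nhds_zero_nat _
    filter_upwards [hmesh.eventually (h.abs_measureReal_jump_sub_le k j hε), eventually_ne_atTop 0]
      with m hm hm0
    rw [hareal, hbsum m hm0, ← Finset.sum_sub_distrib]
    refine (Finset.abs_sum_le_sum_abs _ _).trans ?_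
    calc _ ≤ ∑ _l ∈ Finset.range m, ε * ((t - s) / (m : ℝ≥0) : ℝ≥0) := by
          refine Finset.sum_le_sum fun l _ => ?_
          rw [grid_succ]
          exact hm _ A (history_mono (le_grid s t m l) _ hA)
      _ = _ := by
          have : (m : ℝ) ≠ 0 := by exact_mod_cast hm0
          rw [Finset.sum_const, Finset.card_range, nsmul_eq_mul, NNReal.coe_div, NNReal.coe_natCast]
          field_simp
  have heq : L.toReal = b := by
    by_contra hne
    have hpos : 0 < |L.toReal - b| := abs_pos.2 (sub_ne_zero.2 hne)
    have hd : (0 : ℝ) ≤ (t - s : ℝ≥0) := NNReal.coe_nonneg _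
    -- This `ε` makes the bound at most half of the distance; the `+ 1` avoids a division by zero
    -- when `t = s`.
    have := hclose (|L.toReal - b| / (2 * ((t - s : ℝ≥0) + 1))) (by positivity)
    rw [div_mul_eq_mul_div, le_div_iff₀ (by positivity)] at this
    nlinarith
  rw [← heq, ENNReal.ofReal_toReal hLfin]

end Compensator

/-! ### Campbell's formula for predictable integrands -/

section Campbell

/-- The averaged measures `μ.bind K₁` and `μ.bind K₂` agree on a generating π-system, hence
everywhere. The set `U` carries all the mass and stands in for `Set.univ`, which need not belong to
`S`: generators of the predictable σ-algebra contain positive times only. -/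
theorem lintegral_lintegral_eq_of_forall_piSystem {Ω Z : Type*} [MeasurableSpace Ω] {μ : Measure Ω}
    {mZ : MeasurableSpace Z} {S : Set (Set Z)} (hS : mZ = MeasurableSpace.generateFrom S)
    (hpi : IsPiSystem S) {K₁ K₂ : Ω → Measure Z} [∀ ω, IsFiniteMeasure (K₁ ω)]
    [∀ ω, IsFiniteMeasure (K₂ ω)]
    (h₁ : ∀ A ∈ S, Measurable fun ω => K₁ ω A) (h₂ : ∀ A ∈ S, Measurable fun ω => K₂ ω A)
    {U : Set Z} (hU : U ∈ S) (hU₁ : ∀ ω, K₁ ω Set.univ = K₁ ω U)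
    (hU₂ : ∀ ω, K₂ ω Set.univ = K₂ ω U) (hfin : ∫⁻ ω, K₁ ω U ∂μ ≠ ∞)
    (heq : ∀ A ∈ S, ∫⁻ ω, K₁ ω A ∂μ = ∫⁻ ω, K₂ ω A ∂μ) {H : Z → ℝ≥0∞} (hH : Measurable H) :
    (Measurable fun ω => ∫⁻ z, H z ∂(K₁ ω)) ∧
      ∫⁻ ω, ∫⁻ z, H z ∂(K₁ ω) ∂μ = ∫⁻ ω, ∫⁻ z, H z ∂(K₂ ω) ∂μ := by
  have hm₁ : Measurable K₁ :=
    Measurable.measure_of_isPiSystem hS hpi h₁ (by simpa only [hU₁] using h₁ U hU)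
  have hm₂ : Measurable K₂ :=
    Measurable.measure_of_isPiSystem hS hpi h₂ (by simpa only [hU₂] using h₂ U hU)
  refine ⟨(Measure.measurable_lintegral hH).comp hm₁, ?_⟩
  rw [← Measure.lintegral_bind hm₁.aemeasurable hH.aemeasurable,
    ← Measure.lintegral_bind hm₂.aemeasurable hH.aemeasurable]
  have hSm : ∀ A ∈ S, MeasurableSet A := fun A hA => by
    rw [hS]; exact MeasurableSpace.measurableSet_generateFrom hA
  have huniv : ∀ K : Ω → Measure Z, Measurable K → μ.bind K Set.univ = ∫⁻ ω, K ω Set.univ ∂μ :=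
    fun K hK => Measure.bind_apply MeasurableSet.univ hK.aemeasurable
  have : IsFiniteMeasure (μ.bind K₁) := ⟨by
    rw [huniv K₁ hm₁]
    simpa only [hU₁] using hfin.lt_top⟩
  congr 1
  refine ext_of_generate_finite S hS hpi (fun A hA => ?_) ?_
  · rw [Measure.bind_apply (hSm A hA) hm₁.aemeasurable, Measure.bind_apply (hSm A hA)
      hm₂.aemeasurable, heq A hA]
  · rw [huniv K₁ hm₁, huniv K₂ hm₂]
    simp only [hU₁, hU₂]
    exact heq U hU

variable {α : Type*} [TopologicalSpace α] [DiscreteTopology α] {g : ℝ≥0 → α}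

/-- The point measure which puts the mass `φ (g (r-)) (g r)` at the image of the jump
`r ∈ (0, t]`. -/
def pointMeasure {Z : Type*} [MeasurableSpace Z] (φ : α → α → ℝ≥0∞) (hg : IsCadlagPath g)
    (t : ℝ≥0) (e : ℝ≥0 → Z) : Measure Z :=
  ∑ r ∈ (finite_jumpSet_Ioc hg 0 t).toFinset,
    φ (Function.leftLim g r) (g r) • Measure.dirac (e r)

theorem lintegral_pointMeasure {Z : Type*} [MeasurableSpace Z] (φ : α → α → ℝ≥0∞)
    (hg : IsCadlagPath g) (t : ℝ≥0) (e : ℝ≥0 → Z) {H : Z → ℝ≥0∞} (hH : Measurable H) :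
    ∫⁻ z, H z ∂(pointMeasure φ hg t e) = ∑ r ∈ (finite_jumpSet_Ioc hg 0 t).toFinset,
      φ (Function.leftLim g r) (g r) * H (e r) := by
  rw [pointMeasure, lintegral_finsetSum_measure]
  refine Finset.sum_congr rfl fun r _ => ?_
  rw [lintegral_smul_measure, lintegral_dirac' _ hH, smul_eq_mul]

theorem pointMeasure_apply {Z : Type*} [MeasurableSpace Z] (φ : α → α → ℝ≥0∞)
    (hg : IsCadlagPath g) {s t : ℝ≥0} (e : ℝ≥0 → Z) {A : Set Z} (hA : MeasurableSet A)
    (hAe : ∀ r, e r ∈ A ↔ s < r) : pointMeasure φ hg t e A = jsum φ g s t := by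
  rw [← lintegral_indicator_one hA, lintegral_pointMeasure φ hg t e (measurable_one.indicator hA),
    jsum, finsum_mem_eq_finite_toFinset_sum _ (finite_jumpSet_Ioc hg s t)]
  symm
  have hsub : (finite_jumpSet_Ioc hg s t).toFinset ⊆ (finite_jumpSet_Ioc hg 0 t).toFinset := by
    intro r
    simp only [Set.Finite.mem_toFinset]
    exact fun hr => ⟨hr.1, hr.1.1, hr.2.2⟩
  rw [← Finset.sum_subset hsub]
  · refine Finset.sum_congr rfl fun r hr => ?_
    rw [Set.Finite.mem_toFinset] at hr
    rw [Set.indicator_of_mem ((hAe r).2 hr.2.1), Pi.one_apply, mul_one]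
  · intro r hr hr'
    rw [Set.Finite.mem_toFinset] at hr hr'
    rw [Set.indicator_of_notMem, mul_zero]
    exact fun hrA => hr' ⟨hr.1, (hAe r).1 hrA, hr.2.2⟩

theorem pointMeasure_apply_empty {Z : Type*} [MeasurableSpace Z] (φ : α → α → ℝ≥0∞)
    (hg : IsCadlagPath g) {t : ℝ≥0} (e : ℝ≥0 → Z) {A : Set Z} (hA : MeasurableSet A)
    (hAe : ∀ r, e r ∉ A) : pointMeasure φ hg t e A = 0 := by
  rw [← lintegral_indicator_one hA, lintegral_pointMeasure φ hg t e (measurable_one.indicator hA)]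
  exact Finset.sum_eq_zero fun r _ => by rw [Set.indicator_of_notMem (hAe r), mul_zero]

theorem pointMeasure_univ {Z : Type*} [MeasurableSpace Z] (φ : α → α → ℝ≥0∞)
    (hg : IsCadlagPath g) {t : ℝ≥0} (e : ℝ≥0 → Z) :
    pointMeasure φ hg t e Set.univ = jsum φ g 0 t := by
  rw [← lintegral_indicator_one MeasurableSet.univ, lintegral_pointMeasure φ hg t e
    (measurable_one.indicator MeasurableSet.univ), jsum,
    finsum_mem_eq_finite_toFinset_sum _ (finite_jumpSet_Ioc hg 0 t)]
  simp

variable {n : ℕ} {Ω : Type*} {R : RiskParameters n} {i : Fin n} {J : ℝ≥0 → Ω → Fin n}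
  {N : ℝ≥0 → Ω → ℕ} {C : Fin n → ℕ → Ω → ℝ} {D : Fin n → Fin n → ℕ → Ω → ℝ}
  [mΩ : MeasurableSpace Ω] {μ : Measure Ω} [IsProbabilityMeasure μ]

/-- The expected sum of a predictable process over the jumps from `k` to `j`. -/
theorem IsRiskModel.lintegral_sum_jumps (h : IsRiskModel R i μ J N C D) (k j : Fin n) (t : ℝ≥0)
    {H : Ω × ℝ≥0 → ℝ≥0∞} (hH : Measurable[predictable (history J N C D)] H) :
    (Measurable fun ω => ∑ r ∈ (finite_jumpSet_Ioc (h.joint_cadlag ω) 0 t).toFinset,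
      jumpInd k j (Function.leftLim (fun u => joint J N u ω) r) (joint J N r ω) * H (ω, r)) ∧
    ∫⁻ ω, ∑ r ∈ (finite_jumpSet_Ioc (h.joint_cadlag ω) 0 t).toFinset,
      jumpInd k j (Function.leftLim (fun u => joint J N u ω) r) (joint J N r ω) * H (ω, r) ∂μ =
    ∫⁻ ω, (∫⁻ s in Set.Ioc (0 : ℝ) t, ENNReal.ofReal (stateRate R k j (J s.toNNReal ω)) *
      H (ω, s.toNNReal)) ∂μ := by
  have hle : predictable (history J N C D) ≤ mΩ.prod inferInstance := predictable_le h.history_le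
  set ρ : Ω → ℝ → ℝ≥0∞ := fun ω s => ENNReal.ofReal (stateRate R k j (J s.toNNReal ω)) with hρ
  have hstate0 : ∀ a, 0 ≤ stateRate R k j a := fun a => by
    unfold stateRate; split_ifs <;> simp
  have hρm : ∀ ω, Measurable (ρ ω) := by
    intro ω
    have hJm : Measurable fun z : Ω × ℝ≥0 => J z.2 z.1 :=
      measurable_uncurry_of_rightCts h.chain.measurable fun ω v => (h.chain.cadlag ω v).1
    exact ((measurable_of_countable (stateRate R k j)).comp (hJm.comp
      (measurable_const.prodMk measurable_real_toNNReal))).ennreal_ofReal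
  have hem : ∀ ω, Measurable[_, predictable (history J N C D)] fun s : ℝ => (ω, s.toNNReal) :=
    fun ω => (measurable_const.prodMk measurable_real_toNNReal).mono le_rfl hle
  -- For each `ω`, `K₁` puts mass on the jumps of the given type and `K₂` is their intensity, both
  -- on the slice over `ω`. They are measures on the predictable σ-algebra, so that their means need
  -- comparison on sets `B ×ˢ Set.Ioi s` only.
  set K₁ : Ω → @Measure (Ω × ℝ≥0) (predictable (history J N C D)) := fun ω =>
    @pointMeasure _ _ _ _ _ (predictable (history J N C D)) (jumpInd k j) (h.joint_cadlag ω) t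
      fun r => (ω, r) with hK₁
  set K₂ : Ω → @Measure (Ω × ℝ≥0) (predictable (history J N C D)) := fun ω =>
    @Measure.map _ _ _ (predictable (history J N C D)) (fun s : ℝ => (ω, s.toNNReal))
      ((volume.restrict (Set.Ioc (0 : ℝ) t)).withDensity (ρ ω)) with hK₂
  have hA : ∀ {s B}, MeasurableSet[history J N C D s] B →
      MeasurableSet[predictable (history J N C D)] (B ×ˢ Set.Ioi s) := fun hB =>
    MeasurableSpace.measurableSet_generateFrom ⟨_, _, hB, rfl⟩
  have hK₁A : ∀ {s B}, MeasurableSet[history J N C D s] B → ∀ ω, K₁ ω (B ×ˢ Set.Ioi s) =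
      B.indicator (fun ω => jsum (jumpInd k j) (fun r => joint J N r ω) s t) ω := by
    intro s B hB ω
    by_cases hω : ω ∈ B
    · rw [Set.indicator_of_mem hω]
      exact @pointMeasure_apply _ _ _ _ _ (predictable (history J N C D)) _ _ _ _ _ _ (hA hB)
        fun r => by simp [hω]
    · rw [Set.indicator_of_notMem hω]
      exact @pointMeasure_apply_empty _ _ _ _ _ (predictable (history J N C D)) _ _ _ _ _ (hA hB)
        fun r => by simp [hω]
  have hK₂A : ∀ {s B}, MeasurableSet[history J N C D s] B → ∀ ω, K₂ ω (B ×ˢ Set.Ioi s) =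
      B.indicator (fun ω => ∫⁻ r in Set.Ioc (s : ℝ) t, ρ ω r) ω := by
    intro s B hB ω
    have h1 := @Measure.map_apply _ _ _ (predictable (history J N C D))
      ((volume.restrict (Set.Ioc (0 : ℝ) t)).withDensity (ρ ω)) _ (hem ω) _ (hA hB)
    refine h1.trans ?_
    rw [withDensity_apply _ ((hem ω) (hA hB))]
    by_cases hω : ω ∈ B
    · rw [Set.indicator_of_mem hω]
      have h2 : (fun r : ℝ => (ω, r.toNNReal)) ⁻¹' B ×ˢ Set.Ioi s = Set.Ioi (s : ℝ) := by
        ext r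
        simp [hω, Real.lt_toNNReal_iff_coe_lt]
      rw [h2, Measure.restrict_restrict measurableSet_Ioi]
      congr 2
      ext r
      simp only [Set.mem_inter_iff, Set.mem_Ioi, Set.mem_Ioc]
      exact ⟨fun hr => ⟨hr.1, hr.2.2⟩, fun hr => ⟨hr.1, s.coe_nonneg.trans_lt hr.1, hr.2⟩⟩
    · rw [Set.indicator_of_notMem hω]
      have h2 : (fun r : ℝ => (ω, r.toNNReal)) ⁻¹' B ×ˢ Set.Ioi s = ∅ := by
        ext r
        simp [hω]
      rw [h2, Measure.restrict_empty, lintegral_zero_measure]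
  have hint : ∀ s : ℝ≥0, s ≤ t → ∀ ω, ∫⁻ r in Set.Ioc (s : ℝ) t, ρ ω r =
      ENNReal.ofReal (∫ r in (s : ℝ)..(t : ℝ), stateRate R k j (J r.toNNReal ω)) := by
    intro s hst ω
    have hst' : (s : ℝ) ≤ t := by exact_mod_cast hst
    rw [intervalIntegral.integral_of_le hst', ofReal_integral_eq_lintegral_ofReal
      ((intervalIntegrable_iff_integrableOn_Ioc_of_le hst').1
        (intervalIntegrable_path (h.chain.cadlag ω) _ _ _))
      (Eventually.of_forall fun r => hstate0 _)]
  have hempty : ∀ s : ℝ≥0, t < s → ∀ ω, ∫⁻ r in Set.Ioc (s : ℝ) t, ρ ω r = 0 := by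
    intro s hst ω
    have hst' : (t : ℝ) ≤ s := by exact_mod_cast hst.le
    rw [Set.Ioc_eq_empty (not_lt.2 hst'), Measure.restrict_empty, lintegral_zero_measure]
  have hempty' : ∀ s : ℝ≥0, t < s → ∀ ω, jsum (jumpInd k j) (fun r => joint J N r ω) s t = 0 := by
    intro s hst ω
    simp [jsum, Set.Ioc_eq_empty (not_lt.2 hst.le)]
  have hJS : ∀ s, Measurable fun ω => jsum (jumpInd k j) (fun r => joint J N r ω) s t := by
    intro s
    rcases le_or_gt s t with hst | hst
    · exact measurable_jsum hst (fun r _ => h.measurable_joint r) h.joint_cadlag (jumpInd_self k j)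
    · simp only [hempty' s hst]
      exact measurable_const
  have hIS : ∀ s : ℝ≥0, Measurable fun ω => ∫⁻ r in Set.Ioc (s : ℝ) t, ρ ω r := by
    intro s
    rcases le_or_gt s t with hst | hst
    · simp only [hint s hst]
      exact (measurable_intervalIntegral_comp hst (fun r _ => h.chain.measurable r)
        h.chain.cadlag _).ennreal_ofReal
    · simp only [hempty s hst]
      exact measurable_const
  have hU₂ : ∀ ω, K₂ ω Set.univ = K₂ ω (Set.univ ×ˢ Set.Ioi 0) := by
    intro ω
    rw [hK₂A (@MeasurableSet.univ _ (_)) ω, Set.indicator_univ]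
    have h1 := @Measure.map_apply _ _ _ (predictable (history J N C D))
      ((volume.restrict (Set.Ioc (0 : ℝ) t)).withDensity (ρ ω)) _ (hem ω) _
      (@MeasurableSet.univ _ (predictable (history J N C D)))
    refine h1.trans ?_
    rw [Set.preimage_univ, withDensity_apply _ MeasurableSet.univ, Measure.restrict_univ,
      NNReal.coe_zero]
  have hU₁ : ∀ ω, K₁ ω Set.univ = K₁ ω (Set.univ ×ˢ Set.Ioi 0) := by
    intro ω
    rw [hK₁A (@MeasurableSet.univ _ (_)) ω, Set.indicator_univ]
    exact @pointMeasure_univ _ _ _ _ _ (predictable (history J N C D)) _ _ _ _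
  have hf₁ : ∀ ω, @IsFiniteMeasure _ (predictable (history J N C D)) (K₁ ω) := fun ω => by
    refine @IsFiniteMeasure.mk _ (_) _ ?_
    rw [hU₁, hK₁A (@MeasurableSet.univ _ (_)) ω, Set.indicator_univ]
    refine (jsum_ne_top (h.joint_cadlag ω) (fun a b => ?_) _ _).lt_top
    exact ((jumpInd_le k j a b).trans_lt (changeInd_ne_top a b).lt_top).ne
  have hf₂ : ∀ ω, @IsFiniteMeasure _ (predictable (history J N C D)) (K₂ ω) := fun ω => by
    refine @IsFiniteMeasure.mk _ (_) _ ?_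
    rw [hU₂, hK₂A (@MeasurableSet.univ _ (_)) ω, Set.indicator_univ, hint 0 zero_le]
    exact ENNReal.ofReal_lt_top
  have hcomp : ∀ {s B}, MeasurableSet[history J N C D s] B →
      ∫⁻ ω, K₁ ω (B ×ˢ Set.Ioi s) ∂μ = ∫⁻ ω, K₂ ω (B ×ˢ Set.Ioi s) ∂μ := by
    intro s B hB
    have hBm := h.history_le _ _ hB
    rw [lintegral_congr (hK₁A hB), lintegral_congr (hK₂A hB), lintegral_indicator hBm,
      lintegral_indicator hBm]
    rcases le_or_gt s t with hst | hst
    · rw [h.setLIntegral_jsum_jumpInd k j hst hB, lintegral_congr (hint s hst),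
        ofReal_integral_eq_lintegral_ofReal]
      · obtain ⟨d, rfl⟩ := exists_add_of_le hst
        exact (h.integrable_integral _ _ _).integrableOn
      · exact Eventually.of_forall fun ω => intervalIntegral.integral_nonneg
          (by exact_mod_cast hst) fun r _ => hstate0 _
    · rw [lintegral_congr (hempty' s hst), lintegral_congr (hempty s hst)]
  have key := @lintegral_lintegral_eq_of_forall_piSystem Ω (Ω × ℝ≥0) _ μ
    (predictable (history J N C D))
    {A | ∃ s B, MeasurableSet[history J N C D s] B ∧ A = B ×ˢ Set.Ioi s} rfl ?_ K₁ K₂ hf₁ hf₂ ?_ ?_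
    (Set.univ ×ˢ Set.Ioi 0) ⟨0, Set.univ, @MeasurableSet.univ _ (_), rfl⟩ hU₁ hU₂ ?_ ?_ H hH
  · have e1 : ∀ ω, @lintegral _ (predictable (history J N C D)) (K₁ ω) H =
        ∑ r ∈ (finite_jumpSet_Ioc (h.joint_cadlag ω) 0 t).toFinset,
          jumpInd k j (Function.leftLim (fun u => joint J N u ω) r) (joint J N r ω) * H (ω, r) :=
      fun ω => @lintegral_pointMeasure _ _ _ _ _ (predictable (history J N C D)) _ _ _ _ _ hH
    have e2 : ∀ ω, @lintegral _ (predictable (history J N C D)) (K₂ ω) H =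
        ∫⁻ s in Set.Ioc (0 : ℝ) t, ρ ω s * H (ω, s.toNNReal) := by
      intro ω
      refine (@lintegral_map _ _ _ (predictable (history J N C D)) _ _ _ hH (hem ω)).trans ?_
      exact lintegral_withDensity_eq_lintegral_mul _ (hρm ω) (hH.comp (hem ω))
    simp only [e1, e2] at key
    exact key
  · rintro _ ⟨s, B, hB, rfl⟩ _ ⟨s', B', hB', rfl⟩ -
    refine ⟨s ⊔ s', B ∩ B', ?_, ?_⟩
    · exact MeasurableSet.inter (history_mono le_sup_left _ hB) (history_mono le_sup_right _ hB')
    · rw [Set.prod_inter_prod, Set.Ioi_inter_Ioi]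
  · rintro _ ⟨s, B, hB, rfl⟩
    simp only [hK₁A hB]
    exact (hJS s).indicator (h.history_le _ _ hB)
  · rintro _ ⟨s, B, hB, rfl⟩
    simp only [hK₂A hB]
    exact (hIS s).indicator (h.history_le _ _ hB)
  · rw [hcomp (@MeasurableSet.univ _ (_)), lintegral_congr (hK₂A (@MeasurableSet.univ _ (_))),
      Set.indicator_univ, lintegral_congr (hint 0 zero_le), ← ofReal_integral_eq_lintegral_ofReal]
    · exact ENNReal.ofReal_ne_top
    · simpa using h.integrable_integral (stateRate R k j) 0 t
    · exact Eventually.of_forall fun ω => intervalIntegral.integral_nonneg t.coe_nonneg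
        fun r _ => hstate0 _
  · rintro _ ⟨s, B, hB, rfl⟩
    exact hcomp hB

end Campbell

/-! ### Integrating out the claim due next -/

section NextClaim

theorem lintegral_comp_of_indepFun {Ω β γ : Type*} [MeasurableSpace Ω] [MeasurableSpace β]
    [MeasurableSpace γ] {μ : Measure Ω} [IsProbabilityMeasure μ] {Y : Ω → β} {ξ : Ω → γ}
    (hY : Measurable Y) (hξ : Measurable ξ) (h : IndepFun Y ξ μ) {ψ : β × γ → ℝ≥0∞}
    (hψ : Measurable ψ) :
    ∫⁻ ω, ψ (Y ω, ξ ω) ∂μ = ∫⁻ ω, (∫⁻ y, ψ (Y ω, y) ∂(μ.map ξ)) ∂μ := by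
  have hξ' := Measure.isProbabilityMeasure_map (μ := μ) hξ.aemeasurable
  have hY' := Measure.isProbabilityMeasure_map (μ := μ) hY.aemeasurable
  have h1 := (indepFun_iff_map_prod_eq_prod_map_map hY.aemeasurable hξ.aemeasurable).1 h
  rw [← lintegral_map (f := ψ) (g := fun ω => (Y ω, ξ ω)) hψ (hY.prodMk hξ), h1,
    lintegral_prod _ hψ.aemeasurable, lintegral_map hψ.lintegral_prod_right' hY]

/-- On each fiber of the claim count, the claim with random index becomes a claim with fixed index,
to which independence applies. -/
theorem lintegral_eq_of_forall_fiber {Ω : Type*} [MeasurableSpace Ω] {μ : Measure Ω} {c : Ω → ℕ}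
    (hc : Measurable c) {f g : Ω → ℝ≥0∞}
    (h : ∀ m, ∫⁻ ω in c ⁻¹' {m}, f ω ∂μ = ∫⁻ ω in c ⁻¹' {m}, g ω ∂μ) :
    ∫⁻ ω, f ω ∂μ = ∫⁻ ω, g ω ∂μ := by
  have key : ∀ f : Ω → ℝ≥0∞, ∫⁻ ω, f ω ∂μ = ∑' m, ∫⁻ ω in c ⁻¹' {m}, f ω ∂μ := by
    intro f
    rw [← lintegral_iUnion (fun m => hc (measurableSet_singleton m)), ← Set.preimage_iUnion,
      Set.iUnion_of_singleton, Set.preimage_univ, Measure.restrict_univ]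
    exact fun a b hab => (Set.disjoint_singleton.2 hab).preimage c
  rw [key f, key g]
  exact tsum_congr h

variable {n : ℕ} {Ω : Type*} {R : RiskParameters n} {i : Fin n} {J : ℝ≥0 → Ω → Fin n}
  {N : ℝ≥0 → Ω → ℕ} {C : Fin n → ℕ → Ω → ℝ} {D : Fin n → Fin n → ℕ → Ω → ℝ}

/-- The index of the `m`-th claim for jumps from `k` to `j`. -/
def claimIndex (k j : Fin n) (m : ℕ) : (Fin n × ℕ) ⊕ (Fin n × Fin n × ℕ) :=
  if k = j then Sum.inl (k, m) else Sum.inr (k, j, m)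

/-- The number of claims up to time `s` of the kind which is due at jumps from `k` to `j`. -/
def claimNumber (J : ℝ≥0 → Ω → Fin n) (N : ℝ≥0 → Ω → ℕ) (k j : Fin n) (s : ℝ≥0) (ω : Ω) : ℕ :=
  if k = j then N s ω else jumpCount (fun u => J u ω) s

/-- The claim which would be due at a jump from `k` to `j` at the next epoch after time `s`. -/
def nextClaim (J : ℝ≥0 → Ω → Fin n) (N : ℝ≥0 → Ω → ℕ) (C : Fin n → ℕ → Ω → ℝ)
    (D : Fin n → Fin n → ℕ → Ω → ℝ) (k j : Fin n) (s : ℝ≥0) (ω : Ω) : ℝ :=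
  allClaims C D (claimIndex k j (claimNumber J N k j s ω + 1)) ω

/-- The law of the claims due at jumps from `k` to `j`. -/
def RiskParameters.jumpLaw (R : RiskParameters n) (k j : Fin n) : Measure ℝ :=
  if k = j then R.claimLaw k else R.switchLaw k j

theorem RiskParameters.isProbabilityMeasure_jumpLaw (R : RiskParameters n) (k j : Fin n) :
    IsProbabilityMeasure (R.jumpLaw k j) := by
  unfold jumpLaw
  split_ifs
  exacts [R.claimLaw_prob k, R.switchLaw_prob k j]

theorem RiskParameters.jumpLaw_nonneg (R : RiskParameters n) (k j : Fin n) :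
    R.jumpLaw k j (Set.Iio 0) = 0 := by
  unfold jumpLaw
  split_ifs
  exacts [R.claimLaw_nonneg k, R.switchLaw_nonneg k j]

theorem RiskParameters.nu_eq (R : RiskParameters n) (k j : Fin n) :
    R.nu k j = jumpRate R k j • R.jumpLaw k j := by
  unfold nu jumpRate jumpLaw
  split_ifs
  · rfl
  · rfl

theorem measurable_claimNumber [MeasurableSpace Ω] {s : ℝ≥0} (hJ : ∀ r ≤ s, Measurable (J r))
    (hJc : ∀ ω, IsCadlagPath fun r => J r ω) (hN : Measurable (N s)) (k j : Fin n) :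
    Measurable (claimNumber J N k j s) := by
  unfold claimNumber
  split_ifs
  exacts [hN, measurable_jumpCount hJ hJc]

theorem riskProcess_congr {x : ℝ} {s : ℝ≥0} {ω : Ω} {C' : Fin n → ℕ → Ω → ℝ}
    {D' : Fin n → Fin n → ℕ → Ω → ℝ} (hC : ∀ a, ∀ m ≤ N s ω, C a m ω = C' a m ω)
    (hD : ∀ a b, ∀ m ≤ jumpCount (fun u => J u ω) s, D a b m ω = D' a b m ω) :
    riskProcess R x J N C D s ω = riskProcess R x J N C' D' s ω := by
  unfold riskProcess
  congr 1
  · congr 1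
    exact Finset.sum_congr rfl fun m hm => hC _ _ (Finset.mem_Icc.1 hm).2
  · exact Finset.sum_congr rfl fun m hm => hD _ _ _ (Finset.mem_Icc.1 hm).2

/-- The information on the environment, the arrivals, and all claims but one. -/
@[reducible]
def otherInfo (J : ℝ≥0 → Ω → Fin n) (N : ℝ≥0 → Ω → ℕ) (C : Fin n → ℕ → Ω → ℝ)
    (D : Fin n → Fin n → ℕ → Ω → ℝ) (c₀ : (Fin n × ℕ) ⊕ (Fin n × Fin n × ℕ)) :
    MeasurableSpace Ω :=
  (⨆ c ∈ ({c₀}ᶜ : Set ((Fin n × ℕ) ⊕ (Fin n × Fin n × ℕ))),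
    MeasurableSpace.comap (allClaims C D c) inferInstance) ⊔
    MeasurableSpace.comap (fun ω t => (J t ω, N t ω)) inferInstance

variable [mΩ : MeasurableSpace Ω] {μ : Measure Ω}

theorem IsRiskModel.map_claim (h : IsRiskModel R i μ J N C D) (k j : Fin n) (m : ℕ) :
    μ.map (allClaims C D (claimIndex k j m)) = R.jumpLaw k j := by
  unfold claimIndex RiskParameters.jumpLaw
  split_ifs
  exacts [h.law_C k m, h.law_D k j m]

variable [IsProbabilityMeasure μ]

/-- A claim is independent of the other claims together with the environment and the arrivals. -/
theorem IsRiskModel.indep_claim (h : IsRiskModel R i μ J N C D)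
    (c₀ : (Fin n × ℕ) ⊕ (Fin n × Fin n × ℕ)) :
    Indep (otherInfo J N C D c₀)
      (MeasurableSpace.comap (allClaims C D c₀) inferInstance) μ := by
  have hle : ∀ c, MeasurableSpace.comap (allClaims C D c) inferInstance ≤ claimInfo C D :=
    fun c => (measurable_claims_claimInfo c).comap_le
  have hle' : (⨆ c ∈ ({c₀}ᶜ : Set ((Fin n × ℕ) ⊕ (Fin n × Fin n × ℕ))),
      MeasurableSpace.comap (allClaims C D c) inferInstance) ≤ claimInfo C D :=
    iSup₂_le fun c _ => hle c
  have h1 := indep_iSup_of_disjoint (fun c => (h.measurable_claims c).comap_le) h.indep_claims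
    (S := {c₀}ᶜ) (T := {c₀}) (by simp)
  rw [iSup_singleton] at h1
  rw [Indep_iff] at h1 ⊢
  intro B A hB hA
  have hA' := h.claimInfo_le _ (hle c₀ _ hA)
  -- On generators `S ∩ T`, first the environment event `T` splits off from all claims, then `S` and
  -- `A` separate by independence among the claims.
  have := measure_eq_of_forall_inter (μ := μ.restrict A) (ν := μ A • μ) (hle'.trans h.claimInfo_le)
    h.env_le (fun S T hS hT => ?_) hB
  · rwa [Measure.restrict_apply' hA', Measure.smul_apply, smul_eq_mul, mul_comm] at this
  · rw [Measure.restrict_apply' hA', Measure.smul_apply, smul_eq_mul,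
      h.measure_inter (hle' _ hS) hT, Set.inter_right_comm,
      h.measure_inter (MeasurableSet.inter (hle' _ hS) (hle c₀ _ hA)) hT, h1 S A hS hA]
    ring

/-- The next claim can be integrated out. -/
theorem IsRiskModel.lintegral_nextClaim (h : IsRiskModel R i μ J N C D) (x : ℝ) (k j : Fin n)
    (s : ℝ≥0) {ψ : (ℝ × Fin n) × ℝ → ℝ≥0∞} (hψ : Measurable ψ) :
    ∫⁻ ω, ψ ((riskProcess R x J N C D s ω, J s ω), nextClaim J N C D k j s ω) ∂μ =
      ∫⁻ ω, (∫⁻ y, ψ ((riskProcess R x J N C D s ω, J s ω), y) ∂(R.jumpLaw k j)) ∂μ := by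
  classical
  have hprob := R.isProbabilityMeasure_jumpLaw k j
  have hcnt : Measurable (claimNumber J N k j s) := measurable_claimNumber
    (fun r _ => h.chain.measurable r) h.chain.cadlag (h.arrivals.measurable s) k j
  refine lintegral_eq_of_forall_fiber hcnt fun m => ?_
  set c₀ : (Fin n × ℕ) ⊕ (Fin n × Fin n × ℕ) := claimIndex k j (m + 1) with hc₀
  -- With the claim `c₀` overwritten by `0`, the risk process is measurable for the other sources of
  -- randomness. Where the count is `m`, nothing has changed at time `s`, since `c₀` has number `m +
  -- 1` and is not yet paid.
  set C' : Fin n → ℕ → Ω → ℝ := fun a l ω => if Sum.inl (a, l) = c₀ then 0 else C a l ω with hC'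
  set D' : Fin n → Fin n → ℕ → Ω → ℝ :=
    fun a b l ω => if Sum.inr (a, b, l) = c₀ then 0 else D a b l ω with hD'
  have hcl : ∀ c, c ≠ c₀ → Measurable[otherInfo J N C D c₀] (allClaims C D c) := fun c hc =>
    (comap_measurable (allClaims C D c)).mono (le_sup_of_le_left
      (le_iSup₂_of_le (f := fun c (_ : c ∈ ({c₀}ᶜ : Set ((Fin n × ℕ) ⊕ (Fin n × Fin n × ℕ)))) =>
        MeasurableSpace.comap (allClaims C D c) inferInstance) c hc le_rfl)) le_rfl
  have hJ : ∀ r, Measurable[otherInfo J N C D c₀] (J r) := fun r => (measurable_env r).mono le_sup_right le_rfl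
  have hN : ∀ r, Measurable[otherInfo J N C D c₀] (N r) := fun r => (measurable_arrivals r).mono le_sup_right le_rfl
  have hCm : ∀ a l, Measurable[otherInfo J N C D c₀] (C' a l) := by
    intro a l
    by_cases hal : Sum.inl (a, l) = c₀
    · simp only [hC', if_pos hal]
      exact @measurable_const _ _ _ (otherInfo J N C D c₀) _
    · simp only [hC', if_neg hal]
      exact hcl _ hal
  have hDm : ∀ a b l, Measurable[otherInfo J N C D c₀] (D' a b l) := by
    intro a b l
    by_cases hal : Sum.inr (a, b, l) = c₀
    · simp only [hD', if_pos hal]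
      exact @measurable_const _ _ _ (otherInfo J N C D c₀) _
    · simp only [hD', if_neg hal]
      exact hcl _ hal
  have hm₀le : otherInfo J N C D c₀ ≤ mΩ := sup_le (iSup₂_le fun c _ => (h.measurable_claims c).comap_le) h.env_le
  have hX : Measurable[otherInfo J N C D c₀] (riskProcess R x J N C' D' s) :=
    @measurable_riskProcess_time n Ω (otherInfo J N C D c₀) J N C' D' R x s (fun r _ => hJ r) h.chain.cadlag
      (fun r _ => hN r) h.arrivals.cadlag h.arrivals.mono hCm hDm
  have hcnt' : Measurable[otherInfo J N C D c₀] (claimNumber J N k j s) :=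
    @measurable_claimNumber n Ω J N (otherInfo J N C D c₀) s (fun r _ => hJ r) h.chain.cadlag (hN s) k j
  set Y : Ω → (ℝ × Fin n) × ℕ := fun ω =>
    ((riskProcess R x J N C' D' s ω, J s ω), claimNumber J N k j s ω) with hY
  have hYm : Measurable[otherInfo J N C D c₀] Y := (hX.prodMk (hJ s)).prodMk hcnt'
  have hind : IndepFun Y (allClaims C D c₀) μ :=
    indep_of_indep_of_le_left (h.indep_claim c₀) hYm.comap_le
  -- The restriction to the fiber is moved into the integrand; the count does not involve claim
  -- sizes and is a component of `Y`.
  set Ψ : ((ℝ × Fin n) × ℕ) × ℝ → ℝ≥0∞ := fun z => if z.1.2 = m then ψ (z.1.1, z.2) else 0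
    with hΨ
  have hΨm : Measurable Ψ := Measurable.ite
    ((measurable_snd.comp measurable_fst) (measurableSet_singleton m))
    (hψ.comp ((measurable_fst.comp measurable_fst).prodMk measurable_snd)) measurable_const
  have key := lintegral_comp_of_indepFun (hYm.mono hm₀le le_rfl) (h.measurable_claims c₀) hind hΨm
  rw [hc₀, h.map_claim] at key
  have heq : ∀ ω, claimNumber J N k j s ω = m →
      riskProcess R x J N C' D' s ω = riskProcess R x J N C D s ω := by
    intro ω hω
    refine riskProcess_congr (fun a l hl => if_neg fun hal => ?_) fun a b l hl =>
      if_neg fun hal => ?_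
    all_goals
      unfold claimNumber at hω
      rw [hc₀] at hal
      unfold claimIndex at hal
      split_ifs at hω hal
      all_goals
        simp at hal
        try omega
  rw [← lintegral_indicator (hcnt (measurableSet_singleton m)),
    ← lintegral_indicator (hcnt (measurableSet_singleton m))]
  refine Eq.trans (lintegral_congr fun ω => ?_) (key.trans (lintegral_congr fun ω => ?_))
  · by_cases hω : claimNumber J N k j s ω = m
    · rw [Set.indicator_of_mem (by exact hω)]
      simp only [hΨ, hY, hω, if_true, heq ω hω, nextClaim]
    · rw [Set.indicator_of_notMem (by exact hω)]
      simp only [hΨ, hY, if_neg hω]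
  · by_cases hω : claimNumber J N k j s ω = m
    · rw [Set.indicator_of_mem (by exact hω)]
      simp only [hΨ, hY, hω, if_true, heq ω hω]
    · rw [Set.indicator_of_notMem (by exact hω)]
      simp only [hΨ, hY, if_neg hω, lintegral_zero]

end NextClaim

/-! ### The compensation formula for nonnegative functions -/

section JumpSum

variable {n : ℕ} {Ω : Type*} {R : RiskParameters n} {i : Fin n} {J : ℝ≥0 → Ω → Fin n}
  {N : ℝ≥0 → Ω → ℕ} {C : Fin n → ℕ → Ω → ℝ} {D : Fin n → Fin n → ℕ → Ω → ℝ}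

theorem claimNumber_isCadlagPath {ω : Ω} (hJc : IsCadlagPath fun t => J t ω)
    (hNc : IsCadlagPath fun t => N t ω) (k j : Fin n) :
    IsCadlagPath fun s => claimNumber J N k j s ω := by
  unfold claimNumber
  split_ifs
  exacts [hNc, jumpCount_isCadlagPath hJc]

theorem nextClaim_eventually_left {ω : Ω} (hJc : IsCadlagPath fun t => J t ω)
    (hNc : IsCadlagPath fun t => N t ω) (k j : Fin n) (s : ℝ≥0) :
    ∀ᶠ u in 𝓝[<] s, nextClaim J N C D k j u ω = allClaims C D (claimIndex k j
      (Function.leftLim (fun r => claimNumber J N k j r ω) s + 1)) ω := by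
  filter_upwards [(claimNumber_isCadlagPath hJc hNc k j).eventually_left s] with u hu
  rw [nextClaim, hu]

theorem nextClaim_rightCts {ω : Ω} (hJc : IsCadlagPath fun t => J t ω)
    (hNc : IsCadlagPath fun t => N t ω) (k j : Fin n) (s : ℝ≥0) :
    ContinuousWithinAt (fun u => nextClaim J N C D k j u ω) (Set.Ici s) s := by
  refine tendsto_const_nhds.congr' ?_
  filter_upwards [(claimNumber_isCadlagPath hJc hNc k j).eventually_right s] with u hu
  rw [nextClaim, nextClaim, hu]

theorem leftLim_nextClaim {ω : Ω} (hJc : IsCadlagPath fun t => J t ω)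
    (hNc : IsCadlagPath fun t => N t ω) (k j : Fin n) {s : ℝ≥0} (hs : 0 < s) :
    Function.leftLim (fun u => nextClaim J N C D k j u ω) s = allClaims C D (claimIndex k j
      (Function.leftLim (fun r => claimNumber J N k j r ω) s + 1)) ω := by
  have := nhdsLT_neBot hs
  apply leftLim_eq_of_tendsto
  exact tendsto_const_nhds.congr'
    ((nextClaim_eventually_left hJc hNc k j s).mono fun u hu => hu.symm)

/-- At a jump from `k` to `j`, the claim which was due is paid. -/
theorem riskProcess_of_isJump {x : ℝ} {ω : Ω} (hJc : IsCadlagPath fun t => J t ω)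
    (hNc : IsCadlagPath fun t => N t ω) (hNm : Monotone fun t => N t ω) {k j : Fin n} {s : ℝ≥0}
    (hs : 0 < s) (hj : IsJump k j (Function.leftLim (fun u => joint J N u ω) s) (joint J N s ω)) :
    riskProcess R x J N C D s ω = Function.leftLim (fun u => riskProcess R x J N C D u ω) s -
      Function.leftLim (fun u => nextClaim J N C D k j u ω) s := by
  have hl : Function.leftLim (fun u => joint J N u ω) s =
    (Function.leftLim (fun u => J u ω) s, Function.leftLim (fun u => N u ω) s) :=
      leftLim_prodMk hJc hNc s
  rw [hl] at hj
  obtain ⟨h1, h2, h3⟩ := hj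
  simp only [joint] at h1 h2 h3
  rw [leftLim_nextClaim hJc hNc k j hs]
  unfold claimIndex claimNumber
  by_cases hkj : k = j
  · simp only [if_pos hkj] at h3 ⊢
    rw [riskProcess_of_arrival hJc hNc hNm hs (by rw [h1, h2, hkj]) h3, h2, ← hkj]
    rfl
  · simp only [if_neg hkj] at h3 ⊢
    rw [riskProcess_of_transition hJc hNc ⟨hs, by rw [h1]; show k ≠ J s ω; rwa [h2]⟩ h3.symm, h1, h2]
    rfl

theorem measurable_history_chain {v r : ℝ≥0} (hr : r ≤ v) : Measurable[history J N C D v] (J r) :=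
  (measurable_pathInfo hr).mono (le_sup_of_le_right le_sup_left) le_rfl

theorem measurable_history_arrivals {v r : ℝ≥0} (hr : r ≤ v) :
    Measurable[history J N C D v] (N r) :=
  (measurable_pathInfo hr).mono (le_sup_of_le_right le_sup_right) le_rfl

theorem measurable_history_claims (v : ℝ≥0) (c : (Fin n × ℕ) ⊕ (Fin n × Fin n × ℕ)) :
    Measurable[history J N C D v] (allClaims C D c) :=
  (measurable_claims_claimInfo c).mono le_sup_left le_rfl

variable [mΩ : MeasurableSpace Ω] {μ : Measure Ω}

theorem IsRiskModel.measurable_risk_uncurry (h : IsRiskModel R i μ J N C D) (x : ℝ) :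
    Measurable fun z : Ω × ℝ≥0 => riskProcess R x J N C D z.2 z.1 :=
  measurable_uncurry_of_rightCts (fun _ => measurable_riskProcess_time R x
    (fun r _ => h.chain.measurable r) h.chain.cadlag (fun r _ => h.arrivals.measurable r)
    h.arrivals.cadlag h.arrivals.mono h.measurable_C h.measurable_D)
    fun ω s => riskProcess_rightCts (h.chain.cadlag ω) (h.arrivals.cadlag ω) s

theorem IsRiskModel.measurable_chain_uncurry (h : IsRiskModel R i μ J N C D) :
    Measurable fun z : Ω × ℝ≥0 => J z.2 z.1 :=
  measurable_uncurry_of_rightCts h.chain.measurable fun ω v => (h.chain.cadlag ω v).1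

theorem IsRiskModel.measurable_history_risk (h : IsRiskModel R i μ J N C D) (x : ℝ)
    (s : ℝ≥0) : Measurable[history J N C D s] (riskProcess R x J N C D s) :=
  @measurable_riskProcess_time n Ω (history J N C D s) J N C D R x s
    (fun _ => measurable_history_chain) h.chain.cadlag (fun _ => measurable_history_arrivals)
    h.arrivals.cadlag h.arrivals.mono (fun a m => measurable_history_claims s (Sum.inl (a, m)))
    fun a b m => measurable_history_claims s (Sum.inr (a, b, m))

theorem IsRiskModel.measurable_history_nextClaim (h : IsRiskModel R i μ J N C D) (k j : Fin n)
    (s : ℝ≥0) : Measurable[history J N C D s] (nextClaim J N C D k j s) :=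
  @measurable_comp_countable Ω ℝ ℕ (history J N C D s) _ _ _ _
    (fun m ω => allClaims C D (claimIndex k j (m + 1)) ω) (claimNumber J N k j s)
    (fun _ => measurable_history_claims s _)
    (@measurable_claimNumber n Ω J N (history J N C D s) s (fun _ => measurable_history_chain)
      h.chain.cadlag (measurable_history_arrivals le_rfl) k j)

theorem IsRiskModel.measurable_nextClaim_uncurry (h : IsRiskModel R i μ J N C D) (k j : Fin n) :
    Measurable fun z : Ω × ℝ≥0 => nextClaim J N C D k j z.2 z.1 :=
  measurable_uncurry_of_rightCts
    (fun s => (h.measurable_history_nextClaim k j s).mono (h.history_le s) le_rfl)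
    fun ω s => nextClaim_rightCts (h.chain.cadlag ω) (h.arrivals.cadlag ω) k j s

/-- The value which is contributed to the sum over the epochs if the process jumps from `k` to `j`,
as a predictable process. -/
def dueValue (R : RiskParameters n) (x : ℝ) (J : ℝ≥0 → Ω → Fin n) (N : ℝ≥0 → Ω → ℕ)
    (C : Fin n → ℕ → Ω → ℝ) (D : Fin n → Fin n → ℕ → Ω → ℝ)
    (F : ℝ≥0 × ℝ × ℝ × Fin n × Fin n → ℝ≥0∞) (k j : Fin n) (z : Ω × ℝ≥0) : ℝ≥0∞ :=
  F (z.2, if 0 < z.2 then Function.leftLim (fun u => riskProcess R x J N C D u z.1) z.2 else 0,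
    (if 0 < z.2 then Function.leftLim (fun u => riskProcess R x J N C D u z.1) z.2 else 0) -
      if 0 < z.2 then Function.leftLim (fun u => nextClaim J N C D k j u z.1) z.2 else 0, k, j)

theorem IsRiskModel.measurable_dueValue (h : IsRiskModel R i μ J N C D) (x : ℝ)
    {F : ℝ≥0 × ℝ × ℝ × Fin n × Fin n → ℝ≥0∞} (hF : Measurable F) (k j : Fin n) :
    Measurable[predictable (history J N C D)] (dueValue R x J N C D F k j) := by
  let _ := predictable (history J N C D)
  have h1 := measurable_snd_predictable (history J N C D)
  have h2 := measurable_leftLim_predictable (F := history J N C D)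
    (h.measurable_history_risk x)
    (fun ω s _ => ⟨_, tendsto_riskProcess_left (h.chain.cadlag ω) (h.arrivals.cadlag ω) s⟩) 0
  have h3 := measurable_leftLim_predictable (F := history J N C D)
    (h.measurable_history_nextClaim k j)
    (fun ω s _ => ⟨_, tendsto_const_nhds.congr' ((nextClaim_eventually_left (h.chain.cadlag ω)
      (h.arrivals.cadlag ω) k j s).mono fun u hu => hu.symm)⟩) 0
  exact hF.comp (h1.prodMk (h2.prodMk ((h2.sub h3).prodMk measurable_const)))

/-- The sum of a nonnegative function over the epochs in `(0, t]`. -/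
def epochSum (h : IsRiskModel R i μ J N C D) (x : ℝ)
    (F : ℝ≥0 × ℝ × ℝ × Fin n × Fin n → ℝ≥0∞) (t : ℝ≥0) (ω : Ω) : ℝ≥0∞ :=
  ∑ r ∈ (finite_jumpSet_Ioc (h.joint_cadlag ω) 0 t).toFinset,
    F (r, Function.leftLim (fun u => riskProcess R x J N C D u ω) r, riskProcess R x J N C D r ω,
      Function.leftLim (fun u => J u ω) r, J r ω)

/-- The integrand of the compensator of `epochSum`. -/
def compValue (R : RiskParameters n) (x : ℝ) (J : ℝ≥0 → Ω → Fin n) (N : ℝ≥0 → Ω → ℕ)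
    (C : Fin n → ℕ → Ω → ℝ) (D : Fin n → Fin n → ℕ → Ω → ℝ)
    (F : ℝ≥0 × ℝ × ℝ × Fin n × Fin n → ℝ≥0∞) (k j : Fin n) (z : ℝ × Ω × ℝ) : ℝ≥0∞ :=
  if J z.2.2.toNNReal z.2.1 = k then
    F (z.2.2.toNNReal, riskProcess R x J N C D z.2.2.toNNReal z.2.1,
      riskProcess R x J N C D z.2.2.toNNReal z.2.1 - z.1, k, j)
  else 0

theorem IsRiskModel.measurable_compValue (h : IsRiskModel R i μ J N C D) (x : ℝ)
    {F : ℝ≥0 × ℝ × ℝ × Fin n × Fin n → ℝ≥0∞} (hF : Measurable F) (k j : Fin n) :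
    Measurable (compValue R x J N C D F k j) := by
  have hs : Measurable fun z : ℝ × Ω × ℝ => z.2.2.toNNReal :=
    measurable_real_toNNReal.comp (measurable_snd.comp measurable_snd)
  have hz : Measurable fun z : ℝ × Ω × ℝ => (z.2.1, z.2.2.toNNReal) :=
    (measurable_fst.comp measurable_snd).prodMk hs
  have hX := (h.measurable_risk_uncurry x).comp hz
  refine Measurable.ite ((h.measurable_chain_uncurry.comp hz) (measurableSet_singleton k))
    (hF.comp (hs.prodMk (hX.prodMk ((hX.sub measurable_fst).prodMk measurable_const))))
    measurable_const

variable [IsProbabilityMeasure μ]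

theorem RiskParameters.isFiniteMeasure_nu (R : RiskParameters n) (k j : Fin n) :
    IsFiniteMeasure (R.nu k j) := by
  have := R.isProbabilityMeasure_jumpLaw k j
  rw [R.nu_eq]
  infer_instance

/-- The claim laws give no mass to negative numbers, so the restriction to `[0, ∞)` changes nothing.
-/
theorem RiskParameters.nu_restrict (R : RiskParameters n) (k j : Fin n) :
    (R.nu k j).restrict (Set.Ici 0) = jumpRate R k j • R.jumpLaw k j := by
  rw [R.nu_eq]
  apply Measure.restrict_eq_self_of_ae_mem
  rw [ae_iff]
  simp only [Set.mem_Ici, not_le]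
  exact (Measure.smul_apply _ _ _).trans (by
    rw [show {a : ℝ | a < 0} = Set.Iio 0 from rfl, R.jumpLaw_nonneg, smul_zero])

theorem IsRiskModel.ae_isJump (h : IsRiskModel R i μ J N C D) (t : ℝ≥0) :
    ∀ᵐ ω ∂μ, ∀ r ∈ jumpSet (fun u => joint J N u ω) ∩ Set.Ioc 0 t,
      IsJump (Function.leftLim (fun u => J u ω) r) (J r ω)
        (Function.leftLim (fun u => joint J N u ω) r) (joint J N r ω) := by
  have h0 := h.lintegral_jsum_irregularInd (zero_le (a := t))
  rw [lintegral_eq_zero_iff (measurable_jsum zero_le (fun r _ => h.measurable_joint r)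
    h.joint_cadlag irregularInd_self)] at h0
  filter_upwards [h0] with ω hω r hr
  have hfin := finite_jumpSet_Ioc (h.joint_cadlag ω) 0 t
  rw [jsum, finsum_mem_eq_finite_toFinset_sum _ hfin, Pi.zero_apply,
    Finset.sum_eq_zero_iff] at hω
  have h1 := hω r (hfin.mem_toFinset.2 hr)
  have hl : Function.leftLim (fun u => joint J N u ω) r =
    (Function.leftLim (fun u => J u ω) r, Function.leftLim (fun u => N u ω) r) :=
      leftLim_prodMk (h.chain.cadlag ω) (h.arrivals.cadlag ω) r
  by_contra hne
  unfold irregularInd at h1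
  rw [if_pos ⟨hr.1.2, by rw [hl] at hne ⊢; exact hne⟩] at h1
  exact one_ne_zero h1

/-- Almost surely each epoch is a jump of exactly one type, read off from the states before and
after it, and the claim then paid is the one that was due. This makes the summands predictable. -/
theorem IsRiskModel.ae_epochSum_eq (h : IsRiskModel R i μ J N C D) (x : ℝ)
    (F : ℝ≥0 × ℝ × ℝ × Fin n × Fin n → ℝ≥0∞) (t : ℝ≥0) :
    ∀ᵐ ω ∂μ, epochSum h x F t ω = ∑ k, ∑ j,
      ∑ r ∈ (finite_jumpSet_Ioc (h.joint_cadlag ω) 0 t).toFinset,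
        jumpInd k j (Function.leftLim (fun u => joint J N u ω) r) (joint J N r ω) *
          dueValue R x J N C D F k j (ω, r) := by
  filter_upwards [h.ae_isJump t] with ω hω
  have hfin := finite_jumpSet_Ioc (h.joint_cadlag ω) 0 t
  rw [epochSum, Finset.sum_congr rfl fun k _ => Finset.sum_comm, Finset.sum_comm]
  refine Finset.sum_congr rfl fun r hr => ?_
  have hj := hω r (hfin.mem_toFinset.1 hr)
  have hr0 : 0 < r := (hfin.mem_toFinset.1 hr).1.1
  rw [Finset.sum_eq_single (Function.leftLim (fun u => J u ω) r),
    Finset.sum_eq_single (J r ω)]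
  · rw [jumpInd, if_pos hj, one_mul, dueValue]
    simp only [if_pos hr0]
    rw [riskProcess_of_isJump (h.chain.cadlag ω) (h.arrivals.cadlag ω) (h.arrivals.mono ω) hr0 hj]
  · intro j _ hne
    rw [jumpInd, if_neg fun hj' => hne (hj'.2.1.symm.trans hj.2.1), zero_mul]
  · simp
  · intro k _ hne
    refine Finset.sum_eq_zero fun j _ => ?_
    rw [jumpInd, if_neg fun hj' => hne (hj'.1.symm.trans hj.1), zero_mul]
  · simp

/-- Measurability is inherited from the predictable representation, which holds only off the null
set of paths with irregular jumps. -/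
theorem IsRiskModel.aemeasurable_epochSum (h : IsRiskModel R i μ J N C D) (x : ℝ)
    {F : ℝ≥0 × ℝ × ℝ × Fin n × Fin n → ℝ≥0∞} (hF : Measurable F) (t : ℝ≥0) :
    AEMeasurable (epochSum h x F t) μ :=
  ⟨_, Finset.measurable_fun_sum _ fun k _ => Finset.measurable_fun_sum _ fun j _ =>
    (h.lintegral_sum_jumps k j t (h.measurable_dueValue x hF k j)).1, h.ae_epochSum_eq x F t⟩

/-- The compensation of one kind of jumps. -/
theorem IsRiskModel.lintegral_dueValue (h : IsRiskModel R i μ J N C D) (x : ℝ)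
    {F : ℝ≥0 × ℝ × ℝ × Fin n × Fin n → ℝ≥0∞} (hF : Measurable F) (k j : Fin n) (t : ℝ≥0) :
    ∫⁻ ω, (∫⁻ s in Set.Ioc (0 : ℝ) t, ENNReal.ofReal (stateRate R k j (J s.toNNReal ω)) *
      dueValue R x J N C D F k j (ω, s.toNNReal)) ∂μ =
    ∫⁻ z, compValue R x J N C D F k j z ∂(((R.nu k j).restrict (Set.Ici 0)).prod
        (μ.prod (volume.restrict (Set.Ioc (0 : ℝ) t)))) := by
  have hprob := R.isProbabilityMeasure_jumpLaw k j
  have hz : Measurable fun z : Ω × ℝ => (z.1, z.2.toNNReal) :=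
    measurable_fst.prodMk (measurable_real_toNNReal.comp measurable_snd)
  have hs : Measurable fun z : Ω × ℝ => z.2.toNNReal := measurable_real_toNNReal.comp measurable_snd
  have hX := (h.measurable_risk_uncurry x).comp hz
  have hξ := (h.measurable_nextClaim_uncurry k j).comp hz
  have hJ := h.measurable_chain_uncurry.comp hz
  have hm : Measurable fun z : Ω × ℝ =>
      ENNReal.ofReal (stateRate R k j (J z.2.toNNReal z.1)) *
        F (z.2.toNNReal, riskProcess R x J N C D z.2.toNNReal z.1,
          riskProcess R x J N C D z.2.toNNReal z.1 - nextClaim J N C D k j z.2.toNNReal z.1, k, j) :=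
    ((measurable_of_countable (stateRate R k j)).comp hJ).ennreal_ofReal.mul
      (hF.comp (hs.prodMk (hX.prodMk ((hX.sub hξ).prodMk measurable_const))))
  have h1 : ∀ ω, ∫⁻ s in Set.Ioc (0 : ℝ) t, ENNReal.ofReal (stateRate R k j (J s.toNNReal ω)) *
      dueValue R x J N C D F k j (ω, s.toNNReal) =
      ∫⁻ s in Set.Ioc (0 : ℝ) t, ENNReal.ofReal (stateRate R k j (J s.toNNReal ω)) *
        F (s.toNNReal, riskProcess R x J N C D s.toNNReal ω,
          riskProcess R x J N C D s.toNNReal ω - nextClaim J N C D k j s.toNNReal ω, k, j) := by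
    intro ω
    -- Left limits differ from values at jump times only, which are finitely many and hence
    -- invisible to `ds`.
    have hfin : ((fun r : ℝ≥0 => (r : ℝ)) ''
        (jumpSet (fun u => joint J N u ω) ∩ Set.Ioc 0 t)).Finite :=
      (finite_jumpSet_Ioc (h.joint_cadlag ω) 0 t).image _
    refine lintegral_congr_ae ?_
    filter_upwards [ae_restrict_mem measurableSet_Ioc,
      ae_restrict_of_ae (compl_mem_ae_iff.2 (hfin.measure_zero volume))] with s hs hsj
    have hs0 : 0 < s.toNNReal := Real.toNNReal_pos.2 hs.1
    have hns : s.toNNReal ∉ jumpSet fun u => joint J N u ω := fun hmem => hsj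
      ⟨s.toNNReal, ⟨hmem, hs0, Real.toNNReal_le_iff_le_coe.2 hs.2⟩, Real.coe_toNNReal s hs.1.le⟩
    have hjl : Function.leftLim (fun u => joint J N u ω) s.toNNReal = joint J N s.toNNReal ω := by
      by_contra hne
      exact hns ⟨hs0, hne⟩
    rw [show Function.leftLim (fun u => joint J N u ω) s.toNNReal =
      (Function.leftLim (fun u => J u ω) s.toNNReal, Function.leftLim (fun u => N u ω) s.toNNReal)
      from leftLim_prodMk (h.chain.cadlag ω) (h.arrivals.cadlag ω) _] at hjl
    have hJl : Function.leftLim (fun u => J u ω) s.toNNReal = J s.toNNReal ω :=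
      congrArg Prod.fst hjl
    have hNl : Function.leftLim (fun u => N u ω) s.toNNReal = N s.toNNReal ω :=
      congrArg Prod.snd hjl
    have hcl : Function.leftLim (fun u => claimNumber J N k j u ω) s.toNNReal =
        claimNumber J N k j s.toNNReal ω := by
      unfold claimNumber
      split_ifs
      exacts [hNl, jumpCount_eq_leftLim (h.chain.cadlag ω) hJl]
    simp only [dueValue, if_pos hs0, leftLim_nextClaim (h.chain.cadlag ω) (h.arrivals.cadlag ω) k j
      hs0, hcl, riskProcess_eq_leftLim (h.chain.cadlag ω) (h.arrivals.cadlag ω) hJl hNl]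
    rfl
  have hcomp := h.measurable_compValue x hF k j
  -- Time is made the outermost variable on both sides, so that `IsRiskModel.lintegral_nextClaim`
  -- applies for each fixed `s`.
  rw [lintegral_congr h1, lintegral_lintegral_swap hm.aemeasurable, R.nu_restrict,
    lintegral_prod_symm _ hcomp.aemeasurable,
    lintegral_prod_symm _ (hcomp.lintegral_prod_left').aemeasurable]
  refine lintegral_congr fun s => ?_
  have hψ : Measurable fun z : (ℝ × Fin n) × ℝ => ENNReal.ofReal (stateRate R k j z.1.2) *
      F (s.toNNReal, z.1.1, z.1.1 - z.2, k, j) := by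
    have h2 : Measurable fun z : (ℝ × Fin n) × ℝ => z.1.1 := measurable_fst.comp measurable_fst
    exact ((measurable_of_countable (stateRate R k j)).comp
      (measurable_snd.comp measurable_fst)).ennreal_ofReal.mul (hF.comp
        (measurable_const.prodMk (h2.prodMk ((h2.sub measurable_snd).prodMk measurable_const))))
  refine (h.lintegral_nextClaim x k j s.toNNReal hψ).trans (lintegral_congr fun ω => ?_)
  rw [lintegral_smul_measure, ENNReal.smul_def, smul_eq_mul, ← lintegral_const_mul]
  · refine lintegral_congr fun y => ?_
    unfold compValue stateRate
    split_ifs <;> simp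
  · exact hcomp.comp (measurable_id.prodMk measurable_const)

/-- The compensation formula for nonnegative functions. -/
theorem IsRiskModel.lintegral_epochSum (h : IsRiskModel R i μ J N C D) (x : ℝ)
    {F : ℝ≥0 × ℝ × ℝ × Fin n × Fin n → ℝ≥0∞} (hF : Measurable F) (t : ℝ≥0) :
    ∫⁻ ω, epochSum h x F t ω ∂μ = ∑ k, ∑ j, ∫⁻ z, compValue R x J N C D F k j z
      ∂(((R.nu k j).restrict (Set.Ici 0)).prod
        (μ.prod (volume.restrict (Set.Ioc (0 : ℝ) t)))) := by
  rw [lintegral_congr_ae (h.ae_epochSum_eq x F t), lintegral_finsetSum]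
  · refine Finset.sum_congr rfl fun k _ => ?_
    rw [lintegral_finsetSum]
    · refine Finset.sum_congr rfl fun j _ => ?_
      rw [(h.lintegral_sum_jumps k j t (h.measurable_dueValue x hF k j)).2,
        h.lintegral_dueValue x hF k j t]
    · exact fun j _ => (h.lintegral_sum_jumps k j t (h.measurable_dueValue x hF k j)).1
  · exact fun k _ => Finset.measurable_fun_sum _ fun j _ =>
      (h.lintegral_sum_jumps k j t (h.measurable_dueValue x hF k j)).1

end JumpSum

/-! ### Bounded functions: positive and negative parts -/

section Main

variable {n : ℕ} {Ω : Type*} {R : RiskParameters n} {i : Fin n} {J : ℝ≥0 → Ω → Fin n}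
  {N : ℝ≥0 → Ω → ℕ} {C : Fin n → ℕ → Ω → ℝ} {D : Fin n → Fin n → ℕ → Ω → ℝ}

/-- The function `f` with values in `[0, ∞]`, with its arguments in a tuple. -/
def posPart (f : ℝ≥0 → ℝ → ℝ → Fin n → Fin n → ℝ) (z : ℝ≥0 × ℝ × ℝ × Fin n × Fin n) : ℝ≥0∞ :=
  ENNReal.ofReal (f z.1 z.2.1 z.2.2.1 z.2.2.2.1 z.2.2.2.2)

theorem compValue_posPart (f : ℝ≥0 → ℝ → ℝ → Fin n → Fin n → ℝ) (x : ℝ) (k j : Fin n)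
    (z : ℝ × Ω × ℝ) : compValue R x J N C D (posPart f) k j z =
      ENNReal.ofReal (compIntegrand f (riskProcess R x J N C D) J k j z.1 z.2.1 z.2.2.toNNReal) := by
  unfold compValue compIntegrand
  split_ifs <;> simp [posPart]

theorem compIntegrand_neg (f : ℝ≥0 → ℝ → ℝ → Fin n → Fin n → ℝ) (X : ℝ≥0 → Ω → ℝ) (k j : Fin n)
    (y : ℝ) (ω : Ω) (s : ℝ≥0) :
    compIntegrand (fun s u v k j => -f s u v k j) X J k j y ω s =
      -compIntegrand f X J k j y ω s := by
  unfold compIntegrand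
  split_ifs <;> simp

variable [mΩ : MeasurableSpace Ω] {μ : Measure Ω}

theorem jumpSum_eq_sum (h : IsRiskModel R i μ J N C D) (f : ℝ≥0 → ℝ → ℝ → Fin n → Fin n → ℝ)
    (X : ℝ≥0 → Ω → ℝ) (t : ℝ≥0) (ω : Ω) :
    jumpSum f X J N t ω = ∑ r ∈ (finite_jumpSet_Ioc (h.joint_cadlag ω) 0 t).toFinset,
      f r (Function.leftLim (fun u => X u ω) r) (X r ω) (Function.leftLim (fun u => J u ω) r)
        (J r ω) := by
  have hset : epochs J N ω ∩ Set.Iic t = jumpSet (fun u => joint J N u ω) ∩ Set.Ioc 0 t := by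
    rw [show jumpSet (fun u => joint J N u ω) = epochs J N ω from
      jumpSet_prodMk (h.chain.cadlag ω) (h.arrivals.cadlag ω)]
    ext r
    simp only [Set.mem_inter_iff, Set.mem_Ioc, Set.mem_Iic]
    exact ⟨fun hr => ⟨hr.1, hr.1.elim And.left And.left, hr.2⟩, fun hr => ⟨hr.1, hr.2.2⟩⟩
  rw [jumpSum, hset, finsum_mem_eq_finite_toFinset_sum _ (finite_jumpSet_Ioc (h.joint_cadlag ω) 0 t)]

/-- `ENNReal.ofReal` truncates at zero, so applying `posPart` to `-f` yields the negative part of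
`f`. -/
theorem jumpSum_eq_sub (h : IsRiskModel R i μ J N C D) (x : ℝ)
    (f : ℝ≥0 → ℝ → ℝ → Fin n → Fin n → ℝ) (t : ℝ≥0) (ω : Ω) :
    jumpSum f (riskProcess R x J N C D) J N t ω =
      (epochSum h x (posPart f) t ω).toReal -
        (epochSum h x (posPart fun s u v k j => -f s u v k j) t ω).toReal := by
  rw [jumpSum_eq_sum h, epochSum, epochSum, ENNReal.toReal_sum (by simp [posPart]),
    ENNReal.toReal_sum (by simp [posPart]), ← Finset.sum_sub_distrib]
  refine Finset.sum_congr rfl fun r _ => ?_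
  simp only [posPart, ENNReal.toReal_ofReal']
  exact (max_zero_sub_eq_self _).symm

theorem IsRiskModel.measurable_compIntegrand (h : IsRiskModel R i μ J N C D) (x : ℝ)
    {f : ℝ≥0 → ℝ → ℝ → Fin n → Fin n → ℝ}
    (hf : Measurable fun z : ℝ≥0 × ℝ × ℝ × Fin n × Fin n =>
      f z.1 z.2.1 z.2.2.1 z.2.2.2.1 z.2.2.2.2) (k j : Fin n) :
    Measurable fun z : ℝ × Ω × ℝ =>
      compIntegrand f (riskProcess R x J N C D) J k j z.1 z.2.1 z.2.2.toNNReal := by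
  have hs : Measurable fun z : ℝ × Ω × ℝ => z.2.2.toNNReal :=
    measurable_real_toNNReal.comp (measurable_snd.comp measurable_snd)
  have hz : Measurable fun z : ℝ × Ω × ℝ => (z.2.1, z.2.2.toNNReal) :=
    (measurable_fst.comp measurable_snd).prodMk hs
  have hX := (h.measurable_risk_uncurry x).comp hz
  have hkj : Measurable fun _ : ℝ × Ω × ℝ => (k, j) := measurable_const
  exact Measurable.ite ((h.measurable_chain_uncurry.comp hz) (measurableSet_singleton k))
    (hf.comp (hs.prodMk (hX.prodMk ((hX.sub measurable_fst).prodMk hkj)))) measurable_const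

theorem IsRiskModel.integrable_compIntegrand [IsProbabilityMeasure μ]
    (h : IsRiskModel R i μ J N C D) (x : ℝ) {f : ℝ≥0 → ℝ → ℝ → Fin n → Fin n → ℝ}
    (hf : Measurable fun z : ℝ≥0 × ℝ × ℝ × Fin n × Fin n =>
      f z.1 z.2.1 z.2.2.1 z.2.2.2.1 z.2.2.2.2)
    (hbdd : ∃ M : ℝ, ∀ s u v k j, |f s u v k j| ≤ M) (t : ℝ≥0) (k j : Fin n) :
    Integrable (fun z : ℝ × Ω × ℝ =>
        compIntegrand f (riskProcess R x J N C D) J k j z.1 z.2.1 z.2.2.toNNReal)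
      (((R.nu k j).restrict (Set.Ici 0)).prod
        (μ.prod (volume.restrict (Set.Ioc (0 : ℝ) t)))) := by
  have := R.isFiniteMeasure_nu k j
  obtain ⟨M, hM⟩ := hbdd
  refine Integrable.of_bound (h.measurable_compIntegrand x hf k j).aestronglyMeasurable M
    (Eventually.of_forall fun z => ?_)
  unfold compIntegrand
  split_ifs
  · exact hM _ _ _ _ _
  · simpa using (abs_nonneg _).trans (hM 0 0 0 k j)

theorem IsRiskModel.epochSum_posPart [IsProbabilityMeasure μ]
    (h : IsRiskModel R i μ J N C D) (x : ℝ) {f : ℝ≥0 → ℝ → ℝ → Fin n → Fin n → ℝ}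
    (hf : Measurable fun z : ℝ≥0 × ℝ × ℝ × Fin n × Fin n =>
      f z.1 z.2.1 z.2.2.1 z.2.2.2.1 z.2.2.2.2)
    (hbdd : ∃ M : ℝ, ∀ s u v k j, |f s u v k j| ≤ M) (t : ℝ≥0) :
    Integrable (fun ω => (epochSum h x (posPart f) t ω).toReal) μ ∧
    ∫ ω, (epochSum h x (posPart f) t ω).toReal ∂μ = ∑ k, ∑ j, (∫⁻ z : ℝ × Ω × ℝ,
      ENNReal.ofReal (compIntegrand f (riskProcess R x J N C D) J k j z.1 z.2.1 z.2.2.toNNReal)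
      ∂(((R.nu k j).restrict (Set.Ici 0)).prod
        (μ.prod (volume.restrict (Set.Ioc (0 : ℝ) t))))).toReal := by
  have hF : Measurable (posPart f) := hf.ennreal_ofReal
  have hae := h.aemeasurable_epochSum x hF t
  have hfin : ∀ k j, ∫⁻ z : ℝ × Ω × ℝ,
      ENNReal.ofReal (compIntegrand f (riskProcess R x J N C D) J k j z.1 z.2.1 z.2.2.toNNReal)
      ∂(((R.nu k j).restrict (Set.Ici 0)).prod
        (μ.prod (volume.restrict (Set.Ioc (0 : ℝ) t)))) ≠ ∞ := fun k j =>
    (h.integrable_compIntegrand x hf hbdd t k j).lintegral_lt_top.ne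
  have heq := h.lintegral_epochSum x hF t
  simp only [compValue_posPart] at heq
  have hne : ∫⁻ ω, epochSum h x (posPart f) t ω ∂μ ≠ ∞ := by
    rw [heq]
    exact ENNReal.sum_ne_top.2 fun k _ => ENNReal.sum_ne_top.2 fun j _ => hfin k j
  refine ⟨integrable_toReal_of_lintegral_ne_top hae hne, ?_⟩
  rw [integral_toReal hae (ae_lt_top' hae hne), heq, ENNReal.toReal_sum fun k _ =>
    ENNReal.sum_ne_top.2 fun j _ => hfin k j]
  exact Finset.sum_congr rfl fun k _ => ENNReal.toReal_sum fun j _ => hfin k j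

end Main

end MMRisk

end

theorem theorem4p1 {n : ℕ} (R : MMRisk.RiskParameters n) {Ω : Type*} [MeasurableSpace Ω]
    (μ : Measure Ω) [IsProbabilityMeasure μ] (x : ℝ) (i : Fin n)
    (J : ℝ≥0 → Ω → Fin n) (N : ℝ≥0 → Ω → ℕ)
    (C : Fin n → ℕ → Ω → ℝ) (D : Fin n → Fin n → ℕ → Ω → ℝ)
    (hmodel : MMRisk.IsRiskModel R i μ J N C D)
    (X : ℝ≥0 → Ω → ℝ) (hX : X = MMRisk.riskProcess R x J N C D)
    (f : ℝ≥0 → ℝ → ℝ → Fin n → Fin n → ℝ)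
    (hf : Measurable fun z : ℝ≥0 × ℝ × ℝ × Fin n × Fin n =>
      f z.1 z.2.1 z.2.2.1 z.2.2.2.1 z.2.2.2.2)
    (hbdd : ∃ M : ℝ, ∀ s u v k j, |f s u v k j| ≤ M)
    (t : ℝ≥0) :
    Integrable (MMRisk.jumpSum f X J N t) μ ∧
    (∀ k j, Integrable (fun z : ℝ × Ω × ℝ =>
        MMRisk.compIntegrand f X J k j z.1 z.2.1 z.2.2.toNNReal)
      (((R.nu k j).restrict (Set.Ici 0)).prod
        (μ.prod (volume.restrict (Set.Ioc (0 : ℝ) t))))) ∧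
    ∫ ω, MMRisk.jumpSum f X J N t ω ∂μ =
      ∑ k, ∑ j, ∫ y in Set.Ici (0 : ℝ), (∫ ω, (∫ s in (0 : ℝ)..(t : ℝ),
        MMRisk.compIntegrand f X J k j y ω s.toNNReal) ∂μ) ∂(R.nu k j) := by
  subst hX
  have hint := hmodel.integrable_compIntegrand x hf hbdd t
  obtain ⟨hp, hpi⟩ := hmodel.epochSum_posPart x hf hbdd t
  obtain ⟨hq, hqi⟩ := hmodel.epochSum_posPart x (f := fun s u v k j => -f s u v k j) hf.neg
    (by simpa only [abs_neg] using hbdd) t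
  have hsum := funext (MMRisk.jumpSum_eq_sub hmodel x f t)
  refine ⟨hsum ▸ hp.sub hq, hint, ?_⟩
  rw [hsum, integral_sub hp hq, hpi, hqi, ← Finset.sum_sub_distrib]
  refine Finset.sum_congr rfl fun k _ => ?_
  rw [← Finset.sum_sub_distrib]
  refine Finset.sum_congr rfl fun j _ => ?_
  have := R.isFiniteMeasure_nu k j
  simp only [MMRisk.compIntegrand_neg]
  -- The two parts recombine into one integral over the product space, and Fubini, applied twice,
  -- gives the iterated integral.
  rw [← integral_eq_lintegral_pos_part_sub_lintegral_neg_part (hint k j), integral_prod _ (hint k j)]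
  refine integral_congr_ae ?_
  filter_upwards [(hint k j).prod_right_ae] with y hy
  rw [integral_prod _ hy]
  simp only [intervalIntegral.integral_of_le t.coe_nonneg]
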